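/- Let $n\ge 1$, $m\ge 2$, $k\ge 1$ be integers, let $1<q<p<\infty$ and $p_1,\dots,p_m\in(1,\infty)$ with $\frac1p=\sum_{i=1}^m\frac1{p_i}$, and put $\frac1r:=\frac1q-\frac1p$. All function spaces are over $\mathbb R^n$ with Lebesgue measure; functions are complex-valued unless said otherwise. **Non-degenerate operators.** Let $s_1,\dots,s_m\in(1,\infty]$ with $\frac1{s_0}:=\sum_i\frac1{s_i}\in(0,\infty)$, and let $T$ be an $m$-linear operator that is bounded from $L^{s_1}\times\cdots\times L^{s_m}$ to $L^{s_0}$. In a slot with $s_i=\infty$, $T$ is understood to be the extension of its values on $C_c^\infty$ by bounded a.e. convergence: if $g_N\in C_c^\infty$ are uniformly bounded and $g_N\to f_i$ a.e., then $T(f_1,\dots,g_N,\dots,f_m)\to T(f_1,\dots,f_i,\dots,f_m)$ in measure. Then $T$ is called a non-degenerate $m$-linear Calderón–Zygmund operator if there are a function $K(x,y_1,\dots,y_m)\in\mathbb C$, defined off the diagonal $x=y_1=\cdots=y_m$ of $(\mathbb R^n)^{m+1}$, constants $C,c_0>0$, and an increasing $\omega:[0,1)\to[0,\infty)$ with $\omega(t)\to0$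 as $t\to0^+$, such that: 1. $|K(x,y_1,\dots,y_m)|\le C\big(\sum_{i}|x-y_i|\big)^{-mn}$ off the diagonal; 2. off the diagonal, and for all $h\in\mathbb R^n$ with $|h|\le\frac12\max_i|x-y_i|$, $$|K(x+h,y_1,\dots,y_m)-K(x,y_1,\dots,y_m)|+\sum_{i=1}^m|K(x,y_1,\dots,y_i+h,\dots,y_m)-K(x,y_1,\dots,y_m)|\le\frac{C}{(\sum_i|x-y_i|)^{mn}}\,\omega\!\left(\frac{|h|}{\sum_i|x-y_i|}\right);$$ 3. for all $f_1,\dots,f_m\in C_c^\infty$ and a.e. $x\notin\bigcap_i\operatorname{supp}f_i$, $\;T(f_1,\dots,f_m)(x)=\int_{\mathbb R^{mn}}K(x,y_1,\dots,y_m)\prod_i f_i(y_i)\,dy_1\cdots dy_m$; 4. for every $y\in\mathbb R^n$ and $\rho>0$ there is $x\in\mathbb R^n\setminus B(y,\rho)$ with $|K(x,y,\dots,y)|\ge\frac1{c_0\rho^{mn}}$. **Iterated commutators.** For a real-valued function $b$ let $[b,S]_1(f_1,\dots,f_m):=b\,S(f_1,\dots,f_m)-S(bf_1,f_2,\dots,f_m)$,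 $T^{(0)}_{b,1}:=T$ and $T^{(k)}_{b,1}:=[b,T^{(k-1)}_{b,1}]_1$. We say that $T^{(k)}_{b,1}$ is bounded from $L^{p_1}\times\cdots\times L^{p_m}$ to $L^q$ if there is a constant $A<\infty$ with $\|T^{(k)}_{b,1}(f_1,\dots,f_m)\|_{L^q}\le A\prod_i\|f_i\|_{L^{p_i}}$ for all $f_i\in L^{p_i}$ at which the commutator is defined through $T$, i.e. $f_i\in L^{s_i}$ for all $i$ and $b^jf_1\in L^{s_1}$ for $0\le j\le k$. **Theorem.** Let $T$ be a non-degenerate $m$-linear Calderón–Zygmund operator and let $b\in L^k_{\mathrm{loc}}(\mathbb R^n)$ be real-valued. If $T^{(k)}_{b,1}$ is bounded from $L^{p_1}\times\cdots\times L^{p_m}$ to $L^q$, then $b\in\dot L^{kr}(\mathbb R^n)$, that is, $b\in L^{kr}_{\mathrm{loc}}(\mathbb R^n)$ and $\inf_{c\in\mathbb R}\|b-c\|_{L^{kr}}<\infty$. -/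

import Mathlib

open MeasureTheory Filter Topology
open scoped ENNReal NNReal

noncomputable section

/-- The Euclidean space `ℝⁿ` with its Euclidean norm and Lebesgue measure. -/
abbrev RSpace (n : ℕ) : Type := EuclideanSpace ℝ (Fin n)

/-- Operators acting on `m`-tuples of complex-valued functions on `ℝⁿ`. -/
abbrev TupleOp (n m : ℕ) : Type := (Fin m → RSpace n → ℂ) → RSpace n → ℂ

/-! ### Function spaces -/

/-- `b ∈ L^u_loc(ℝⁿ)`: `b` is in `L^u` of every ball. -/
def MemLpLoc {n : ℕ} (u : ℝ≥0∞) (b : RSpace n → ℝ) : Prop :=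
  ∀ (z : RSpace n) (R : ℝ), MemLp b u (volume.restrict (Metric.ball z R))

/-- The space of real `L^u` functions modulo constants: `b ∈ L^u_loc(ℝⁿ)` and
`inf_c ‖b - c‖_{L^u} < ∞`. -/
def MemLpModConst {n : ℕ} (u : ℝ≥0∞) (b : RSpace n → ℝ) : Prop :=
  MemLpLoc u b ∧ (⨅ c : ℝ, eLpNorm (fun x => b x - c) u volume) < ∞

/-- Test functions: `f ∈ C_c^∞(ℝⁿ)`, complex-valued. -/
def IsTestFunction {n : ℕ} (f : RSpace n → ℂ) : Prop :=
  ContDiff ℝ (⊤ : ℕ∞) f ∧ HasCompactSupport f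

open Classical in
/-- The class in `L^u` of a function `f`; it is only used for `f ∈ L^u`, where it is the usual
class (outside `L^u` it is `0`). -/
def lpClass {n : ℕ} (u : ℝ≥0∞) (f : RSpace n → ℂ) : Lp ℂ u (volume : Measure (RSpace n)) :=
  if h : MemLp f u volume then h.toLp f else 0

theorem lpClass_coe {n : ℕ} {u : ℝ≥0∞} {f : RSpace n → ℂ} (h : MemLp f u volume) :
    lpClass u f =ᵐ[volume] f := by
  rw [lpClass, dif_pos h]
  exact h.coeFn_toLp

/-! ### Multilinear Calderón–Zygmund operators -/

/-- The type of `m`-linear maps from `L^{s₁} × ⋯ × L^{s_m}` to `L^{s₀}`. -/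
abbrev LpMultilinear (n m : ℕ) (s : Fin m → ℝ≥0∞) (s₀ : ℝ≥0∞) : Type :=
  MultilinearMap ℂ (fun i => Lp ℂ (s i) (volume : Measure (RSpace n)))
    (Lp ℂ s₀ (volume : Measure (RSpace n)))

/-- An `m`-linear map between Lebesgue spaces, read as an operator on tuples of functions
`f_i ∈ L^{s_i}`. -/
def LpMultilinear.onFunctions {n m : ℕ} {s : Fin m → ℝ≥0∞} {s₀ : ℝ≥0∞}
    (T : LpMultilinear n m s s₀) : TupleOp n m :=
  fun f => ⇑(T fun i => lpClass (s i) (f i))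

/-- `K`, a function off the diagonal `x = y₁ = ⋯ = y_m`, satisfies the size condition and the
regularity condition with modulus of continuity `ω`, where `ω : [0,1) → [0,∞)` is increasing
and `ω(t) → 0` as `t → 0⁺`. The condition `∃ i, ‖h‖ ≤ ‖x - y i‖ / 2` says that
`‖h‖ ≤ (1/2) max_i ‖x - y i‖`. -/
structure IsMultilinearCZKernel {n m : ℕ} (K : RSpace n → (Fin m → RSpace n) → ℂ)
    (C : ℝ) (ω : ℝ → ℝ) : Prop where
  modulus_nonneg : ∀ t ∈ Set.Ico (0 : ℝ) 1, 0 ≤ ω t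
  modulus_mono : MonotoneOn ω (Set.Ico (0 : ℝ) 1)
  modulus_tendsto : Tendsto ω (𝓝[>] 0) (𝓝 0)
  size : ∀ (x : RSpace n) (y : Fin m → RSpace n), (¬ ∀ i, y i = x) →
    ‖K x y‖ ≤ C / (∑ i, ‖x - y i‖) ^ (m * n)
  regularity : ∀ (x : RSpace n) (y : Fin m → RSpace n) (h : RSpace n), (¬ ∀ i, y i = x) →
    (∃ i, ‖h‖ ≤ 1 / 2 * ‖x - y i‖) →
    ‖K (x + h) y - K x y‖ + ∑ i, ‖K x (Function.update y i (y i + h)) - K x y‖ ≤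
      C / (∑ i, ‖x - y i‖) ^ (m * n) * ω (‖h‖ / ∑ i, ‖x - y i‖)

/-- `K` is non-degenerate: for all `y` and all `ρ > 0` there is `x ∉ B(y, ρ)` such that
`|K(x, y, …, y)| ≥ 1 / (c₀ ρ^{mn})`. -/
def IsNondegenerateKernel {n m : ℕ} (K : RSpace n → (Fin m → RSpace n) → ℂ) : Prop :=
  ∃ c₀ : ℝ, 0 < c₀ ∧ ∀ (y : RSpace n) (ρ : ℝ), 0 < ρ →
    ∃ x : RSpace n, x ∉ Metric.ball y ρ ∧ 1 / (c₀ * ρ ^ (m * n)) ≤ ‖K x fun _ => y‖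

/-- `S` is represented by the kernel `K` off the intersection of the supports of test
functions. -/
def IsRepresentedBy {n m : ℕ} (S : TupleOp n m)
    (K : RSpace n → (Fin m → RSpace n) → ℂ) : Prop :=
  ∀ f : Fin m → RSpace n → ℂ, (∀ i, IsTestFunction (f i)) →
    ∀ᵐ x ∂(volume : Measure (RSpace n)), x ∉ ⋂ i, tsupport (f i) →
      S f x = ∫ y : Fin m → RSpace n, K x y * ∏ i, f i (y i)

/-- `T` is bounded from `L^{s₁} × ⋯ × L^{s_m}` to `L^{s₀}`, where `s_i ∈ (1, ∞]` and
`1/s₀ = ∑ 1/s_i ∈ (0, ∞)`. In a slot with `s_i = ∞`, where test functions are not dense in norm,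
`T` is the extension of its values on test functions by bounded a.e. convergence. -/
structure IsInitiallyBounded {n m : ℕ} {s : Fin m → ℝ≥0∞} {s₀ : ℝ≥0∞}
    (T : LpMultilinear n m s s₀) : Prop where
  one_lt : ∀ i, 1 < s i
  scaling : s₀⁻¹ = ∑ i, (s i)⁻¹
  ne_top : s₀ ≠ ∞
  bound : ∃ C : ℝ≥0, ∀ f : (i : Fin m) → Lp ℂ (s i) (volume : Measure (RSpace n)),
    eLpNorm (T f) s₀ volume ≤ C * ∏ i, eLpNorm (f i) (s i) volume
  extension_top : ∀ i, s i = ∞ → ∀ f : Fin m → RSpace n → ℂ,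
    (∀ l, MemLp (f l) (s l) volume) → ∀ g : ℕ → RSpace n → ℂ, (∀ N, IsTestFunction (g N)) →
    (∃ M : ℝ, ∀ N x, ‖g N x‖ ≤ M) →
    (∀ᵐ x ∂(volume : Measure (RSpace n)), Tendsto (fun N => g N x) atTop (𝓝 (f i x))) →
    TendstoInMeasure volume (fun N => T.onFunctions (Function.update f i (g N))) atTop
      (T.onFunctions f)

/-- `T` is a non-degenerate `m`-linear Calderón–Zygmund operator. -/
structure IsNondegenerateCZO {n m : ℕ} {s : Fin m → ℝ≥0∞} {s₀ : ℝ≥0∞}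
    (T : LpMultilinear n m s s₀) : Prop where
  initiallyBounded : IsInitiallyBounded T
  kernel : ∃ (K : RSpace n → (Fin m → RSpace n) → ℂ) (C : ℝ) (ω : ℝ → ℝ),
    IsMultilinearCZKernel K C ω ∧ IsRepresentedBy T.onFunctions K ∧ IsNondegenerateKernel K

/-! ### Iterated commutators -/

/-- The commutator in slot `i`:
`[b, S]_i (f₁, …, f_m) = b S(f₁, …, f_m) - S(f₁, …, b f_i, …, f_m)`. -/
def slotCommutator {n m : ℕ} (b : RSpace n → ℝ) (i : Fin m) (S : TupleOp n m) : TupleOp n m :=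
  fun f x => (b x : ℂ) * S f x - S (Function.update f i fun z => (b z : ℂ) * f i z) x

/-- The iterated commutator: `S^{(0)} = S` and `S^{(k+1)} = [b, S^{(k)}]_i`. -/
def iteratedCommutator {n m : ℕ} (b : RSpace n → ℝ) (i : Fin m) : ℕ → TupleOp n m → TupleOp n m
  | 0, S => S
  | k + 1, S => slotCommutator b i (iteratedCommutator b i k S)

/-- The functions `(f₁, …, f_m)` in `L^{p₁} × ⋯ × L^{p_m}` at which the `k`-th iterated
commutator in slot `i` of an operator on `L^{s₁} × ⋯ × L^{s_m}` is defined: `f_l ∈ L^{s_l}` for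
all `l`, and `b^j f_i ∈ L^{s_i}` for `0 ≤ j ≤ k`. -/
def commutatorDomain {n m : ℕ} (s p : Fin m → ℝ≥0∞) (b : RSpace n → ℝ) (i : Fin m) (k : ℕ) :
    Set (Fin m → RSpace n → ℂ) :=
  {f | (∀ l, MemLp (f l) (p l) volume) ∧ (∀ l, MemLp (f l) (s l) volume) ∧
    ∀ j ≤ k, MemLp (fun x => (b x : ℂ) ^ j * f i x) (s i) volume}

/-- `S`, defined on `D`, is bounded from `L^{p₁} × ⋯ × L^{p_m}` to `L^q`. -/
def IsBoundedOnDomain {n m : ℕ} (D : Set (Fin m → RSpace n → ℂ)) (S : TupleOp n m)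
    (p : Fin m → ℝ≥0∞) (q : ℝ≥0∞) : Prop :=
  ∃ C : ℝ≥0, ∀ f ∈ D, eLpNorm (S f) q volume ≤ C * ∏ i, eLpNorm (f i) (p i) volume

end

/-! The kernel of the commutator is `(b x - b y₁)^k K(x, y)`. By non-degeneracy and regularity, each
ball `B` has a reflected ball of the same radius, at a comparable distance, such that `K` stays
within half of a constant `K₀` when `x` runs over the reflected ball and all `y_i` over `B`, where
`|K₀| |B|^m` is bounded below (`IsMultilinearCZKernel.exists_reflected`). Let `c` be a median of `b`
on the reflected ball. For `z ∈ B` with `b z ≥ c` and `x` in the half of the reflected ball where `b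
x ≤ c`, one has `|b z - c| ≤ b z - b x`; the case `b z < c` is symmetric. Pairing the commutator of
indicator functions with the indicator of that half, rotated by the phase of `K₀`, therefore bounds
`∫_B |b - c|^k` from above (`le_re_integral_iteratedCommutator`).

For a finite family of balls `B_Q` with disjoint major subsets `E_Q`, these estimates are added up
with weights `a_Q`. Independent random signs in every slot make the sum of the separate pairings an
average of single pairings (`norm_sum_diag_le`), to which Hölder and the boundedness of the
commutator apply. The functions occurring there are sums over balls, and in `L^u` they are as small
as the corresponding sums over the disjoint `E_Q` (`lintegral_sum_balls_rpow_le`, by duality and a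
maximal inequality). Since `1/p + 1/q' = 1/r'`, the outcome is `∑ a_Q ∫_{B_Q} |b - c_Q|^k ≤ C (∑
a_Q^{r'} |E_Q|)^{1/r'}`. With `o_Q` the average of `|b - c_Q|^k` and `a_Q = o_Q^{r-1}` this becomes
a uniform bound for `∑ o_Q^r |E_Q|` (`exists_testing_bound`).

A stopping time on dyadic cubes dominates `|b - c_{Q₀}|`, at the scale of small cubes inside a root
cube `Q₀`, by a sum of `o_Q^{1/k} 1_Q` over a sparse family (`exists_sparse_domination`). The
`L^{kr}` norm of that sum is controlled by `∑ o_Q^r |E_Q|`, with a constant that depends neither on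
the scale nor on `Q₀`. Lebesgue differentiation and Fatou remove the scale; letting `Q₀` grow, the
constants `c_{Q₀}` stay bounded and converge along a subsequence. -/

noncomputable section

/-! ### Maximal functions and sums over sparse families of balls -/

/-- A layer-cake comparison: a Doob type weak inequality between two measures yields
an inequality between moments. -/
theorem lintegral_rpow_le_of_weak {α : Type*} [MeasurableSpace α] {μ ν : Measure α} {f : α → ℝ}
    (f_nn : 0 ≤ f) (hf : Measurable f) {C : ℝ≥0∞} {v : ℝ} (hv : 1 < v)
    (h : ∀ t : ℝ, 0 < t → ENNReal.ofReal t * μ {x | t < f x} ≤ C * ν {x | t < f x}) :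
    ∫⁻ x, ENNReal.ofReal (f x ^ v) ∂μ ≤
      ENNReal.ofReal (v / (v - 1)) * C * ∫⁻ x, ENNReal.ofReal (f x ^ (v - 1)) ∂ν := by
  have hv0 : 0 < v := by linarith
  have hv1 : 0 < v - 1 := by linarith
  rw [lintegral_rpow_eq_lintegral_meas_lt_mul μ (Eventually.of_forall f_nn) hf.aemeasurable hv0,
    lintegral_rpow_eq_lintegral_meas_lt_mul ν (Eventually.of_forall f_nn) hf.aemeasurable hv1]
  have key : ∫⁻ t in Set.Ioi (0 : ℝ), μ {a | t < f a} * ENNReal.ofReal (t ^ (v - 1)) ≤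
      C * ∫⁻ t in Set.Ioi (0 : ℝ), ν {a | t < f a} * ENNReal.ofReal (t ^ (v - 1 - 1)) := by
    have hmeas : Measurable fun t : ℝ =>
        ν {a | t < f a} * ENNReal.ofReal (t ^ (v - 1 - 1)) := by
      have : Antitone fun t : ℝ => ν {a | t < f a} := fun s t hst =>
        measure_mono fun a ha => lt_of_le_of_lt hst ha
      exact this.measurable.mul (by fun_prop)
    rw [← lintegral_const_mul _ hmeas]
    refine lintegral_mono_ae ?_
    filter_upwards [self_mem_ae_restrict measurableSet_Ioi] with t ht
    have ht : 0 < t := ht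
    -- The factor `t` split off here is the one in the weak inequality; this is how the moment drops
    -- from `v` to `v - 1`.
    have : t ^ (v - 1) = t * t ^ (v - 1 - 1) := by
      rw [Real.rpow_sub_one ht.ne' (v - 1)]; field_simp
    rw [this, ENNReal.ofReal_mul ht.le, ← mul_assoc, ← mul_assoc, mul_comm (μ _)]
    exact mul_le_mul_left (h t ht) _
  have e : ENNReal.ofReal (v / (v - 1)) * ENNReal.ofReal (v - 1) = ENNReal.ofReal v := by
    rw [← ENNReal.ofReal_mul (by positivity)]; congr 1; field_simp
  calc _ ≤ ENNReal.ofReal v *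
        (C * ∫⁻ t in Set.Ioi (0 : ℝ), ν {a | t < f a} * ENNReal.ofReal (t ^ (v - 1 - 1))) := by
        gcongr
    _ = _ := by rw [← e]; ring

/-- The maximal function associated with a finite family of weighted balls. -/
def ballMax {n : ℕ} {ι : Type*} (S : Finset ι) (y : ι → RSpace n) (l : ι → ℝ) (A : ι → ℝ≥0)
    (x : RSpace n) : ℝ≥0 :=
  S.sup fun Q => (Metric.closedBall (y Q) (l Q)).indicator (fun _ => A Q) x

theorem measurable_ballMax {n : ℕ} {ι : Type*} (S : Finset ι) (y : ι → RSpace n) (l : ι → ℝ)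
    (A : ι → ℝ≥0) : Measurable (ballMax S y l A) := by
  classical
  induction S using Finset.induction_on with
  | empty => exact measurable_const
  | insert Q S _ ih =>
    have : ballMax (insert Q S) y l A = fun x =>
        max ((Metric.closedBall (y Q) (l Q)).indicator (fun _ => A Q) x) (ballMax S y l A x) := by
      ext x; simp [ballMax]
    rw [this]
    exact (measurable_const.indicator Metric.isClosed_closedBall.measurableSet).max ih

theorem lt_ballMax_iff {n : ℕ} {ι : Type*} {S : Finset ι} {y : ι → RSpace n} {l : ι → ℝ}
    {A : ι → ℝ≥0} {x : RSpace n} {t : ℝ≥0} :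
    t < ballMax S y l A x ↔ ∃ Q ∈ S, t < A Q ∧ x ∈ Metric.closedBall (y Q) (l Q) := by
  simp only [ballMax, Finset.lt_sup_iff]
  constructor
  · rintro ⟨Q, hQ, h⟩
    by_cases hx : x ∈ Metric.closedBall (y Q) (l Q)
    · rw [Set.indicator_of_mem hx] at h; exact ⟨Q, hQ, h, hx⟩
    · rw [Set.indicator_of_notMem hx] at h; simp at h
  · rintro ⟨Q, hQ, h, hx⟩
    exact ⟨Q, hQ, by rwa [Set.indicator_of_mem hx]⟩

theorem volume_closedBall_mul {n : ℕ} (y : RSpace n) {l c : ℝ} (hl : 0 ≤ l) (hc : 0 ≤ c) :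
    volume (Metric.closedBall y (c * l)) =
      ENNReal.ofReal (c ^ n) * volume (Metric.closedBall y l) := by
  rw [Measure.addHaar_closedBall_mul _ _ hc hl, Measure.addHaar_closedBall_center _ y]
  simp

/-- Among the balls with `A Q > t`, Vitali's lemma selects disjoint ones whose fivefold dilates
cover the superlevel set. The selected balls themselves lie in the superlevel set, so only the
`ν`-mass of that set is needed on the right; this Doob form is what the layer-cake comparison
requires. -/
theorem ballMax_weak {n : ℕ} {ι : Type*} (S : Finset ι) (y : ι → RSpace n) (l : ι → ℝ)
    (hl : ∀ Q ∈ S, 0 < l Q) (A : ι → ℝ≥0) (ν : Measure (RSpace n))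
    (hA : ∀ Q ∈ S, A Q * volume (Metric.closedBall (y Q) (l Q)) ≤
      ν (Metric.closedBall (y Q) (l Q))) (t : ℝ≥0) :
    t * volume {x | t < ballMax S y l A x} ≤
      ENNReal.ofReal (5 ^ n) * ν {x | t < ballMax S y l A x} := by
  classical
  set W := {x | t < ballMax S y l A x}
  let τ : Set ι := {Q | Q ∈ S ∧ t < A Q}
  have hfin : τ.Finite := S.finite_toSet.subset fun Q hQ => hQ.1
  obtain ⟨R, hR⟩ : ∃ R, ∀ Q ∈ τ, l Q ≤ R := by
    refine ⟨∑ Q ∈ S, l Q, fun Q hQ => ?_⟩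
    exact Finset.single_le_sum (f := l) (fun i hi => (hl i hi).le) hQ.1
  obtain ⟨u, hu, hdis, hcov⟩ := Vitali.exists_disjoint_subfamily_covering_enlargement_closedBall
    τ y l R hR 5 (by norm_num)
  have hufin : u.Finite := hfin.subset hu
  have h1 : W ⊆ ⋃ Q ∈ u, Metric.closedBall (y Q) (5 * l Q) := by
    intro x hx
    obtain ⟨Q, hQ, hA, hx⟩ := lt_ballMax_iff.1 hx
    obtain ⟨P, hP, hsub⟩ := hcov Q ⟨hQ, hA⟩
    exact Set.mem_biUnion hP (hsub hx)
  have h2 : (⋃ Q ∈ u, Metric.closedBall (y Q) (l Q)) ⊆ W := by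
    intro x hx
    simp only [Set.mem_iUnion] at hx
    obtain ⟨Q, hQ, hx⟩ := hx
    exact lt_ballMax_iff.2 ⟨Q, (hu hQ).1, (hu hQ).2, hx⟩
  calc t * volume W
      ≤ t * ∑ Q ∈ hufin.toFinset, volume (Metric.closedBall (y Q) (5 * l Q)) := by
        gcongr
        refine (measure_mono h1).trans ?_
        have := measure_biUnion_finset_le (μ := volume) hufin.toFinset
          (fun Q => Metric.closedBall (y Q) (5 * l Q))
        simpa using this
    _ = ENNReal.ofReal (5 ^ n) *
        ∑ Q ∈ hufin.toFinset, t * volume (Metric.closedBall (y Q) (l Q)) := by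
        rw [Finset.mul_sum, Finset.mul_sum]
        refine Finset.sum_congr rfl fun Q hQ => ?_
        rw [volume_closedBall_mul _ (hl Q (hu (hufin.mem_toFinset.1 hQ)).1).le (by norm_num)]
        ring
    _ ≤ ENNReal.ofReal (5 ^ n) *
        ∑ Q ∈ hufin.toFinset, ν (Metric.closedBall (y Q) (l Q)) := by
        gcongr with Q hQ
        have hQ' := hu (hufin.mem_toFinset.1 hQ)
        refine le_trans ?_ (hA Q hQ'.1)
        gcongr
        exact hQ'.2.le
    _ = ENNReal.ofReal (5 ^ n) * ν (⋃ Q ∈ u, Metric.closedBall (y Q) (l Q)) := by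
        congr 1
        rw [← measure_biUnion_finset (by simpa using hdis)
          (fun Q _ => Metric.isClosed_closedBall.measurableSet)]
        simp
    _ ≤ _ := by gcongr

/-- `L^u` bound for sums of balls which contain disjoint major subsets. -/
theorem lintegral_sum_balls_rpow_le {n : ℕ} {u : ℝ} (hu : 1 < u) {C₀ : ℝ} (hC₀ : 0 < C₀) :
    ∃ C : ℝ, 0 < C ∧ ∀ {ι : Type} (S : Finset ι) (y : ι → RSpace n) (l : ι → ℝ)
      (E : ι → Set (RSpace n)) (α : ι → ℝ≥0), (∀ Q ∈ S, 0 < l Q) →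
      (∀ Q ∈ S, MeasurableSet (E Q)) → (∀ Q ∈ S, E Q ⊆ Metric.closedBall (y Q) (l Q)) →
      (S : Set ι).PairwiseDisjoint E →
      (∀ Q ∈ S, volume (Metric.closedBall (y Q) (l Q)) ≤ ENNReal.ofReal C₀ * volume (E Q)) →
      ∫⁻ x, (∑ Q ∈ S, (Metric.closedBall (y Q) (l Q)).indicator (fun _ => (α Q : ℝ≥0∞)) x) ^ u ≤
        ENNReal.ofReal C * ∑ Q ∈ S, (α Q : ℝ≥0∞) ^ u * volume (E Q) := by
  have hu1 : 0 < u - 1 := by linarith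
  set v := u / (u - 1) with hv_def
  have hv : 1 < v := by rw [hv_def, lt_div_iff₀ hu1]; linarith
  have hvv : v / (v - 1) = u := by rw [hv_def]; field_simp; ring
  have huv : u.HolderConjugate v := Real.HolderConjugate.conjExponent hu
  have hD : 0 < C₀ * (u * 5 ^ n) := by positivity
  -- `C₀` pays for replacing the balls by the sets `E Q`; `u = v / (v - 1)` and `5 ^ n` come from
  -- the maximal inequality.
  refine ⟨(C₀ * (u * 5 ^ n)) ^ u, by positivity, ?_⟩
  intro ι S y l E α hl hEm hEs hdis hvol
  set B : ι → Set (RSpace n) := fun Q => Metric.closedBall (y Q) (l Q) with hB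
  have hBm : ∀ Q, MeasurableSet (B Q) := fun Q => Metric.isClosed_closedBall.measurableSet
  set φ : RSpace n → ℝ≥0∞ := fun x => ∑ Q ∈ S, (B Q).indicator (fun _ => (α Q : ℝ≥0∞)) x with hφ
  have hφm : Measurable φ := Finset.measurable_fun_sum _ fun Q _ => measurable_const.indicator (hBm Q)
  set ψ : RSpace n → ℝ≥0∞ := fun x => ∑ Q ∈ S, (E Q).indicator (fun _ => (α Q : ℝ≥0∞)) x with hψ
  have hψm : Measurable ψ :=
    Finset.measurable_fun_sum _ fun Q hQ => measurable_const.indicator (hEm Q hQ)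
  have hφtop : ∀ x, φ x ≠ ∞ := fun x => by
    simp only [hφ]
    refine ENNReal.sum_ne_top.2 fun Q _ => ?_
    by_cases hx : x ∈ B Q <;> simp [hx]
  -- finiteness
  have hI : ∫⁻ x, φ x ^ u ≠ ∞ := by
    have hle : ∀ x, φ x ^ u ≤ (⋃ Q ∈ S, B Q).indicator (fun _ => (∑ Q ∈ S, (α Q : ℝ≥0∞)) ^ u) x := by
      intro x
      by_cases hx : x ∈ ⋃ Q ∈ S, B Q
      · rw [Set.indicator_of_mem hx]
        refine ENNReal.rpow_le_rpow ?_ (by linarith)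
        exact Finset.sum_le_sum fun Q _ => Set.indicator_le_self' (fun _ _ => zero_le) x
      · have : φ x = 0 := by
          simp only [hφ]
          refine Finset.sum_eq_zero fun Q hQ => Set.indicator_of_notMem (fun h => hx ?_) _
          exact Set.mem_biUnion hQ h
        rw [this, ENNReal.zero_rpow_of_pos (by linarith)]; simp
    refine ne_top_of_le_ne_top ?_ (lintegral_mono hle)
    have hm : MeasurableSet (⋃ Q ∈ S, B Q) := S.measurableSet_biUnion fun Q _ => hBm Q
    rw [lintegral_indicator hm, lintegral_const]
    refine ENNReal.mul_ne_top (ENNReal.rpow_ne_top_of_nonneg (by linarith) (by simp [ENNReal.sum_eq_top])) ?_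
    rw [Measure.restrict_apply_univ]
    refine ((measure_biUnion_finset_le S B).trans_lt ?_).ne
    exact ENNReal.sum_lt_top.2 fun Q _ => measure_closedBall_lt_top
  -- The density `φ ^ (u - 1)` is the extremal dual function of `φ`: `∫ φ ^ u` equals `∑ α Q * ν (B
  -- Q)`. The weights `A Q` below are the averages of this density over the balls.
  set ν : Measure (RSpace n) := volume.withDensity fun x => φ x ^ (u - 1) with hν
  have hνB : ∀ Q, ν (B Q) ≠ ∞ := by
    intro Q
    rw [hν, withDensity_apply _ (hBm Q)]
    have h1 : ∀ x, φ x ^ (u - 1) ≤ 1 + φ x ^ u := by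
      intro x
      rcases le_total (φ x) 1 with h | h
      · exact (ENNReal.rpow_le_one h hu1.le).trans le_self_add
      · exact (ENNReal.rpow_le_rpow_of_exponent_le h (by linarith)).trans le_add_self
    refine ne_top_of_le_ne_top ?_ (lintegral_mono h1)
    rw [lintegral_add_left measurable_const]
    refine ENNReal.add_ne_top.2 ⟨?_, ne_top_of_le_ne_top hI (setLIntegral_le_lintegral _ _)⟩
    simpa using (measure_closedBall_lt_top (μ := (volume : Measure (RSpace n)))).ne
  have hB0 : ∀ Q ∈ S, volume (B Q) ≠ 0 := fun Q hQ =>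
    (Metric.measure_closedBall_pos _ _ (hl Q hQ)).ne'
  have hBt : ∀ Q, volume (B Q) ≠ ∞ := fun Q => measure_closedBall_lt_top.ne
  set A : ι → ℝ≥0 := fun Q => (ν (B Q) / volume (B Q)).toNNReal with hA
  have hAν : ∀ Q ∈ S, (A Q : ℝ≥0∞) * volume (B Q) = ν (B Q) := by
    intro Q hQ
    rw [hA, ENNReal.coe_toNNReal (ENNReal.div_ne_top (hνB Q) (hB0 Q hQ)),
      ENNReal.div_mul_cancel (hB0 Q hQ) (hBt Q)]
  set M : RSpace n → ℝ≥0 := ballMax S y l A with hM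
  have hMm : Measurable M := measurable_ballMax S y l A
  set J := ∫⁻ x, (M x : ℝ≥0∞) ^ v with hJ
  set I := ∫⁻ x, φ x ^ u with hIdef
  -- maximal inequality
  have hmax : J ≤ ENNReal.ofReal (u * 5 ^ n) * (I ^ (1 / v) * J ^ (1 / u)) := by
    have h := lintegral_rpow_le_of_weak (μ := volume) (ν := ν) (f := fun x => (M x : ℝ))
      (fun x => NNReal.coe_nonneg (M x)) (by fun_prop) (C := ENNReal.ofReal (5 ^ n)) hv (by
        intro t ht
        have := ballMax_weak S y l hl A ν (fun Q hQ => (hAν Q hQ).le) t.toNNReal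
        have e : {x | t < (M x : ℝ)} = {x | t.toNNReal < ballMax S y l A x} := by
          ext x; simp [Real.toNNReal_lt_iff_lt_coe ht.le, hM]
        rw [e]
        exact this)
    have e1 : ∀ (w : ℝ), 0 < w → ∀ x, ENNReal.ofReal ((M x : ℝ) ^ w) = (M x : ℝ≥0∞) ^ w := by
      intro w hw x
      rw [← ENNReal.ofReal_rpow_of_nonneg (NNReal.coe_nonneg (M x)) hw.le, ENNReal.ofReal_coe_nnreal]
    simp only [e1 v (by linarith), e1 (v - 1) (by linarith)] at h
    rw [hvv, ← ENNReal.ofReal_mul (by linarith), hν,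
      lintegral_withDensity_eq_lintegral_mul _ (by fun_prop) (by fun_prop)] at h
    refine h.trans ?_
    gcongr
    have hh := ENNReal.lintegral_mul_le_Lp_mul_Lq (μ := (volume : Measure (RSpace n))) huv.symm
      (f := fun x => φ x ^ (u - 1)) (g := fun x => (M x : ℝ≥0∞) ^ (v - 1))
      (by fun_prop) (by fun_prop)
    refine hh.trans (le_of_eq ?_)
    have e2 : (u - 1) * v = u := by rw [hv_def]; field_simp
    have e3 : (v - 1) * u = v := by rw [hv_def]; field_simp; ring
    simp only [← ENNReal.rpow_mul, e2, e3, hJ, hIdef]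
  have hJtop : J ≠ ∞ := by
    have hle : ∀ x, (M x : ℝ≥0∞) ^ v ≤
        (⋃ Q ∈ S, B Q).indicator (fun _ => (∑ Q ∈ S, (A Q : ℝ≥0∞)) ^ v) x := by
      intro x
      by_cases hx : x ∈ ⋃ Q ∈ S, B Q
      · rw [Set.indicator_of_mem hx]
        refine ENNReal.rpow_le_rpow ?_ (by linarith)
        have : M x ≤ ∑ Q ∈ S, A Q := by
          rw [hM, ballMax]
          refine Finset.sup_le fun Q hQ => ?_
          exact (Set.indicator_le_self' (fun _ _ => zero_le) x).trans
            (Finset.single_le_sum (f := A) (fun _ _ => zero_le) hQ)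
        exact_mod_cast this
      · have : M x = 0 := by
          by_contra h
          obtain ⟨Q, hQ, -, hxQ⟩ := lt_ballMax_iff.1 (pos_iff_ne_zero.2 h)
          exact hx (Set.mem_biUnion hQ hxQ)
        rw [this, ENNReal.coe_zero, ENNReal.zero_rpow_of_pos (by linarith)]; simp
    refine ne_top_of_le_ne_top ?_ (lintegral_mono hle)
    have hm : MeasurableSet (⋃ Q ∈ S, B Q) := S.measurableSet_biUnion fun Q _ => hBm Q
    rw [lintegral_indicator hm, lintegral_const]
    refine ENNReal.mul_ne_top (ENNReal.rpow_ne_top_of_nonneg (by linarith) (by simp [ENNReal.sum_eq_top])) ?_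
    rw [Measure.restrict_apply_univ]
    refine ((measure_biUnion_finset_le S B).trans_lt ?_).ne
    exact ENNReal.sum_lt_top.2 fun Q _ => measure_closedBall_lt_top
  have hconj : (1 : ℝ) = 1 / v + 1 / u := by
    have := huv.symm.inv_add_inv_eq_one; simp only [one_div]; linarith
  -- Absorption of a power of the left side. It fails for `x = ∞`, which is why `I` and `J` were
  -- shown to be finite.
  have cancel : ∀ (x D : ℝ≥0∞) (a c : ℝ), 0 < a → 0 < c → (1 : ℝ) = a + c → x ≠ ∞ →
      x ≤ D * x ^ c → x ^ a ≤ D := by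
    intro x D a c ha hc hac hx h
    rcases eq_or_ne x 0 with rfl | h0
    · rw [ENNReal.zero_rpow_of_pos ha]; exact zero_le
    · have hc0 : x ^ c ≠ 0 := by simp [h0, hx]
      have hct : x ^ c ≠ ∞ := ENNReal.rpow_ne_top_of_nonneg hc.le hx
      have : x ^ a * x ^ c ≤ D * x ^ c := by
        rw [← ENNReal.rpow_add _ _ h0 hx, ← hac, ENNReal.rpow_one]; exact h
      exact (ENNReal.mul_le_mul_iff_left hc0 hct).1 this
  have hu0 : 0 < 1 / u := by positivity
  have hv0 : 0 < 1 / v := by positivity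
  have hJle : J ^ (1 / v) ≤ ENNReal.ofReal (u * 5 ^ n) * I ^ (1 / v) :=
    cancel J _ _ _ hv0 hu0 hconj hJtop (by rw [mul_assoc]; exact hmax)
  -- duality
  have hdual : I ≤ ENNReal.ofReal C₀ * ((∫⁻ x, ψ x ^ u) ^ (1 / u) * J ^ (1 / v)) := by
    have e1 : I = ∑ Q ∈ S, (α Q : ℝ≥0∞) * ν (B Q) := by
      have : ∀ x, φ x ^ u = ∑ Q ∈ S, (B Q).indicator (fun x => (α Q : ℝ≥0∞) * φ x ^ (u - 1)) x := by
        intro x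
        have h1 : φ x ^ u = φ x * φ x ^ (u - 1) := by
          rcases eq_or_ne (φ x) 0 with h | h
          · rw [h, ENNReal.zero_rpow_of_pos (by linarith), zero_mul]
          · nth_rewrite 2 [← ENNReal.rpow_one (φ x)]
            rw [← ENNReal.rpow_add _ _ h (hφtop x)]; congr 1; ring
        rw [h1]
        conv_lhs => rw [hφ]
        simp only
        rw [Finset.sum_mul]
        refine Finset.sum_congr rfl fun Q _ => ?_
        by_cases hx : x ∈ B Q <;> simp [hx, hφ]
      rw [hIdef, lintegral_congr this, lintegral_finsetSum _ (fun Q _ =>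
        (by fun_prop : Measurable fun x => (α Q : ℝ≥0∞) * φ x ^ (u - 1)).indicator (hBm Q))]
      refine Finset.sum_congr rfl fun Q _ => ?_
      rw [lintegral_indicator (hBm Q), lintegral_const_mul _ (by fun_prop), hν,
        withDensity_apply _ (hBm Q)]
    calc I = ∑ Q ∈ S, (α Q : ℝ≥0∞) * ((A Q : ℝ≥0∞) * volume (B Q)) := by
          rw [e1]; exact Finset.sum_congr rfl fun Q hQ => by rw [hAν Q hQ]
      _ ≤ ∑ Q ∈ S, (α Q : ℝ≥0∞) * ((A Q : ℝ≥0∞) * (ENNReal.ofReal C₀ * volume (E Q))) := by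
          gcongr with Q hQ; exact hvol Q hQ
      _ = ENNReal.ofReal C₀ * ∑ Q ∈ S, (α Q : ℝ≥0∞) * ((A Q : ℝ≥0∞) * volume (E Q)) := by
          rw [Finset.mul_sum]; exact Finset.sum_congr rfl fun Q _ => by ring
      _ ≤ ENNReal.ofReal C₀ * ∫⁻ x, ψ x * M x := by
          gcongr
          have : ∀ x, ψ x * M x =
              ∑ Q ∈ S, (E Q).indicator (fun x => (α Q : ℝ≥0∞) * M x) x := by
            intro x
            rw [hψ]; simp only
            rw [Finset.sum_mul]
            refine Finset.sum_congr rfl fun Q _ => ?_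
            by_cases hx : x ∈ E Q <;> simp [hx]
          rw [lintegral_congr this, lintegral_finsetSum _ (fun Q hQ =>
            (by fun_prop : Measurable fun x => (α Q : ℝ≥0∞) * M x).indicator (hEm Q hQ))]
          refine Finset.sum_le_sum fun Q hQ => ?_
          rw [lintegral_indicator (hEm Q hQ), lintegral_const_mul _ (by fun_prop)]
          gcongr
          rw [← setLIntegral_const]
          refine setLIntegral_mono (by fun_prop) fun x hx => ?_
          have : A Q ≤ M x := by
            rw [hM, ballMax]
            have := Finset.le_sup (f := fun Q => (Metric.closedBall (y Q) (l Q)).indicator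
              (fun _ => A Q) x) hQ
            simp only [Set.indicator_of_mem (hEs Q hQ hx)] at this
            exact this
          exact_mod_cast this
      _ ≤ _ := by
          gcongr
          exact ENNReal.lintegral_mul_le_Lp_mul_Lq _ huv hψm.aemeasurable (by fun_prop)
  have hψu : ∫⁻ x, ψ x ^ u = ∑ Q ∈ S, (α Q : ℝ≥0∞) ^ u * volume (E Q) := by
    have : ∀ x, ψ x ^ u = ∑ Q ∈ S, (E Q).indicator (fun _ => (α Q : ℝ≥0∞) ^ u) x := by
      intro x
      by_cases hx : ∃ Q ∈ S, x ∈ E Q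
      · obtain ⟨Q, hQ, hx⟩ := hx
        have hne : ∀ P ∈ S, P ≠ Q → x ∉ E P := fun P hP hPQ hxP =>
          Set.disjoint_left.1 (hdis hP hQ hPQ) hxP hx
        rw [hψ]; simp only
        rw [Finset.sum_eq_single_of_mem Q hQ fun P hP hPQ => Set.indicator_of_notMem (hne P hP hPQ) _,
          Finset.sum_eq_single_of_mem Q hQ fun P hP hPQ => Set.indicator_of_notMem (hne P hP hPQ) _,
          Set.indicator_of_mem hx, Set.indicator_of_mem hx]
      · push Not at hx
        rw [hψ]; simp only
        rw [Finset.sum_eq_zero fun P hP => Set.indicator_of_notMem (hx P hP) _,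
          Finset.sum_eq_zero fun P hP => Set.indicator_of_notMem (hx P hP) _,
          ENNReal.zero_rpow_of_pos (by linarith)]
    rw [lintegral_congr this, lintegral_finsetSum _ (fun Q hQ =>
      measurable_const.indicator (hEm Q hQ))]
    exact Finset.sum_congr rfl fun Q hQ => by rw [lintegral_indicator (hEm Q hQ), setLIntegral_const]
  rw [hψu] at hdual
  set Y := ∑ Q ∈ S, (α Q : ℝ≥0∞) ^ u * volume (E Q)
  have hfin : I ^ (1 / u) ≤ ENNReal.ofReal (C₀ * (u * 5 ^ n)) * Y ^ (1 / u) := by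
    refine cancel I _ _ _ hu0 hv0 (by linarith) hI (hdual.trans ?_)
    rw [ENNReal.ofReal_mul hC₀.le]
    calc _ ≤ ENNReal.ofReal C₀ * (Y ^ (1 / u) * (ENNReal.ofReal (u * 5 ^ n) * I ^ (1 / v))) := by
          gcongr
      _ = _ := by ring
  have := ENNReal.rpow_le_rpow hfin (show 0 ≤ u by linarith)
  rw [ENNReal.mul_rpow_of_nonneg _ _ (by linarith), ← ENNReal.rpow_mul, ← ENNReal.rpow_mul,
    one_div_mul_cancel (by linarith), ENNReal.rpow_one, ENNReal.rpow_one,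
    ENNReal.ofReal_rpow_of_pos hD] at this
  exact this

/-! ### Dyadic cubes -/

/-- The index of the dyadic cube of generation `j` that contains `x`, where the cube of
generation `0` at the origin is `[-L/2, L/2)ⁿ`. -/
def gridMap {n : ℕ} (L : ℝ) (j : ℕ) (x : RSpace n) : Fin n → ℤ :=
  fun i => ⌊2 ^ j * (x i / L + 1 / 2)⌋

/-- The dyadic cubes of generation `j`. -/
def gridCube {n : ℕ} (L : ℝ) (j : ℕ) (κ : Fin n → ℤ) : Set (RSpace n) :=
  gridMap L j ⁻¹' {κ}

/-- The lower corner of a dyadic cube. -/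
def gridCorner {n : ℕ} (L : ℝ) (j : ℕ) (κ : Fin n → ℤ) : RSpace n :=
  WithLp.toLp 2 fun i => L * (κ i / 2 ^ j - 1 / 2)

/-- A bound for the diameters of the dyadic cubes of generation `j`. -/
def gridRadius (n : ℕ) (L : ℝ) (j : ℕ) : ℝ := √n * (L / 2 ^ j)

theorem measurable_gridMap {n : ℕ} (L : ℝ) (j : ℕ) : Measurable (gridMap (n := n) L j) := by
  refine measurable_pi_lambda _ fun i => Int.measurable_floor.comp ?_
  fun_prop

theorem measurableSet_gridCube {n : ℕ} (L : ℝ) (j : ℕ) (κ : Fin n → ℤ) :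
    MeasurableSet (gridCube L j κ) :=
  measurable_gridMap L j (measurableSet_singleton κ)

/-- Nestedness of the generations: halving the floor of `2 ^ (j + 1) * a` by integer division yields
the floor of `2 ^ j * a`. -/
theorem gridMap_eq_of_succ {n : ℕ} {L : ℝ} {j : ℕ} {x y : RSpace n}
    (h : gridMap L (j + 1) x = gridMap L (j + 1) y) : gridMap L j x = gridMap L j y := by
  funext i
  have hi := congrFun h i
  simp only [gridMap] at hi ⊢
  have key : ∀ a : ℝ, ⌊2 ^ j * a⌋ = ⌊2 ^ (j + 1) * a⌋ / 2 := by
    intro a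
    rw [Int.floor_eq_iff]
    have h1 := Int.floor_le (2 ^ (j + 1) * a)
    have h2 := Int.lt_floor_add_one (2 ^ (j + 1) * a)
    set z := ⌊2 ^ (j + 1) * a⌋
    have h3 : (2 * (z / 2) : ℤ) ≤ z := by omega
    have h4 : (z : ℤ) ≤ 2 * (z / 2) + 1 := by omega
    have h3' : (2 : ℝ) * ((z / 2 : ℤ) : ℝ) ≤ z := by exact_mod_cast h3
    have h4' : (z : ℝ) ≤ 2 * ((z / 2 : ℤ) : ℝ) + 1 := by exact_mod_cast h4
    rw [pow_succ] at h1 h2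
    constructor <;> nlinarith
  rw [key, key, hi]

theorem gridMap_eq_of_le {n : ℕ} {L : ℝ} {i j : ℕ} (hij : i ≤ j) {x y : RSpace n}
    (h : gridMap L j x = gridMap L j y) : gridMap L i x = gridMap L i y := by
  induction j, hij using Nat.le_induction with
  | base => exact h
  | succ j _ ih => exact ih (gridMap_eq_of_succ h)

theorem mem_gridCube_iff {n : ℕ} {L : ℝ} (hL : 0 < L) {j : ℕ} {κ : Fin n → ℤ} {x : RSpace n} :
    x ∈ gridCube L j κ ↔ ∀ i, gridCorner L j κ i ≤ x i ∧ x i < gridCorner L j κ i + L / 2 ^ j := by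
  have h2 : (0 : ℝ) < 2 ^ j := by positivity
  simp only [gridCube, Set.mem_preimage, Set.mem_singleton_iff, funext_iff, gridMap,
    Int.floor_eq_iff, gridCorner]
  refine forall_congr' fun i => ?_
  have e1 : (κ i : ℝ) ≤ 2 ^ j * (x i / L + 1 / 2) ↔ L * (κ i / 2 ^ j - 1 / 2) ≤ x i := by
    rw [← div_le_iff₀' h2, ← sub_le_iff_le_add, le_div_iff₀' hL]
  have e2 : 2 ^ j * (x i / L + 1 / 2) < (κ i : ℝ) + 1 ↔
      x i < L * (κ i / 2 ^ j - 1 / 2) + L / 2 ^ j := by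
    rw [← lt_div_iff₀' h2, ← lt_sub_iff_add_lt, div_lt_iff₀' hL]
    have : L * (((κ i : ℝ) + 1) / 2 ^ j - 1 / 2) = L * (κ i / 2 ^ j - 1 / 2) + L / 2 ^ j := by
      field_simp; ring
    rw [this]
  rw [e1, e2]

theorem volume_gridCube {n : ℕ} {L : ℝ} (hL : 0 < L) (j : ℕ) (κ : Fin n → ℤ) :
    volume (gridCube L j κ) = ENNReal.ofReal ((L / 2 ^ j) ^ n) := by
  have : gridCube L j κ = (WithLp.ofLp : RSpace n → Fin n → ℝ) ⁻¹' (Set.univ.pi fun i =>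
      Set.Ico (gridCorner L j κ i) (gridCorner L j κ i + L / 2 ^ j)) := by
    ext x; rw [mem_gridCube_iff hL]; simp
  rw [this, (PiLp.volume_preserving_ofLp (Fin n)).measure_preimage
    (MeasurableSet.univ_pi fun i => measurableSet_Ico).nullMeasurableSet, Real.volume_pi_Ico]
  simp [ENNReal.ofReal_pow (by positivity : 0 ≤ L / 2 ^ j)]

theorem volume_gridCube_pos {n : ℕ} {L : ℝ} (hL : 0 < L) (j : ℕ) (κ : Fin n → ℤ) :
    0 < volume (gridCube L j κ) := by
  rw [volume_gridCube hL, ENNReal.ofReal_pos]; positivity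

theorem volume_gridCube_lt_top {n : ℕ} {L : ℝ} (hL : 0 < L) (j : ℕ) (κ : Fin n → ℤ) :
    volume (gridCube L j κ) < ∞ := by
  rw [volume_gridCube hL]; exact ENNReal.ofReal_lt_top

theorem volume_real_gridCube {n : ℕ} {L : ℝ} (hL : 0 < L) (j : ℕ) (κ : Fin n → ℤ) :
    volume.real (gridCube L j κ) = (L / 2 ^ j) ^ n := by
  rw [Measure.real, volume_gridCube hL, ENNReal.toReal_ofReal (by positivity)]

theorem gridRadius_pos {n : ℕ} (hn : 0 < n) {L : ℝ} (hL : 0 < L) (j : ℕ) :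
    0 < gridRadius n L j := by
  have : (0 : ℝ) < n := by exact_mod_cast hn
  unfold gridRadius; positivity

theorem gridCube_subset_closedBall {n : ℕ} {L : ℝ} (hL : 0 < L) (j : ℕ) (κ : Fin n → ℤ) :
    gridCube L j κ ⊆ Metric.closedBall (gridCorner L j κ) (gridRadius n L j) := by
  intro x hx
  rw [mem_gridCube_iff hL] at hx
  rw [Metric.mem_closedBall, EuclideanSpace.dist_eq, gridRadius]
  have h0 : 0 ≤ L / 2 ^ j := by positivity
  calc √(∑ i, dist (x i) (gridCorner L j κ i) ^ 2) ≤ √(∑ _i : Fin n, (L / 2 ^ j) ^ 2) := by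
        refine Real.sqrt_le_sqrt (Finset.sum_le_sum fun i _ => ?_)
        refine pow_le_pow_left₀ dist_nonneg ?_ 2
        rw [Real.dist_eq, abs_le]; have := hx i; constructor <;> linarith
    _ = √n * (L / 2 ^ j) := by
        rw [Finset.sum_const, Finset.card_univ, Fintype.card_fin, nsmul_eq_mul,
          Real.sqrt_mul (by positivity), Real.sqrt_sq h0]

theorem volume_closedBall_gridRadius {n : ℕ} {L : ℝ} (hL : 0 < L) (j : ℕ) (κ : Fin n → ℤ)
    (y : RSpace n) : volume (Metric.closedBall y (gridRadius n L j)) =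
      ENNReal.ofReal (√n ^ n) * volume (Metric.closedBall (0 : RSpace n) 1) *
        volume (gridCube L j κ) := by
  have h0 : 0 ≤ L / 2 ^ j := by positivity
  rw [volume_gridCube hL, gridRadius, volume_closedBall_mul _ h0 (by positivity)]
  have := volume_closedBall_mul (n := n) y (l := 1) zero_le_one h0
  rw [mul_one] at this
  rw [this, Measure.addHaar_closedBall_center volume y]
  ring

/-- Makes the family of stopping cubes inside the root cube finite. -/
theorem finite_gridMap_zero {n : ℕ} {L : ℝ} (j : ℕ) :
    (gridMap (n := n) L j '' gridCube L 0 0).Finite := by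
  refine (Set.finite_Icc (0 : Fin n → ℤ) (fun _ => 2 ^ j)).subset ?_
  rintro _ ⟨x, hx, rfl⟩
  simp only [gridCube, Set.mem_preimage, Set.mem_singleton_iff, funext_iff, gridMap, pow_zero,
    one_mul, Int.floor_eq_iff, Pi.zero_apply, Int.cast_zero, zero_add] at hx
  have h2 : (0 : ℝ) < 2 ^ j := by positivity
  refine ⟨fun i => ?_, fun i => ?_⟩
  · exact Int.floor_nonneg.2 (mul_nonneg h2.le (hx i).1)
  · have : (⌊2 ^ j * (x i / L + 1 / 2)⌋ : ℝ) ≤ 2 ^ j := by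
      refine (Int.floor_le _).trans ?_
      nlinarith [hx i]
    change ⌊2 ^ j * (x i / L + 1 / 2)⌋ ≤ (2 : ℤ) ^ j
    exact_mod_cast this

/-- A set which is a union of dyadic cubes of one generation is measurable. -/
theorem measurableSet_of_saturated {n : ℕ} {L : ℝ} {j : ℕ} {D : Set (RSpace n)}
    (hD : ∀ x ∈ D, ∀ y, gridMap L j y = gridMap L j x → y ∈ D) : MeasurableSet D := by
  have : D = gridMap L j ⁻¹' (gridMap L j '' D) := by
    ext y
    exact ⟨fun h => ⟨y, h, rfl⟩, fun ⟨x, hx, e⟩ => hD x hx y e.symm⟩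
  rw [this]
  exact measurable_gridMap L j (Set.to_countable _).measurableSet

/-- If the averages of `g` over the dyadic cubes that make up `D` exceed `t`, then so does the
average over `D`. -/
theorem mul_volume_le_of_saturated {n : ℕ} {L : ℝ} (hL : 0 < L) {j : ℕ} {D : Set (RSpace n)}
    (hD : ∀ x ∈ D, ∀ y, gridMap L j y = gridMap L j x → y ∈ D) {g : RSpace n → ℝ}
    (hDfin : volume D ≠ ∞) (hg : IntegrableOn g D) {t : ℝ}
    (ht : ∀ x ∈ D, t ≤ ⨍ y in gridCube L j (gridMap L j x), g y) :
    t * volume.real D ≤ ∫ y in D, g y := by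
  have hDm := measurableSet_of_saturated hD
  have hU : D = ⋃ κ : (gridMap (n := n) L j '' D), gridCube L j κ.1 := by
    ext y
    simp only [Set.mem_iUnion, Subtype.exists, gridCube, Set.mem_preimage, Set.mem_singleton_iff,
      exists_prop, exists_eq_right']
    exact ⟨fun h => ⟨y, h, rfl⟩, fun ⟨x, hx, e⟩ => hD x hx y e.symm⟩
  have hdis : Pairwise (Function.onFun Disjoint
      fun κ : (gridMap (n := n) L j '' D) => gridCube (n := n) L j κ.1) := by
    intro κ κ' hne
    refine Set.disjoint_left.2 fun x hx hx' => hne (Subtype.ext ?_)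
    exact (Set.mem_singleton_iff.1 hx).symm.trans (Set.mem_singleton_iff.1 hx')
  have h1 : HasSum (fun κ : (gridMap (n := n) L j '' D) => ∫ y in gridCube L j κ.1, g y)
      (∫ y in D, g y) := by
    have := hasSum_integral_iUnion (μ := volume) (f := g)
      (fun κ : (gridMap (n := n) L j '' D) => measurableSet_gridCube L j κ.1) hdis (by rwa [← hU])
    rwa [← hU] at this
  have h2 : HasSum (fun κ : (gridMap (n := n) L j '' D) => ∫ _y in gridCube L j κ.1, t)
      (∫ _y in D, t) := by
    have := hasSum_integral_iUnion (μ := volume) (f := fun _ : RSpace n => t)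
      (fun κ : (gridMap (n := n) L j '' D) => measurableSet_gridCube L j κ.1) hdis
      (by rw [← hU]; exact integrableOn_const hDfin)
    rwa [← hU] at this
  have h3 : ∫ _y in D, t = t * volume.real D := by simp [mul_comm]
  rw [← h3]
  refine hasSum_le (fun κ => ?_) h2 h1
  obtain ⟨κ, x, hx, rfl⟩ := κ
  have := ht x hx
  rw [setAverage_eq, smul_eq_mul, le_inv_mul_iff₀ (by
    rw [volume_real_gridCube hL]; positivity)] at this
  simpa using this

/-! ### Stopping cubes and sparse domination -/

/-- The average of `|b - c|^k` over the dyadic cube of generation `j` that contains `x`, where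
`c` is the constant attached to the cube of generation `i` that contains `x`. -/
def gridOsc {n : ℕ} (L : ℝ) (k : ℕ) (b : RSpace n → ℝ) (c : ℕ × (Fin n → ℤ) → ℝ) (i j : ℕ)
    (x : RSpace n) : ℝ :=
  ⨍ y in gridCube L j (gridMap L j x), |b y - c (i, gridMap L i x)| ^ k

open Classical in
/-- The generation of the smallest stopping cube, among those of generation at most `j`, that
contains `x`. -/
def stopLevel {n : ℕ} (L : ℝ) (k : ℕ) (b : RSpace n → ℝ) (c : ℕ × (Fin n → ℤ) → ℝ) :
    ℕ → RSpace n → ℕ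
  | 0, _ => 0
  | j + 1, x =>
    if 2 * gridOsc L k b c (stopLevel L k b c j x) (stopLevel L k b c j x) x <
      gridOsc L k b c (stopLevel L k b c j x) (j + 1) x then j + 1 else stopLevel L k b c j x

section

variable {n : ℕ} {L : ℝ} {k : ℕ} {b : RSpace n → ℝ} {c : ℕ × (Fin n → ℤ) → ℝ}

theorem gridOsc_congr {i j : ℕ} (hij : i ≤ j) {x y : RSpace n}
    (h : gridMap L j x = gridMap L j y) : gridOsc L k b c i j x = gridOsc L k b c i j y := by
  rw [gridOsc, gridOsc, h, gridMap_eq_of_le hij h]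

theorem gridOsc_nonneg (i j : ℕ) (x : RSpace n) : 0 ≤ gridOsc L k b c i j x := by
  rw [gridOsc, setAverage_eq]
  exact smul_nonneg (by positivity) (integral_nonneg fun _ => by positivity)

theorem stopLevel_le (j : ℕ) (x : RSpace n) : stopLevel L k b c j x ≤ j := by
  induction j with
  | zero => simp [stopLevel]
  | succ j ih => rw [stopLevel]; split_ifs <;> omega

/-- The stopping decisions up to generation `j` only look at cubes of generation at most `j`. Hence
the level sets of `stopLevel` are unions of dyadic cubes, and measurable. -/
theorem stopLevel_congr {j : ℕ} {x y : RSpace n} (h : gridMap L j x = gridMap L j y) :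
    stopLevel L k b c j x = stopLevel L k b c j y := by
  induction j with
  | zero => simp [stopLevel]
  | succ j ih =>
    have hs := ih (gridMap_eq_of_succ h)
    have hle := stopLevel_le (L := L) (k := k) (b := b) (c := c) j y
    rw [stopLevel, stopLevel, hs, gridOsc_congr (by omega) h,
      gridOsc_congr le_rfl (gridMap_eq_of_le (by omega) h)]

theorem stopLevel_mono {i j : ℕ} (hij : i ≤ j) (x : RSpace n) :
    stopLevel L k b c i x ≤ stopLevel L k b c j x := by
  induction j, hij using Nat.le_induction with
  | base => exact le_rfl
  | succ j _ ih =>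
    refine ih.trans ?_
    have := stopLevel_le (L := L) (k := k) (b := b) (c := c) j x
    conv_rhs => rw [stopLevel]
    split_ifs <;> omega

theorem stopLevel_succ_eq (j : ℕ) (x : RSpace n) :
    stopLevel L k b c (j + 1) x = j + 1 ∨
      stopLevel L k b c (j + 1) x = stopLevel L k b c j x := by
  rw [stopLevel]; split_ifs <;> simp

/-- Either generation `j` has just been selected, and the two oscillations coincide, or the failed
stopping test is exactly this bound. -/
theorem gridOsc_stopLevel_le (j : ℕ) (x : RSpace n) :
    gridOsc L k b c (stopLevel L k b c j x) j x ≤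
      2 * gridOsc L k b c (stopLevel L k b c j x) (stopLevel L k b c j x) x := by
  have key : ∀ i, gridOsc L k b c i i x ≤ 2 * gridOsc L k b c i i x := fun i => by
    have := gridOsc_nonneg (L := L) (k := k) (b := b) (c := c) i i x
    linarith
  cases j with
  | zero => simpa [stopLevel] using key 0
  | succ j =>
    rw [stopLevel]
    split_ifs with h
    · exact key _
    · exact not_lt.1 h

/-- A child has `2 ^ (-n)` times the volume of its parent. Thus a newly selected cube exceeds the
stopping threshold by a factor of at most `2 ^ n`. -/
theorem gridOsc_succ_le (hL : 0 < L)
    (hb : ∀ t j κ, IntegrableOn (fun y => |b y - t| ^ k) (gridCube L j κ)) (i j : ℕ)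
    (x : RSpace n) : gridOsc L k b c i (j + 1) x ≤ 2 ^ n * gridOsc L k b c i j x := by
  have hsub : gridCube L (j + 1) (gridMap L (j + 1) x) ⊆ gridCube L j (gridMap L j x) :=
    fun y hy => gridMap_eq_of_succ hy
  have h1 : ∫ y in gridCube L (j + 1) (gridMap L (j + 1) x), |b y - c (i, gridMap L i x)| ^ k ≤
      ∫ y in gridCube L j (gridMap L j x), |b y - c (i, gridMap L i x)| ^ k :=
    setIntegral_mono_set (hb _ _ _) (Eventually.of_forall fun _ => by positivity)
      hsub.eventuallyLE
  rw [gridOsc, gridOsc, setAverage_eq, setAverage_eq, volume_real_gridCube hL,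
    volume_real_gridCube hL, smul_eq_mul, smul_eq_mul]
  have e : ((L / 2 ^ (j + 1)) ^ n)⁻¹ = 2 ^ n * ((L / 2 ^ j) ^ n)⁻¹ := by
    rw [pow_succ, ← div_div, div_pow _ (2 : ℝ)]; field_simp
  rw [e, mul_assoc]
  gcongr

/-- Jensen's inequality on a cube. -/
theorem abs_setAverage_sub_le (hL : 0 < L) (hk : 1 ≤ k)
    (hbm : Measurable b)
    (hb : ∀ t j κ, IntegrableOn (fun y => |b y - t| ^ k) (gridCube L j κ)) (t : ℝ) (j : ℕ)
    (κ : Fin n → ℤ) :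
    |(⨍ y in gridCube L j κ, b y) - t| ≤
      (⨍ y in gridCube L j κ, |b y - t| ^ k) ^ (1 / k : ℝ) := by
  have hne : volume (gridCube L j κ) ≠ 0 := (volume_gridCube_pos hL j κ).ne'
  have hfin : volume (gridCube L j κ) ≠ ∞ := (volume_gridCube_lt_top hL j κ).ne
  have : IsFiniteMeasure (volume.restrict (gridCube L j κ)) := ⟨by
    rw [Measure.restrict_apply_univ]; exact hfin.lt_top⟩
  have : NeZero (volume.restrict (gridCube L j κ)) := ⟨by simpa using hne⟩
  have h1 : ∀ s, Integrable (fun y => |b y - s|) (volume.restrict (gridCube L j κ)) := by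
    intro s
    refine ((integrable_const (1 : ℝ)).add (hb s j κ)).mono' (by fun_prop)
      (Eventually.of_forall fun y => ?_)
    rw [Real.norm_eq_abs, abs_abs]
    simp only [Pi.add_apply]
    rcases le_total |b y - s| 1 with h | h
    · have : 0 ≤ |b y - s| ^ k := by positivity
      linarith
    · have := le_self_pow₀ h (by omega : k ≠ 0)
      linarith
  have hbi : Integrable b (volume.restrict (gridCube L j κ)) := by
    refine (h1 0).mono' (by fun_prop) (Eventually.of_forall fun y => by simp)
  have h2 : |(⨍ y in gridCube L j κ, b y) - t| ≤ ⨍ y in gridCube L j κ, |b y - t| := by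
    have e : (⨍ y in gridCube L j κ, b y) - t = ⨍ y in gridCube L j κ, (b y - t) := by
      rw [setAverage_eq, setAverage_eq, integral_sub hbi (integrable_const _)]
      have : volume.real (gridCube L j κ) ≠ 0 := by
        rw [volume_real_gridCube hL]; positivity
      simp only [smul_eq_mul, setIntegral_const]
      field_simp
    rw [e, setAverage_eq, setAverage_eq, smul_eq_mul, smul_eq_mul, abs_mul,
      abs_of_nonneg (by positivity : 0 ≤ (volume.real (gridCube L j κ))⁻¹)]
    gcongr
    exact abs_integral_le_integral_abs
  have h3 : (⨍ y in gridCube L j κ, |b y - t|) ^ k ≤ ⨍ y in gridCube L j κ, |b y - t| ^ k :=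
    (convexOn_pow k).map_average_le (s := Set.Ici (0 : ℝ)) (by fun_prop) isClosed_Ici
      (Eventually.of_forall fun y => Set.mem_Ici.2 (abs_nonneg _)) (h1 t) (hb t j κ)
  refine h2.trans ?_
  have h0 : 0 ≤ ⨍ y in gridCube L j κ, |b y - t| := (abs_nonneg _).trans h2
  rw [one_div]
  exact (Real.le_rpow_inv_iff_of_pos h0 ((pow_nonneg h0 k).trans h3) (by positivity)).2
    (by rwa [Real.rpow_natCast])

/-- The index of the smallest stopping cube of generation at most `N` that contains `x`. -/
def stopIndex (L : ℝ) (k : ℕ) (b : RSpace n → ℝ) (c : ℕ × (Fin n → ℤ) → ℝ) (N : ℕ)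
    (x : RSpace n) : ℕ × (Fin n → ℤ) :=
  (stopLevel L k b c N x, gridMap L (stopLevel L k b c N x) x)

/-- A Chebyshev argument: on the maximal stopping cubes strictly inside `Q` the average of `|b - t|
^ k` is more than twice its average over `Q`, so together they fill at most half of `Q`. On the rest
of `Q` the smallest stopping cube is `Q` itself. -/
theorem volume_gridCube_le_two_mul (hL : 0 < L)
    (hb : ∀ t j κ, IntegrableOn (fun y => |b y - t| ^ k) (gridCube L j κ)) {N j : ℕ}
    (hj : j ≤ N) {x₀ : RSpace n} (hx₀ : stopLevel L k b c j x₀ = j) :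
    volume (gridCube L j (gridMap L j x₀)) ≤
      2 * volume {x | stopIndex L k b c N x = (j, gridMap L j x₀)} := by
  classical
  set Q := gridCube L j (gridMap L j x₀) with hQ
  set t := c (j, gridMap L j x₀) with ht
  set g : RSpace n → ℝ := fun y => |b y - t| ^ k with hg
  set a := gridOsc L k b c j j x₀ with ha
  set σ := stopLevel L k b c with hσ
  have hQfin : volume Q ≠ ∞ := (volume_gridCube_lt_top hL _ _).ne
  have hQlev : ∀ x ∈ Q, gridMap L j x = gridMap L j x₀ := fun x hx => hx
  have hσQ : ∀ x ∈ Q, σ j x = j := fun x hx => (stopLevel_congr (hQlev x hx)).trans hx₀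
  -- `D i` collects the points of `Q` whose first stopping generation after `j` is `i + 1`.
  set D : ℕ → Set (RSpace n) := fun i => {x | x ∈ Q ∧ σ i x = j ∧ σ (i + 1) x = i + 1} with hD
  have hDsub : ∀ i, D i ⊆ Q := fun i x hx => hx.1
  have hsat : ∀ i, j ≤ i → ∀ x ∈ D i, ∀ y, gridMap L (i + 1) y = gridMap L (i + 1) x →
      y ∈ D i := by
    rintro i hi x ⟨h1, h2, h3⟩ y hy
    refine ⟨(gridMap_eq_of_le (by omega) hy).trans h1, ?_, ?_⟩
    · exact (stopLevel_congr (gridMap_eq_of_succ hy)).trans h2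
    · exact (stopLevel_congr hy).trans h3
  have hgi : ∀ κ, IntegrableOn g (gridCube L j κ) := fun κ => hb t j κ
  have hint : ∀ i, j ≤ i → 2 * a * volume.real (D i) ≤ ∫ y in D i, g y ∧
      ((D i).Nonempty → a ≠ 0) := by
    intro i hi
    have havg : ∀ x ∈ D i, 2 * a < ⨍ y in gridCube L (i + 1) (gridMap L (i + 1) x), g y := by
      rintro x ⟨h1, h2, h3⟩
      by_contra hcon
      have e1 : gridOsc L k b c j j x = a := gridOsc_congr le_rfl (hQlev x h1)
      have e2 : gridOsc L k b c j (i + 1) x =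
          ⨍ y in gridCube L (i + 1) (gridMap L (i + 1) x), g y := by
        rw [gridOsc, hQlev x h1]
      have h3' := h3
      simp only [hσ] at h2 h3'
      rw [stopLevel, h2, e1, e2, if_neg hcon] at h3'
      omega
    refine ⟨mul_volume_le_of_saturated hL (hsat i hi)
      (ne_top_of_le_ne_top hQfin (measure_mono (hDsub i)))
      ((hgi _).mono_set (hDsub i)) fun x hx => (havg x hx).le, ?_⟩
    -- If `a = 0` then `g` has integral zero over `Q` and over every subcube, so the strict stopping
    -- test never succeeds. This case is separated because the Chebyshev step divides by `a`.
    rintro ⟨x, hx⟩ ha0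
    have h1 := havg x hx
    rw [ha0, mul_zero, setAverage_eq, smul_eq_mul] at h1
    have hQ0 : ∫ y in Q, g y = 0 := by
      have : a = (volume.real Q)⁻¹ * ∫ y in Q, g y := by
        rw [ha, gridOsc, setAverage_eq, smul_eq_mul]
      rw [ha0] at this
      have hp : volume.real Q ≠ 0 := by rw [hQ, volume_real_gridCube hL]; positivity
      simpa [hp] using this.symm
    have hle : ∫ y in gridCube L (i + 1) (gridMap L (i + 1) x), g y ≤ ∫ y in Q, g y := by
      refine setIntegral_mono_set (hgi _) (Eventually.of_forall fun _ => by positivity)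
        (LE.le.eventuallyLE fun y hy => ?_)
      exact (gridMap_eq_of_le (by omega) (Set.mem_singleton_iff.1 hy)).trans hx.1
    have : (volume.real (gridCube L (i + 1) (gridMap L (i + 1) x)))⁻¹ *
        ∫ y in gridCube L (i + 1) (gridMap L (i + 1) x), g y ≤ 0 :=
      mul_nonpos_of_nonneg_of_nonpos (by positivity) (hle.trans hQ0.le)
    linarith
  have hdis : ((Finset.Ico j N : Finset ℕ) : Set ℕ).PairwiseDisjoint D := by
    have key : ∀ i i', i < i' → Disjoint (D i) (D i') := by
      intro i i' hlt
      refine Set.disjoint_left.2 fun x hx hx' => ?_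
      have h1 := stopLevel_mono (L := L) (k := k) (b := b) (c := c) (by omega : i + 1 ≤ i') x
      have h2 := stopLevel_le (L := L) (k := k) (b := b) (c := c) i x
      have h3 := hx.2.1
      have h4 := hx.2.2
      have h5 := hx'.2.1
      simp only [hσ] at h3 h4 h5
      omega
    intro i _ i' _ hne
    rcases lt_or_gt_of_ne hne with h | h
    · exact key _ _ h
    · exact (key _ _ h).symm
  have hDm : ∀ i ∈ Finset.Ico j N, MeasurableSet (D i) := fun i hi =>
    measurableSet_of_saturated (hsat i (Finset.mem_Ico.1 hi).1)
  set U := ⋃ i ∈ Finset.Ico j N, D i with hU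
  have hUQ : U ⊆ Q := Set.iUnion₂_subset fun i _ => hDsub i
  have hUm : MeasurableSet U := Finset.measurableSet_biUnion _ hDm
  have hUvol : volume.real U = ∑ i ∈ Finset.Ico j N, volume.real (D i) := by
    rw [Measure.real, hU, measure_biUnion_finset hdis hDm, ENNReal.toReal_sum]
    · rfl
    · exact fun i _ => ne_top_of_le_ne_top hQfin (measure_mono (hDsub i))
  have hmain : 2 * volume.real U ≤ volume.real Q := by
    by_cases ha0 : a = 0
    · have : U = ∅ := by
        rw [hU, Set.eq_empty_iff_forall_notMem]
        intro x hx
        simp only [Set.mem_iUnion] at hx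
        obtain ⟨i, hi, hx⟩ := hx
        exact (hint i (Finset.mem_Ico.1 hi).1).2 ⟨x, hx⟩ ha0
      rw [this]; simp
    · have hapos : 0 < a := lt_of_le_of_ne (gridOsc_nonneg _ _ _) (Ne.symm ha0)
      have h1 : 2 * a * volume.real U ≤ ∫ y in U, g y := by
        rw [hUvol, Finset.mul_sum, hU, integral_biUnion_finset _ hDm hdis
          (fun i _ => (hgi _).mono_set (hDsub i))]
        exact Finset.sum_le_sum fun i hi => (hint i (Finset.mem_Ico.1 hi).1).1
      have h2 : ∫ y in U, g y ≤ ∫ y in Q, g y :=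
        setIntegral_mono_set (hgi _) (Eventually.of_forall fun _ => by positivity)
          hUQ.eventuallyLE
      have h3 : ∫ y in Q, g y = a * volume.real Q := by
        have hp : volume.real Q ≠ 0 := by rw [hQ, volume_real_gridCube hL]; positivity
        have : a = (volume.real Q)⁻¹ * ∫ y in Q, g y := by
          rw [ha, gridOsc, setAverage_eq, smul_eq_mul]
        rw [this]
        field_simp
      rw [h3] at h2
      nlinarith
  -- A point of `Q` outside all `D i` keeps level `j` through every generation up to `N`.
  have hcover : Q ⊆ U ∪ {x | stopIndex L k b c N x = (j, gridMap L j x₀)} := by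
    intro x hx
    by_contra hcon
    simp only [Set.mem_union, not_or, hU, Set.mem_iUnion, not_exists] at hcon
    have hind : ∀ i, j ≤ i → i ≤ N → σ i x = j := by
      intro i hi
      induction i, hi using Nat.le_induction with
      | base => exact fun _ => hσQ x hx
      | succ i hi ih =>
        intro hN
        have h1 := ih (by omega)
        rcases stopLevel_succ_eq (L := L) (k := k) (b := b) (c := c) i x with h | h
        · exact absurd ⟨hx, h1, h⟩ (hcon.1 i (Finset.mem_Ico.2 ⟨hi, by omega⟩))
        · exact h.trans h1
    refine hcon.2 ?_
    have := hind N hj le_rfl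
    simp only [hσ] at this
    simp only [Set.mem_ofPred_eq, stopIndex, this, hQlev x hx]
  have hUle : 2 * volume U ≤ volume Q := by
    have hUfin : volume U ≠ ∞ := ne_top_of_le_ne_top hQfin (measure_mono hUQ)
    rw [← ENNReal.toReal_le_toReal (ENNReal.mul_ne_top (by simp) hUfin) hQfin]
    simpa [Measure.real] using hmain
  have h1 : volume Q ≤ volume U + volume {x | stopIndex L k b c N x = (j, gridMap L j x₀)} :=
    (measure_mono hcover).trans (measure_union_le _ _)
  have h2 : volume Q + volume Q ≤
      volume Q + 2 * volume {x | stopIndex L k b c N x = (j, gridMap L j x₀)} := by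
    calc volume Q + volume Q = 2 * volume Q := (two_mul _).symm
      _ ≤ 2 * (volume U + volume {x | stopIndex L k b c N x = (j, gridMap L j x₀)}) := by gcongr
      _ = 2 * volume U + 2 * volume {x | stopIndex L k b c N x = (j, gridMap L j x₀)} := by ring
      _ ≤ _ := by gcongr
  exact (ENNReal.add_le_add_iff_left hQfin).1 h2

/-- Telescoping along the chain of stopping cubes that contain `x`, by induction on `N`. The second
term on the left is a prepayment: the next jump costs the oscillation of the new cube plus `(2 * 2 ^
n) ^ (1 / k)` times that of the current one, and the latter has already been counted. -/
theorem abs_stop_constant_sub_le (hL : 0 < L) (hk : 1 ≤ k) (hbm : Measurable b)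
    (hb : ∀ t j κ, IntegrableOn (fun y => |b y - t| ^ k) (gridCube L j κ)) (N : ℕ)
    (x : RSpace n) :
    |c (stopIndex L k b c N x) - c (0, gridMap L 0 x)| + (2 * 2 ^ n) ^ (1 / k : ℝ) *
        gridOsc L k b c (stopLevel L k b c N x) (stopLevel L k b c N x) x ^ (1 / k : ℝ) ≤
      (1 + (2 * 2 ^ n) ^ (1 / k : ℝ)) * ∑ j ∈ Finset.range (N + 1),
        if stopLevel L k b c j x = j then gridOsc L k b c j j x ^ (1 / k : ℝ) else 0 := by
  have hC : (0 : ℝ) ≤ (2 * 2 ^ n) ^ (1 / k : ℝ) := by positivity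
  induction N with
  | zero =>
    have : 0 ≤ gridOsc L k b c 0 0 x ^ (1 / k : ℝ) := Real.rpow_nonneg (gridOsc_nonneg _ _ _) _
    simp only [stopIndex, stopLevel, sub_self, abs_zero, zero_add, Finset.range_one,
      Finset.sum_singleton, if_true]
    linarith
  | succ N ih =>
    rw [Finset.sum_range_succ]
    rcases stopLevel_succ_eq (L := L) (k := k) (b := b) (c := c) N x with h | h
    · rw [if_pos h, mul_add]
      set i := stopLevel L k b c N x with hi
      have e1 : stopIndex L k b c (N + 1) x = (N + 1, gridMap L (N + 1) x) := by
        rw [stopIndex, h]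
      have e2 : stopIndex L k b c N x = (i, gridMap L i x) := rfl
      rw [e1, h]
      rw [e2] at ih
      -- The average of `b` over the new cube mediates between the old and the new constant; Jensen
      -- compares it with either one.
      set A := ⨍ y in gridCube L (N + 1) (gridMap L (N + 1) x), b y
      have h1 : |A - c (N + 1, gridMap L (N + 1) x)| ≤
          gridOsc L k b c (N + 1) (N + 1) x ^ (1 / k : ℝ) :=
        abs_setAverage_sub_le hL hk hbm hb _ _ _
      have h2 : |A - c (i, gridMap L i x)| ≤ gridOsc L k b c i (N + 1) x ^ (1 / k : ℝ) :=
        abs_setAverage_sub_le hL hk hbm hb _ _ _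
      have h3 : gridOsc L k b c i (N + 1) x ^ (1 / k : ℝ) ≤
          (2 * 2 ^ n) ^ (1 / k : ℝ) * gridOsc L k b c i i x ^ (1 / k : ℝ) := by
        rw [← Real.mul_rpow (by positivity) (gridOsc_nonneg _ _ _)]
        refine Real.rpow_le_rpow (gridOsc_nonneg _ _ _) ?_ (by positivity)
        have h4 := gridOsc_succ_le (c := c) hL hb i N x
        have h5 := gridOsc_stopLevel_le (L := L) (k := k) (b := b) (c := c) N x
        rw [← hi] at h5
        have : (0 : ℝ) < 2 ^ n := by positivity
        nlinarith
      have h6 : |c (N + 1, gridMap L (N + 1) x) - c (0, gridMap L 0 x)| ≤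
          |A - c (N + 1, gridMap L (N + 1) x)| + |A - c (i, gridMap L i x)| +
            |c (i, gridMap L i x) - c (0, gridMap L 0 x)| := by
        have := abs_add_three (-(A - c (N + 1, gridMap L (N + 1) x))) (A - c (i, gridMap L i x))
          (c (i, gridMap L i x) - c (0, gridMap L 0 x))
        rw [abs_neg] at this
        refine le_trans (le_of_eq ?_) this
        congr 1; ring
      nlinarith
    · have e1 : stopIndex L k b c (N + 1) x = stopIndex L k b c N x := by
        rw [stopIndex, h]; rfl
      rw [e1, h]
      refine ih.trans ?_
      have h0 : 0 ≤ (if stopLevel L k b c N x = N + 1 then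
          gridOsc L k b c (N + 1) (N + 1) x ^ (1 / k : ℝ) else 0) := by
        split_ifs
        · exact Real.rpow_nonneg (gridOsc_nonneg _ _ _) _
        · exact le_rfl
      nlinarith

/-- **Sparse domination** of the oscillation of `b` on a cube, at the scale of the dyadic
cubes of generation `N`. -/
theorem exists_sparse_domination (hL : 0 < L) (hk : 1 ≤ k) (hbm : Measurable b)
    (hb : ∀ t j κ, IntegrableOn (fun y => |b y - t| ^ k) (gridCube L j κ))
    (c : ℕ × (Fin n → ℤ) → ℝ) (N : ℕ) :
    ∃ (S : Finset (ℕ × (Fin n → ℤ))) (E : ℕ × (Fin n → ℤ) → Set (RSpace n)),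
      (∀ I, MeasurableSet (E I)) ∧ (∀ I, E I ⊆ gridCube L I.1 I.2) ∧
      Pairwise (Function.onFun Disjoint E) ∧
      (∀ I ∈ S, volume (gridCube L I.1 I.2) ≤ 2 * volume (E I)) ∧
      ∀ x ∈ gridCube L 0 0, |(⨍ y in gridCube L N (gridMap L N x), b y) - c (0, 0)| ≤
        (1 + (2 * 2 ^ n) ^ (1 / k : ℝ)) * ∑ I ∈ S, (gridCube L I.1 I.2).indicator
          (fun _ => (⨍ y in gridCube L I.1 I.2, |b y - c I| ^ k) ^ (1 / k : ℝ)) x := by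
  classical
  -- The family consists of the stopping cubes of generation at most `N` that contain a point of the
  -- root cube; generation `0` always stops, so the root cube belongs to it.
  set T : Set (ℕ × (Fin n → ℤ)) := {I | I.1 ≤ N ∧ ∃ x ∈ gridCube L 0 0,
    stopLevel L k b c I.1 x = I.1 ∧ gridMap L I.1 x = I.2} with hT
  have hTfin : T.Finite := by
    have : T ⊆ ⋃ j ∈ Finset.range (N + 1),
        (fun κ => (j, κ)) '' (gridMap L j '' gridCube (n := n) L 0 0) := by
      rintro ⟨j, κ⟩ ⟨h1, x, hx, -, h3⟩
      simp only [Set.mem_iUnion]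
      exact ⟨j, Finset.mem_range.2 (by simpa [Nat.lt_succ_iff] using h1), κ, ⟨x, hx, h3⟩, rfl⟩
    refine Set.Finite.subset ?_ this
    exact (Finset.range (N + 1)).finite_toSet.biUnion fun j _ =>
      (finite_gridMap_zero j).image _
  -- The major subset of `I` is the set of points whose smallest stopping cube is `I`; as fibres of
  -- one map these sets are disjoint.
  refine ⟨hTfin.toFinset, fun I => {x | stopIndex L k b c N x = I}, ?_, ?_, ?_, ?_, ?_⟩
  · intro I
    refine measurableSet_of_saturated (L := L) (j := N) fun x hx y hy => ?_
    have h1 := stopLevel_congr (k := k) (b := b) (c := c) hy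
    have h2 := stopLevel_le (L := L) (k := k) (b := b) (c := c) N x
    simp only [Set.mem_ofPred_eq, stopIndex] at hx ⊢
    rw [h1, gridMap_eq_of_le h2 hy, hx]
  · rintro I x rfl
    exact rfl
  · intro I I' hne
    exact Set.disjoint_left.2 fun x hx hx' => hne (Eq.trans (Eq.symm hx) hx')
  · rintro ⟨j, κ⟩ hI
    obtain ⟨hj, x, -, hσ, hκ⟩ := hTfin.mem_toFinset.1 hI
    have := volume_gridCube_le_two_mul hL hb hj hσ
    simp only at hκ
    rw [hκ] at this
    exact this
  · intro x hx
    have hx0 : gridMap L 0 x = 0 := hx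
    have hC : (0 : ℝ) ≤ (2 * 2 ^ n) ^ (1 / k : ℝ) := by positivity
    have h1 := abs_stop_constant_sub_le (c := c) hL hk hbm hb N x
    rw [hx0] at h1
    set i := stopLevel L k b c N x with hi
    have e : stopIndex L k b c N x = (i, gridMap L i x) := rfl
    rw [e] at h1
    -- The remaining gap, from the last stopping constant to the average at generation `N`, is
    -- covered by the prepaid term of `abs_stop_constant_sub_le`.
    have h2 : |(⨍ y in gridCube L N (gridMap L N x), b y) - c (i, gridMap L i x)| ≤
        gridOsc L k b c i N x ^ (1 / k : ℝ) := abs_setAverage_sub_le hL hk hbm hb _ _ _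
    have h3 : gridOsc L k b c i N x ^ (1 / k : ℝ) ≤
        (2 * 2 ^ n) ^ (1 / k : ℝ) * gridOsc L k b c i i x ^ (1 / k : ℝ) := by
      rw [← Real.mul_rpow (by positivity) (gridOsc_nonneg _ _ _)]
      refine Real.rpow_le_rpow (gridOsc_nonneg _ _ _) ?_ (by positivity)
      have h5 := gridOsc_stopLevel_le (L := L) (k := k) (b := b) (c := c) N x
      rw [← hi] at h5
      have h6 : (1 : ℝ) ≤ 2 ^ n := one_le_pow₀ (by norm_num)
      have h7 := gridOsc_nonneg (L := L) (k := k) (b := b) (c := c) i i x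
      nlinarith
    have h4 := abs_sub_le (⨍ y in gridCube L N (gridMap L N x), b y) (c (i, gridMap L i x))
      (c (0, 0))
    refine le_trans (by linarith) (h1.trans ?_)
    refine mul_le_mul_of_nonneg_left ?_ (by linarith)
    rw [← Finset.sum_filter]
    have hinj : Set.InjOn (fun j => (j, gridMap L j x))
        ((Finset.range (N + 1)).filter fun j => stopLevel L k b c j x = j) :=
      fun a _ a' _ h => (Prod.ext_iff.1 h).1
    have h5 : ∑ j ∈ (Finset.range (N + 1)).filter fun j => stopLevel L k b c j x = j,
        gridOsc L k b c j j x ^ (1 / k : ℝ) =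
        ∑ I ∈ ((Finset.range (N + 1)).filter fun j => stopLevel L k b c j x = j).image
          (fun j => (j, gridMap L j x)), (gridCube L I.1 I.2).indicator
          (fun _ => (⨍ y in gridCube L I.1 I.2, |b y - c I| ^ k) ^ (1 / k : ℝ)) x := by
      rw [Finset.sum_image hinj]
      refine Finset.sum_congr rfl fun j _ => ?_
      rw [Set.indicator_of_mem (show x ∈ gridCube L j (gridMap L j x) from rfl)]
      rfl
    rw [h5]
    refine Finset.sum_le_sum_of_subset_of_nonneg ?_ fun I _ _ => ?_
    · intro I hI
      obtain ⟨j, hj, rfl⟩ := Finset.mem_image.1 hI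
      obtain ⟨hj1, hj2⟩ := Finset.mem_filter.1 hj
      exact hTfin.mem_toFinset.2 ⟨by simpa [Nat.lt_succ_iff] using hj1, x, hx, hj2, rfl⟩
    · refine Set.indicator_nonneg (fun _ _ => Real.rpow_nonneg ?_ _) _
      rw [setAverage_eq]
      exact smul_nonneg (by positivity) (integral_nonneg fun _ => by positivity)

end

/-! ### Bounded functions with bounded support, and continuity of the operator -/

/-- Bounded measurable functions that vanish outside `A`. -/
structure BddOn {n : ℕ} (A : Set (RSpace n)) (f : RSpace n → ℂ) : Prop where
  measurable : Measurable f
  bounded : ∃ M : ℝ, ∀ x, ‖f x‖ ≤ M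
  zero_off : ∀ x, x ∉ A → f x = 0

section

variable {n m : ℕ} {A A' : Set (RSpace n)} {f g : RSpace n → ℂ}

theorem BddOn.mono (hf : BddOn A f) (h : A ⊆ A') : BddOn A' f :=
  ⟨hf.1, hf.2, fun x hx => hf.3 x fun hxA => hx (h hxA)⟩

theorem BddOn.exists_bound (hf : BddOn A f) : ∃ M : ℝ, 0 ≤ M ∧ ∀ x, ‖f x‖ ≤ M := by
  obtain ⟨M, hM⟩ := hf.2
  exact ⟨M, (norm_nonneg _).trans (hM 0), hM⟩

theorem BddOn.memLp (hf : BddOn A f) (hA : Bornology.IsBounded A) (u : ℝ≥0∞) :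
    MemLp f u volume := by
  obtain ⟨M, hM0, hM⟩ := hf.exists_bound
  obtain ⟨R, hR⟩ := hA.subset_closedBall 0
  have hAm : MeasurableSet (Metric.closedBall (0 : RSpace n) R) :=
    Metric.isClosed_closedBall.measurableSet
  have h1 : MemLp ((Metric.closedBall (0 : RSpace n) R).indicator fun _ => M) u volume :=
    memLp_indicator_const _ hAm _ (Or.inr measure_closedBall_lt_top.ne)
  refine h1.mono hf.1.aestronglyMeasurable (Eventually.of_forall fun x => ?_)
  by_cases hx : x ∈ Metric.closedBall (0 : RSpace n) R
  · rw [Set.indicator_of_mem hx]; exact (hM x).trans (le_abs_self M)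
  · rw [hf.3 x fun h => hx (hR h)]; simp

theorem BddOn.of_test (hf : IsTestFunction f) (hA : tsupport f ⊆ A) : BddOn A f := by
  refine ⟨hf.1.continuous.measurable, ?_, fun x hx => ?_⟩
  · exact hf.2.exists_bound_of_continuous hf.1.continuous
  · exact image_eq_zero_of_notMem_tsupport fun h => hx (hA h)

theorem BddOn.mul_left {a : RSpace n → ℂ} (hf : BddOn A f) (ha : Measurable a)
    (hb : ∃ M : ℝ, ∀ x ∈ A, ‖a x‖ ≤ M) : BddOn A fun x => a x * f x := by
  refine ⟨ha.mul hf.1, ?_, fun x hx => by rw [hf.3 x hx, mul_zero]⟩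
  obtain ⟨M, hM0, hM⟩ := hf.exists_bound
  obtain ⟨M', hM'⟩ := hb
  refine ⟨|M'| * M, fun x => ?_⟩
  by_cases hx : x ∈ A
  · rw [norm_mul]
    exact mul_le_mul ((hM' x hx).trans (le_abs_self _)) (hM x) (norm_nonneg _) (abs_nonneg _)
  · rw [hf.3 x hx, mul_zero, norm_zero]; positivity

/-- Mollification of a bounded function with compact support. -/
theorem BddOn.exists_approx {y : RSpace n} {ρ ρ' : ℝ} (hρ : ρ < ρ')
    (hf : BddOn (Metric.closedBall y ρ) f) :
    ∃ (g : ℕ → RSpace n → ℂ) (M : ℝ), (∀ N, IsTestFunction (g N)) ∧ (∀ N x, ‖g N x‖ ≤ M) ∧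
      (∀ N, tsupport (g N) ⊆ Metric.closedBall y ρ') ∧
      ∀ᵐ x ∂(volume : Measure (RSpace n)), Tendsto (fun N => g N x) atTop (𝓝 (f x)) := by
  obtain ⟨M, hM0, hM⟩ := hf.exists_bound
  have hδ : 0 < ρ' - ρ := by linarith
  -- The outer radii tend to zero and never exceed `ρ' - ρ`, which keeps the mollified functions
  -- supported in the larger ball. The fixed ratio `2` of outer to inner radius is what a.e.
  -- convergence of the convolutions asks for.
  let φ : ℕ → ContDiffBump (0 : RSpace n) := fun N =>
    ⟨(ρ' - ρ) / (N + 1) / 2, (ρ' - ρ) / (N + 1), by positivity, by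
      have : 0 < (ρ' - ρ) / (N + 1) := by positivity
      linarith⟩
  have hloc : LocallyIntegrable f volume :=
    (memLp_one_iff_integrable.1 (hf.memLp Metric.isBounded_closedBall 1)).locallyIntegrable
  have hsupp : ∀ N, tsupport (MeasureTheory.convolution ((φ N).normed volume) f
      (ContinuousLinearMap.lsmul ℝ ℝ) volume) ⊆ Metric.closedBall y ρ' := by
    intro N
    refine closure_minimal ?_ Metric.isClosed_closedBall
    refine (support_convolution_subset _).trans ?_
    rintro _ ⟨u, hu, v, hv, rfl⟩
    rw [(φ N).support_normed_eq] at hu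
    have hv' : v ∈ Metric.closedBall y ρ := by
      by_contra h; exact hv (hf.3 v h)
    rw [Metric.mem_closedBall, dist_eq_norm] at hv' ⊢
    rw [mem_ball_zero_iff] at hu
    have h1 : (φ N).rOut ≤ ρ' - ρ := by
      change (ρ' - ρ) / (N + 1) ≤ ρ' - ρ
      exact div_le_self hδ.le (by linarith [(Nat.cast_nonneg N : (0 : ℝ) ≤ N)])
    calc ‖u + v - y‖ = ‖u + (v - y)‖ := by congr 1; abel
      _ ≤ ‖u‖ + ‖v - y‖ := norm_add_le _ _
      _ ≤ ρ' := by linarith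
  refine ⟨fun N => MeasureTheory.convolution ((φ N).normed volume) f
    (ContinuousLinearMap.lsmul ℝ ℝ) volume, M, fun N => ⟨?_, ?_⟩, ?_, hsupp, ?_⟩
  · exact (φ N).hasCompactSupport_normed.contDiff_convolution_left _ (φ N).contDiff_normed hloc
  · exact HasCompactSupport.intro (isCompact_closedBall y ρ') fun x hx =>
      image_eq_zero_of_notMem_tsupport fun h => hx (hsupp N h)
  · intro N x
    simp only [convolution_def]
    calc ‖∫ t, (ContinuousLinearMap.lsmul ℝ ℝ) ((φ N).normed volume t) (f (x - t))‖
        ≤ ∫ t, (φ N).normed volume t * M := by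
          refine norm_integral_le_of_norm_le ((φ N).integrable_normed.mul_const M)
            (Eventually.of_forall fun t => ?_)
          simp only [ContinuousLinearMap.lsmul_apply, norm_smul, Real.norm_eq_abs]
          rw [abs_of_nonneg ((φ N).nonneg_normed t)]
          exact mul_le_mul_of_nonneg_left (hM _) ((φ N).nonneg_normed t)
      _ = M := by rw [integral_mul_const, (φ N).integral_normed, one_mul]
  · refine ContDiffBump.ae_convolution_tendsto_right_of_locallyIntegrable (K := 2) ?_ ?_ hloc
    · have := tendsto_one_div_add_atTop_nhds_zero_nat (𝕜 := ℝ)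
      have h2 := this.const_mul (ρ' - ρ)
      rw [mul_zero] at h2
      refine h2.congr fun N => ?_
      change (ρ' - ρ) * (1 / ((N : ℝ) + 1)) = (ρ' - ρ) / (N + 1)
      ring
    · refine Eventually.of_forall fun N => ?_
      change (ρ' - ρ) / (N + 1) ≤ 2 * ((ρ' - ρ) / (N + 1) / 2)
      linarith

theorem tendsto_eLpNorm_sub_of_bdd {g : ℕ → RSpace n → ℂ} {u : ℝ≥0∞} (hu0 : u ≠ 0) (hu : u ≠ ∞)
    (hA : Bornology.IsBounded A) {M : ℝ} (hg : ∀ N, BddOn A (g N)) (hgM : ∀ N x, ‖g N x‖ ≤ M)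
    (hf : BddOn A f)
    (hlim : ∀ᵐ x ∂(volume : Measure (RSpace n)), Tendsto (fun N => g N x) atTop (𝓝 (f x))) :
    Tendsto (fun N => eLpNorm (g N - f) u volume) atTop (𝓝 0) := by
  obtain ⟨M', hM'0, hM'⟩ := hf.exists_bound
  obtain ⟨R, hR⟩ := hA.subset_closedBall 0
  have hup : 0 < u.toReal := ENNReal.toReal_pos hu0 hu
  have hM0 : 0 ≤ M := (norm_nonneg _).trans (hgM 0 0)
  have key : Tendsto (fun N => ∫⁻ x, ‖(g N - f) x‖ₑ ^ u.toReal) atTop (𝓝 (∫⁻ _x : RSpace n, 0)) := by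
    refine tendsto_lintegral_of_dominated_convergence
      ((Metric.closedBall (0 : RSpace n) R).indicator fun _ => (ENNReal.ofReal (M + M')) ^ u.toReal)
      (fun N => ?_) (fun N => Eventually.of_forall fun x => ?_) ?_ ?_
    · exact (((hg N).1.sub hf.1).enorm).pow_const _
    · by_cases hx : x ∈ Metric.closedBall (0 : RSpace n) R
      · rw [Set.indicator_of_mem hx]
        refine ENNReal.rpow_le_rpow ?_ hup.le
        rw [← ofReal_norm]
        refine ENNReal.ofReal_le_ofReal ((norm_sub_le _ _).trans ?_)
        exact add_le_add (hgM N x) (hM' x)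
      · have hxA : x ∉ A := fun h => hx (hR h)
        simp only [Pi.sub_apply, (hg N).3 x hxA, hf.3 x hxA]
        simp [ENNReal.zero_rpow_of_pos hup]
    · rw [lintegral_indicator Metric.isClosed_closedBall.measurableSet, setLIntegral_const]
      exact ENNReal.mul_ne_top (ENNReal.rpow_ne_top_of_nonneg hup.le ENNReal.ofReal_ne_top)
        measure_closedBall_lt_top.ne
    · filter_upwards [hlim] with x hx
      have h1 : Tendsto (fun N => (g N - f) x) atTop (𝓝 0) := by
        have := hx.sub_const (f x)
        simpa using this
      have h2 := h1.enorm
      have h3 := (ENNReal.continuous_rpow_const (y := u.toReal)).tendsto (‖(0 : ℂ)‖ₑ)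
      have h4 := h3.comp h2
      simpa [ENNReal.zero_rpow_of_pos hup, Function.comp_def] using h4
  rw [lintegral_zero] at key
  have h3 := (ENNReal.continuous_rpow_const (y := 1 / u.toReal)).tendsto 0
  have h4 := h3.comp key
  rw [ENNReal.zero_rpow_of_pos (by positivity)] at h4
  refine h4.congr fun N => ?_
  rw [eLpNorm_eq_lintegral_rpow_enorm_toReal hu0 hu]
  rfl

theorem LpMultilinear.onFunctions_update {s : Fin m → ℝ≥0∞} {s₀ : ℝ≥0∞}
    (T : LpMultilinear n m s s₀) (f : Fin m → RSpace n → ℂ) (i : Fin m) (g : RSpace n → ℂ) :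
    T.onFunctions (Function.update f i g) =
      T (Function.update (fun l => lpClass (s l) (f l)) i (lpClass (s i) g)) := by
  rw [LpMultilinear.onFunctions]
  refine congrArg (fun F => (⇑(T F) : RSpace n → ℂ)) (funext fun l => ?_)
  exact Function.apply_update (fun l => lpClass (s l)) f i g l

theorem IsInitiallyBounded.exponent_ne_zero {s : Fin m → ℝ≥0∞} {s₀ : ℝ≥0∞}
    {T : LpMultilinear n m s s₀} (hT : IsInitiallyBounded T) : s₀ ≠ 0 := by
  intro h
  have h1 := hT.scaling
  rw [h, ENNReal.inv_zero] at h1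
  have h2 : ∑ i, (s i)⁻¹ ≠ ∞ := ENNReal.sum_ne_top.2 fun i _ => by
    have := hT.one_lt i
    exact ENNReal.inv_ne_top.2 (zero_lt_one.trans this).ne'
  exact h2 h1.symm

/-- Continuity of the operator in one slot under bounded convergence with bounded supports. -/
theorem IsInitiallyBounded.tendstoInMeasure {s : Fin m → ℝ≥0∞} {s₀ : ℝ≥0∞}
    {T : LpMultilinear n m s s₀} (hT : IsInitiallyBounded T) (hA : Bornology.IsBounded A)
    {f : Fin m → RSpace n → ℂ} (hf : ∀ l, BddOn A (f l)) (i : Fin m) {g : ℕ → RSpace n → ℂ}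
    {M : ℝ} (hgt : ∀ N, IsTestFunction (g N)) (hg : ∀ N, BddOn A (g N))
    (hgM : ∀ N x, ‖g N x‖ ≤ M)
    (hlim : ∀ᵐ x ∂(volume : Measure (RSpace n)), Tendsto (fun N => g N x) atTop (𝓝 (f i x))) :
    TendstoInMeasure volume (fun N => T.onFunctions (Function.update f i (g N))) atTop
      (T.onFunctions f) := by
  -- In an `L^∞` slot the approximants need not converge in norm, and the extension hypothesis is
  -- the only resource. For `s i < ∞` they converge in `L^{s i}` by dominated convergence, so the
  -- images converge in `L^{s₀}`, hence in measure.
  by_cases hs : s i = ∞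
  · exact hT.extension_top i hs f (fun l => (hf l).memLp hA _) g hgt ⟨M, hgM⟩ hlim
  have hs0 : s i ≠ 0 := (zero_lt_one.trans (hT.one_lt i)).ne'
  obtain ⟨C, hC⟩ := hT.bound
  have hfi := (hf i).memLp hA (s i)
  set F : (l : Fin m) → Lp ℂ (s l) (volume : Measure (RSpace n)) := fun l => lpClass (s l) (f l)
    with hF
  have hTf : T.onFunctions f = T (Function.update F i (lpClass (s i) (f i))) := by
    rw [← T.onFunctions_update f i (f i), Function.update_eq_self]
  refine tendstoInMeasure_of_tendsto_eLpNorm (p := s₀) hT.exponent_ne_zero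
    (fun N => (Lp.aestronglyMeasurable _)) (Lp.aestronglyMeasurable _) ?_
  set D : ℝ≥0∞ := C * ∏ l ∈ Finset.univ.erase i, eLpNorm (F l) (s l) volume with hD
  have hDtop : D ≠ ∞ := by
    refine ENNReal.mul_ne_top ENNReal.coe_ne_top (ENNReal.prod_ne_top fun l _ => ?_)
    exact Lp.eLpNorm_ne_top _
  have hle : ∀ N, eLpNorm (T.onFunctions (Function.update f i (g N)) - T.onFunctions f) s₀ volume ≤
      D * eLpNorm (g N - f i) (s i) volume := by
    intro N
    have hgi := (hg N).memLp hA (s i)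
    rw [T.onFunctions_update, hTf]
    rw [eLpNorm_congr_ae (Lp.coeFn_sub _ _).symm, ← T.map_update_sub]
    refine (hC _).trans (le_of_eq ?_)
    rw [← Finset.mul_prod_erase _ _ (Finset.mem_univ i), hD]
    have e1 : eLpNorm (Function.update F i (lpClass (s i) (g N) - lpClass (s i) (f i)) i) (s i)
        volume = eLpNorm (g N - f i) (s i) volume := by
      rw [Function.update_self]
      refine eLpNorm_congr_ae ?_
      exact (Lp.coeFn_sub _ _).trans ((lpClass_coe hgi).sub (lpClass_coe hfi))
    have e2 : ∏ l ∈ Finset.univ.erase i, eLpNorm (Function.update F i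
        (lpClass (s i) (g N) - lpClass (s i) (f i)) l) (s l) volume =
        ∏ l ∈ Finset.univ.erase i, eLpNorm (F l) (s l) volume :=
      Finset.prod_congr rfl fun l hl => by rw [Function.update_of_ne (Finset.ne_of_mem_erase hl)]
    rw [e1, e2]
    ring
  have h0 := ENNReal.Tendsto.const_mul (a := D)
    (tendsto_eLpNorm_sub_of_bdd hs0 hs hA hg hgM (hf i) hlim) (Or.inr hDtop)
  rw [mul_zero] at h0
  exact tendsto_of_tendsto_of_tendsto_of_le_of_le tendsto_const_nhds h0 (fun _ => zero_le) hle

end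

/-! ### Kernel estimates and kernel representations -/

section

variable {n m : ℕ} {K : RSpace n → (Fin m → RSpace n) → ℂ} {C : ℝ} {ω : ℝ → ℝ}

theorem not_diag_of_sum_pos {x : RSpace n} {y : Fin m → RSpace n} (h : 0 < ∑ i, ‖x - y i‖) :
    ¬ ∀ i, y i = x := by
  intro hy
  simp [hy] at h

theorem IsMultilinearCZKernel.const_nonneg (hK : IsMultilinearCZKernel K C ω) {x : RSpace n}
    {y : Fin m → RSpace n} (h : 0 < ∑ i, ‖x - y i‖) : 0 ≤ C := by
  have h1 := (norm_nonneg _).trans (hK.size x y (not_diag_of_sum_pos h))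
  by_contra hC
  have : C / (∑ i, ‖x - y i‖) ^ (m * n) < 0 := div_neg_of_neg_of_pos (not_le.1 hC) (by positivity)
  linarith

/-- Monotonicity of `ω` lets one value `ω τ` serve for all admissible displacements. If `‖h‖`
exceeded half of every distance, summing over the slots would contradict `m * ‖h‖ ≤ m * τ * D ≤ D /
2`; hence the regularity condition applies. -/
theorem IsMultilinearCZKernel.regularity_bound (hK : IsMultilinearCZKernel K C ω) {x h : RSpace n}
    {y : Fin m → RSpace n} {D τ : ℝ} (hD : 0 < D) (hDle : D ≤ ∑ i, ‖x - y i‖)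
    (hτm : τ * m ≤ 1 / 2) (hh : ‖h‖ ≤ τ * D) :
    ‖K (x + h) y - K x y‖ + ∑ i, ‖K x (Function.update y i (y i + h)) - K x y‖ ≤
      C / D ^ (m * n) * ω τ := by
  set S := ∑ i, ‖x - y i‖ with hS
  have hSpos : 0 < S := hD.trans_le hDle
  have hC := hK.const_nonneg hSpos
  have hm : 0 < m := by
    rcases Nat.eq_zero_or_pos m with rfl | h
    · simp [hS] at hSpos
    · exact h
  have hm' : (1 : ℝ) ≤ m := by exact_mod_cast hm
  have hτ : 0 ≤ τ := by
    by_contra hneg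
    have : τ * D < 0 := mul_neg_of_neg_of_pos (not_le.1 hneg) hD
    linarith [norm_nonneg h]
  have hτ1 : τ < 1 := by nlinarith
  obtain ⟨i, hi⟩ : ∃ i, ‖h‖ ≤ 1 / 2 * ‖x - y i‖ := by
    by_contra! hcon
    have h1 : ∑ i, 1 / 2 * ‖x - y i‖ ≤ ∑ _i : Fin m, ‖h‖ :=
      Finset.sum_le_sum fun i _ => (hcon i).le
    have h2 : ∑ i, 1 / 2 * ‖x - y i‖ < ∑ _i : Fin m, ‖h‖ :=
      Finset.sum_lt_sum_of_nonempty ⟨⟨0, hm⟩, Finset.mem_univ _⟩ fun i _ => hcon i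
    rw [← Finset.mul_sum, Finset.sum_const, Finset.card_univ, Fintype.card_fin, nsmul_eq_mul] at h2
    have h3 : (m : ℝ) * ‖h‖ ≤ m * (τ * D) := by gcongr
    nlinarith
  have hmem1 : ‖h‖ / S ∈ Set.Ico (0 : ℝ) 1 := by
    refine ⟨by positivity, ?_⟩
    rw [div_lt_one hSpos]
    nlinarith
  have hmem2 : τ ∈ Set.Ico (0 : ℝ) 1 := ⟨hτ, hτ1⟩
  refine (hK.regularity x y h (not_diag_of_sum_pos hSpos) ⟨i, hi⟩).trans ?_
  refine mul_le_mul ?_ ?_ (hK.modulus_nonneg _ hmem1) (by positivity)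
  · gcongr
  · refine hK.modulus_mono hmem1 hmem2 ?_
    rw [div_le_iff₀ hSpos]
    nlinarith

theorem IsMultilinearCZKernel.norm_sub_le_left (hK : IsMultilinearCZKernel K C ω)
    {x x' : RSpace n} {y : Fin m → RSpace n} {D τ : ℝ} (hD : 0 < D) (hDle : D ≤ ∑ i, ‖x - y i‖)
    (hτm : τ * m ≤ 1 / 2) (hh : ‖x' - x‖ ≤ τ * D) :
    ‖K x' y - K x y‖ ≤ C / D ^ (m * n) * ω τ := by
  have h1 := hK.regularity_bound hD hDle hτm hh
  rw [add_sub_cancel] at h1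
  have h2 : 0 ≤ ∑ i, ‖K x (Function.update y i (y i + (x' - x))) - K x y‖ :=
    Finset.sum_nonneg fun _ _ => norm_nonneg _
  linarith

/-- The slots are moved one at a time. The total displacement is at most `m * τ * D ≤ D / 2`, so
starting from a sum of distances of at least `2 * D` it stays above `D` throughout. -/
theorem IsMultilinearCZKernel.norm_sub_le_right (hK : IsMultilinearCZKernel K C ω)
    {x : RSpace n} {y y' : Fin m → RSpace n} {D τ : ℝ} (hD : 0 < D)
    (hDle : 2 * D ≤ ∑ i, ‖x - y i‖) (hτm : τ * m ≤ 1 / 2)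
    (hh : ∀ i, ‖y' i - y i‖ ≤ τ * D) :
    ‖K x y' - K x y‖ ≤ m * (C / D ^ (m * n) * ω τ) := by
  classical
  have key : ∀ J : Finset (Fin m), ‖K x (J.piecewise y' y) - K x y‖ ≤
      J.card * (C / D ^ (m * n) * ω τ) := by
    intro J
    induction J using Finset.induction_on with
    | empty => simp
    | insert j J hj ih =>
      set z := J.piecewise y' y with hz
      have hzj : z j = y j := Finset.piecewise_eq_of_notMem _ _ _ hj
      have hup : (insert j J).piecewise y' y = Function.update z j (z j + (y' j - y j)) := by
        rw [Finset.piecewise_insert, hzj, add_sub_cancel]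
      have hDz : D ≤ ∑ i, ‖x - z i‖ := by
        have h1 : ∀ i, ‖x - y i‖ - τ * D ≤ ‖x - z i‖ := by
          intro i
          have h0 : ‖z i - y i‖ ≤ τ * D := by
            by_cases hi : i ∈ J
            · rw [hz, Finset.piecewise_eq_of_mem _ _ _ hi]; exact hh i
            · rw [hz, Finset.piecewise_eq_of_notMem _ _ _ hi, sub_self, norm_zero]
              exact (norm_nonneg _).trans (hh i)
          have h2 : ‖x - y i‖ ≤ ‖x - z i‖ + ‖z i - y i‖ := norm_sub_le_norm_sub_add_norm_sub _ _ _
          linarith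
        have h2 := Finset.sum_le_sum fun i (_ : i ∈ Finset.univ) => h1 i
        rw [Finset.sum_sub_distrib, Finset.sum_const, Finset.card_univ, Fintype.card_fin,
          nsmul_eq_mul] at h2
        nlinarith
      have h1 := hK.regularity_bound hD hDz hτm (hh j)
      have h2 : ‖K x (Function.update z j (z j + (y' j - y j))) - K x z‖ ≤
          ∑ i, ‖K x (Function.update z i (z i + (y' j - y j))) - K x z‖ :=
        Finset.single_le_sum
          (f := fun i => ‖K x (Function.update z i (z i + (y' j - y j))) - K x z‖)
          (fun _ _ => norm_nonneg _) (Finset.mem_univ j)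
      have h3 : ‖K x (Function.update z j (z j + (y' j - y j))) - K x y‖ ≤
          ‖K x (Function.update z j (z j + (y' j - y j))) - K x z‖ + ‖K x z - K x y‖ :=
        norm_sub_le_norm_sub_add_norm_sub _ _ _
      rw [hup, Finset.card_insert_of_notMem hj]
      push_cast
      have h4 := norm_nonneg (K (x + (y' j - y j)) z - K x z)
      linarith
  have := key Finset.univ
  rwa [Finset.piecewise_univ, Finset.card_univ, Fintype.card_fin] at this

/-- The definition of a kernel includes no measurability; continuity in `y` off the diagonal
supplies it, and with it the integrability of the representing integrals. -/
theorem IsMultilinearCZKernel.continuousOn (hK : IsMultilinearCZKernel K C ω) (x : RSpace n) :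
    ContinuousOn (K x) {y | 0 < ∑ i, ‖x - y i‖} := by
  intro y hy
  have hy : 0 < ∑ i, ‖x - y i‖ := hy
  refine ContinuousAt.continuousWithinAt ?_
  set D := (∑ i, ‖x - y i‖) / 2 with hD
  have hDpos : 0 < D := by positivity
  rw [ContinuousAt, tendsto_iff_norm_sub_tendsto_zero]
  have hm : (0 : ℝ) ≤ m := by positivity
  have hC := hK.const_nonneg hy
  -- the modulus of continuity at the ratio of the distances
  rw [Metric.tendsto_nhds]
  intro ε hε
  have h1 := hK.modulus_tendsto
  have h2 : Tendsto (fun t => m * (C / D ^ (m * n) * ω t)) (𝓝[>] 0) (𝓝 0) := by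
    have := (h1.const_mul (C / D ^ (m * n))).const_mul (m : ℝ)
    simpa using this
  obtain ⟨τ, ⟨hτε, hτm⟩, hτ⟩ : ∃ τ, ((m * (C / D ^ (m * n) * ω τ) < ε) ∧ τ * m ≤ 1 / 2) ∧ 0 < τ := by
    have e1 := h2.eventually (gt_mem_nhds hε)
    have e2 : ∀ᶠ t : ℝ in 𝓝[>] 0, t * m ≤ 1 / 2 := by
      have : Tendsto (fun t : ℝ => t * m) (𝓝[>] 0) (𝓝 0) := by
        have : Tendsto (fun t : ℝ => t * m) (𝓝 0) (𝓝 (0 * m)) := (continuous_mul_const _).tendsto _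
        rw [zero_mul] at this
        exact this.mono_left nhdsWithin_le_nhds
      exact this.eventually (ge_mem_nhds (by norm_num))
    exact ((e1.and e2).and self_mem_nhdsWithin).exists
  have hball : Metric.ball y (τ * D) ∈ 𝓝 y := Metric.ball_mem_nhds y (by positivity)
  filter_upwards [hball] with y' hy'
  have h3 : ∀ i, ‖y' i - y i‖ ≤ τ * D := fun i => by
    rw [← dist_eq_norm]
    exact (dist_le_pi_dist y' y i).trans (Metric.mem_ball.1 hy').le
  have h4 := hK.norm_sub_le_right hDpos (x := x) (y := y) (y' := y') (by rw [hD]; linarith) hτm h3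
  rw [Real.dist_eq, sub_zero, abs_of_nonneg (norm_nonneg _)]
  exact h4.trans_lt hτε

/-- A bound of the kernel away from a ball. -/
theorem IsMultilinearCZKernel.norm_le_of_mem (hK : IsMultilinearCZKernel K C ω) (hm : 0 < m)
    {x y₀ : RSpace n} {ρ d : ℝ} (hd : 0 < d) (hx : ρ + d ≤ dist x y₀) {y : Fin m → RSpace n}
    (hy : ∀ i, y i ∈ Metric.closedBall y₀ ρ) :
    m * d ≤ ∑ i, ‖x - y i‖ ∧ ‖K x y‖ ≤ C / (m * d) ^ (m * n) := by
  have hm' : (0 : ℝ) < m := by exact_mod_cast hm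
  have h1 : m * d ≤ ∑ i, ‖x - y i‖ := by
    have : ∑ _i : Fin m, d ≤ ∑ i, ‖x - y i‖ := by
      refine Finset.sum_le_sum fun i _ => ?_
      have h2 := Metric.mem_closedBall.1 (hy i)
      have h3 := dist_triangle x (y i) y₀
      rw [← dist_eq_norm]
      linarith
    simpa using this
  have h2 : 0 < ∑ i, ‖x - y i‖ := by nlinarith
  refine ⟨h1, (hK.size x y (not_diag_of_sum_pos h2)).trans ?_⟩
  have hC := hK.const_nonneg h2
  gcongr

theorem IsMultilinearCZKernel.aestronglyMeasurable_indicator (hK : IsMultilinearCZKernel K C ω)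
    (hm : 0 < m) {x y₀ : RSpace n} {ρ : ℝ} (hx : x ∉ Metric.closedBall y₀ ρ) :
    AEStronglyMeasurable ((Set.univ.pi fun _ : Fin m => Metric.closedBall y₀ ρ).indicator (K x))
      volume := by
  have hP : MeasurableSet (Set.univ.pi fun _ : Fin m => Metric.closedBall y₀ ρ) :=
    MeasurableSet.univ_pi fun _ => Metric.isClosed_closedBall.measurableSet
  rw [aestronglyMeasurable_indicator_iff hP]
  refine ContinuousOn.aestronglyMeasurable ((hK.continuousOn x).mono fun y hy => ?_) hP
  rw [Metric.mem_closedBall, not_le] at hx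
  have hm' : (0 : ℝ) < m := by exact_mod_cast hm
  have h1 := (hK.norm_le_of_mem hm (d := dist x y₀ - ρ) (by linarith) (by linarith)
    (fun i => (Set.mem_univ_pi.1 hy) i)).1
  have : 0 < (m : ℝ) * (dist x y₀ - ρ) := mul_pos hm' (by linarith)
  exact this.trans_le h1

theorem kernel_mul_prod_eq {x y₀ : RSpace n} {ρ : ℝ} {f : Fin m → RSpace n → ℂ}
    (hf : ∀ i, BddOn (Metric.closedBall y₀ ρ) (f i)) (y : Fin m → RSpace n) :
    K x y * ∏ i, f i (y i) =
      (Set.univ.pi fun _ : Fin m => Metric.closedBall y₀ ρ).indicator (K x) y * ∏ i, f i (y i) := by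
  by_cases hy : y ∈ Set.univ.pi fun _ : Fin m => Metric.closedBall y₀ ρ
  · rw [Set.indicator_of_mem hy]
  · rw [Set.indicator_of_notMem hy, zero_mul]
    simp only [Set.mem_univ_pi, not_forall] at hy
    obtain ⟨i, hi⟩ := hy
    rw [Finset.prod_eq_zero (Finset.mem_univ i) ((hf i).3 _ hi), mul_zero]

theorem aestronglyMeasurable_kernel_mul_prod (hK : IsMultilinearCZKernel K C ω) (hm : 0 < m)
    {x y₀ : RSpace n} {ρ : ℝ} (hx : x ∉ Metric.closedBall y₀ ρ) {f : Fin m → RSpace n → ℂ}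
    (hf : ∀ i, BddOn (Metric.closedBall y₀ ρ) (f i)) :
    AEStronglyMeasurable (fun y : Fin m → RSpace n => K x y * ∏ i, f i (y i)) volume := by
  simp_rw [kernel_mul_prod_eq hf]
  refine (hK.aestronglyMeasurable_indicator hm hx).mul (Measurable.aestronglyMeasurable ?_)
  exact Finset.measurable_fun_prod _ fun i _ => (hf i).1.comp (measurable_pi_apply i)

theorem norm_kernel_mul_prod_le (hK : IsMultilinearCZKernel K C ω) (hm : 0 < m)
    {x y₀ : RSpace n} {ρ : ℝ} (hx : x ∉ Metric.closedBall y₀ ρ) {f : Fin m → RSpace n → ℂ}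
    (hf : ∀ i, BddOn (Metric.closedBall y₀ ρ) (f i)) {M : Fin m → ℝ}
    (hM : ∀ i z, ‖f i z‖ ≤ M i) (y : Fin m → RSpace n) :
    ‖K x y * ∏ i, f i (y i)‖ ≤ (Set.univ.pi fun _ : Fin m => Metric.closedBall y₀ ρ).indicator
      (fun _ => C / (m * (dist x y₀ - ρ)) ^ (m * n) * ∏ i, M i) y := by
  rw [kernel_mul_prod_eq hf]
  rw [Metric.mem_closedBall, not_le] at hx
  by_cases hy : y ∈ Set.univ.pi fun _ : Fin m => Metric.closedBall y₀ ρ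
  · rw [Set.indicator_of_mem hy, Set.indicator_of_mem hy, norm_mul, norm_prod]
    have h1 := (hK.norm_le_of_mem hm (d := dist x y₀ - ρ) (by linarith) (by linarith)
      (fun i => (Set.mem_univ_pi.1 hy) i)).2
    exact mul_le_mul h1 (Finset.prod_le_prod (fun _ _ => norm_nonneg _) fun i _ => hM i _)
      (Finset.prod_nonneg fun _ _ => norm_nonneg _) ((norm_nonneg _).trans h1)
  · rw [Set.indicator_of_notMem hy, Set.indicator_of_notMem hy]; simp

theorem integrable_indicator_box (y₀ : RSpace n) (ρ c : ℝ) :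
    Integrable ((Set.univ.pi fun _ : Fin m => Metric.closedBall y₀ ρ).indicator fun _ => c)
      volume := by
  rw [integrable_indicator_iff
    (MeasurableSet.univ_pi fun _ => Metric.isClosed_closedBall.measurableSet)]
  refine integrableOn_const ?_
  rw [volume_pi_pi]
  exact ENNReal.prod_ne_top fun _ _ => measure_closedBall_lt_top.ne

theorem integrable_kernel_mul_prod (hK : IsMultilinearCZKernel K C ω) (hm : 0 < m)
    {x y₀ : RSpace n} {ρ : ℝ} (hx : x ∉ Metric.closedBall y₀ ρ) {f : Fin m → RSpace n → ℂ}
    (hf : ∀ i, BddOn (Metric.closedBall y₀ ρ) (f i)) :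
    Integrable (fun y : Fin m → RSpace n => K x y * ∏ i, f i (y i)) volume := by
  choose M hM using fun i => (hf i).2
  exact (integrable_indicator_box y₀ ρ _).mono'
    (aestronglyMeasurable_kernel_mul_prod hK hm hx hf)
    (Eventually.of_forall (norm_kernel_mul_prod_le hK hm hx hf hM))

theorem ae_pi_apply {P : RSpace n → Prop} (h : ∀ᵐ x ∂(volume : Measure (RSpace n)), P x)
    (i : Fin m) : ∀ᵐ y ∂(volume : Measure (Fin m → RSpace n)), P (y i) :=
  (Measure.quasiMeasurePreserving_eval (fun _ : Fin m => (volume : Measure (RSpace n))) i).ae h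

/-- The kernel representation extends from test functions to bounded functions with support in a
ball, off a larger ball. -/
theorem IsRepresentedBy.ae_eq_of_bdd [NeZero m] {s : Fin m → ℝ≥0∞} {s₀ : ℝ≥0∞}
    {T : LpMultilinear n m s s₀} (hT : IsInitiallyBounded T) (hK : IsMultilinearCZKernel K C ω)
    (hTK : IsRepresentedBy T.onFunctions K) {y₀ : RSpace n} {ρ ρ' : ℝ} (hρ : ρ < ρ')
    {f : Fin m → RSpace n → ℂ} (hf : ∀ i, BddOn (Metric.closedBall y₀ ρ) (f i)) :
    ∀ᵐ x ∂(volume : Measure (RSpace n)), x ∉ Metric.closedBall y₀ ρ' →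
      T.onFunctions f x = ∫ y : Fin m → RSpace n, K x y * ∏ i, f i (y i) := by
  classical
  have hm : 0 < m := Nat.pos_of_ne_zero (NeZero.ne m)
  -- Induction on the set `J` of slots that hold merely bounded functions; the other slots hold test
  -- functions supported in the larger ball, which leaves room for mollification.
  suffices H : ∀ J : Finset (Fin m), ∀ f : Fin m → RSpace n → ℂ,
      (∀ i ∈ J, BddOn (Metric.closedBall y₀ ρ) (f i)) →
      (∀ i ∉ J, IsTestFunction (f i) ∧ tsupport (f i) ⊆ Metric.closedBall y₀ ρ') →
      ∀ᵐ x ∂(volume : Measure (RSpace n)), x ∉ Metric.closedBall y₀ ρ' →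
      T.onFunctions f x = ∫ y : Fin m → RSpace n, K x y * ∏ i, f i (y i) from
    H Finset.univ f (fun i _ => hf i) (fun i hi => absurd (Finset.mem_univ i) hi)
  intro J
  induction J using Finset.induction_on with
  | empty =>
    intro f _ hf
    have hf' := fun i => hf i (Finset.notMem_empty i)
    filter_upwards [hTK f fun i => (hf' i).1] with x hx hxb
    exact hx fun h => hxb ((hf' 0).2 (Set.mem_iInter.1 h 0))
  | insert i J hi ih =>
    intro f hfJ hft
    obtain ⟨g, M, hgt, hgM, hgs, hlim⟩ := (hfJ i (Finset.mem_insert_self i J)).exists_approx hρ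
    have hg : ∀ N, BddOn (Metric.closedBall y₀ ρ') (g N) := fun N =>
      BddOn.of_test (hgt N) (hgs N)
    have hfb : ∀ l, BddOn (Metric.closedBall y₀ ρ') (f l) := by
      intro l
      by_cases hl : l ∈ insert i J
      · exact (hfJ l hl).mono (Metric.closedBall_subset_closedBall hρ.le)
      · exact BddOn.of_test (hft l hl).1 (hft l hl).2
    have hrep : ∀ N, ∀ᵐ x ∂(volume : Measure (RSpace n)), x ∉ Metric.closedBall y₀ ρ' →
        T.onFunctions (Function.update f i (g N)) x =
          ∫ y : Fin m → RSpace n, K x y * ∏ l, Function.update f i (g N) l (y l) := by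
      intro N
      refine ih _ (fun l hl => ?_) fun l hl => ?_
      · rw [Function.update_of_ne (fun h : l = i => hi (h ▸ hl))]
        exact hfJ l (Finset.mem_insert_of_mem hl)
      · by_cases hli : l = i
        · subst hli; rw [Function.update_self]; exact ⟨hgt N, hgs N⟩
        · rw [Function.update_of_ne hli]
          exact hft l fun h => (Finset.mem_insert.1 h).elim hli hl
    have hub : ∀ N l, BddOn (Metric.closedBall y₀ ρ') (Function.update f i (g N) l) := by
      intro N l
      by_cases hli : l = i
      · subst hli; rw [Function.update_self]; exact hg N
      · rw [Function.update_of_ne hli]; exact hfb l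
    -- Only convergence in measure is available, so the limit is identified along a subsequence that
    -- converges a.e.; the integrals converge by dominated convergence.
    obtain ⟨ns, hns, hae⟩ := (hT.tendstoInMeasure Metric.isBounded_closedBall hfb i hgt hg hgM
      hlim).exists_seq_tendsto_ae
    choose Mf hMf using fun l => (hfb l).2
    filter_upwards [hae, ae_all_iff.2 hrep] with x hx1 hx2 hxb
    refine tendsto_nhds_unique hx1 ?_
    have hcongr : ∀ N, T.onFunctions (Function.update f i (g (ns N))) x =
        ∫ y : Fin m → RSpace n, K x y * ∏ l, Function.update f i (g (ns N)) l (y l) :=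
      fun N => hx2 (ns N) hxb
    simp only [hcongr]
    have hMu : ∀ N l z, ‖Function.update f i (g N) l z‖ ≤ Function.update Mf i M l := by
      intro N l z
      by_cases hli : l = i
      · subst hli; simp only [Function.update_self]; exact hgM N z
      · simp only [Function.update_of_ne hli]; exact hMf l z
    refine tendsto_integral_of_dominated_convergence _
      (fun N => aestronglyMeasurable_kernel_mul_prod hK hm hxb (hub (ns N)))
      (integrable_indicator_box y₀ ρ' _)
      (fun N => Eventually.of_forall
        (norm_kernel_mul_prod_le hK hm hxb (hub (ns N)) (hMu (ns N)))) ?_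
    filter_upwards [ae_pi_apply hlim i] with y hy
    refine Tendsto.const_mul _ (tendsto_finsetProd _ fun l _ => ?_)
    by_cases hli : l = i
    · subst hli
      simp only [Function.update_self]
      exact hy.comp hns.tendsto_atTop
    · simp only [Function.update_of_ne hli]
      exact tendsto_const_nhds

/-- The kernel representation of iterated commutators. -/
theorem IsRepresentedBy.iteratedCommutator_ae_eq [NeZero m] {s : Fin m → ℝ≥0∞} {s₀ : ℝ≥0∞}
    {T : LpMultilinear n m s s₀} (hT : IsInitiallyBounded T) (hK : IsMultilinearCZKernel K C ω)
    (hTK : IsRepresentedBy T.onFunctions K) {y₀ : RSpace n} {ρ ρ' : ℝ} (hρ : ρ < ρ')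
    {b : RSpace n → ℝ} (hb : Measurable b) {M : ℝ} (k : ℕ)
    {f : Fin m → RSpace n → ℂ} (hf : ∀ i, BddOn (Metric.closedBall y₀ ρ ∩ {z | |b z| ≤ M}) (f i)) :
    ∀ᵐ x ∂(volume : Measure (RSpace n)), x ∉ Metric.closedBall y₀ ρ' →
      iteratedCommutator b 0 k T.onFunctions f x =
        ∫ y : Fin m → RSpace n, (((b x - b (y 0)) ^ k : ℝ) : ℂ) * (K x y * ∏ i, f i (y i)) := by
  have hm : 0 < m := Nat.pos_of_ne_zero (NeZero.ne m)
  induction k generalizing f with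
  | zero =>
    filter_upwards [hTK.ae_eq_of_bdd hT hK hρ fun i => (hf i).mono Set.inter_subset_left]
      with x hx hxb
    simpa [iteratedCommutator] using hx hxb
  | succ k ih =>
    -- The restriction to `|b| ≤ M` keeps `b * f 0` bounded, so the induction hypothesis, which is
    -- general in `f`, also applies to the modified tuple.
    have hbf : BddOn (Metric.closedBall y₀ ρ ∩ {z | |b z| ≤ M}) fun z => (b z : ℂ) * f 0 z :=
      (hf 0).mul_left (by fun_prop) ⟨M, fun z hz => by simpa using hz.2⟩
    set f' := Function.update f 0 fun z => (b z : ℂ) * f 0 z with hf'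
    have hfu : ∀ i, BddOn (Metric.closedBall y₀ ρ ∩ {z | |b z| ≤ M}) (f' i) := by
      intro i
      by_cases hi : i = 0
      · subst hi; rw [hf', Function.update_self]; exact hbf
      · rw [hf', Function.update_of_ne hi]; exact hf i
    have hprod : ∀ y : Fin m → RSpace n, ∏ i, f' i (y i) = b (y 0) * ∏ i, f i (y i) := by
      intro y
      rw [← Finset.mul_prod_erase _ _ (Finset.mem_univ 0),
        ← Finset.mul_prod_erase _ (fun i => f i (y i)) (Finset.mem_univ 0), hf',
        Function.update_self, mul_assoc]
      congr 2
      exact Finset.prod_congr rfl fun i hi => by rw [Function.update_of_ne (Finset.ne_of_mem_erase hi)]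
    have hint : ∀ (g : Fin m → RSpace n → ℂ),
        (∀ i, BddOn (Metric.closedBall y₀ ρ ∩ {z | |b z| ≤ M}) (g i)) →
        ∀ x, x ∉ Metric.closedBall y₀ ρ' → Integrable (fun y : Fin m → RSpace n =>
          (((b x - b (y 0)) ^ k : ℝ) : ℂ) * (K x y * ∏ i, g i (y i))) volume := by
      intro g hg x hx
      have hg0 : BddOn (Metric.closedBall y₀ ρ ∩ {z | |b z| ≤ M})
          fun z => (((b x - b z) ^ k : ℝ) : ℂ) * g 0 z := by
        refine (hg 0).mul_left (by fun_prop) ⟨(|b x| + M) ^ k, fun z hz => ?_⟩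
        rw [Complex.norm_real, norm_pow, Real.norm_eq_abs]
        refine pow_le_pow_left₀ (abs_nonneg _) ((abs_sub _ _).trans ?_) k
        have : |b z| ≤ M := hz.2
        linarith
      have := integrable_kernel_mul_prod hK hm
        (fun h => hx (Metric.closedBall_subset_closedBall hρ.le h))
        (f := Function.update g 0 fun z => (((b x - b z) ^ k : ℝ) : ℂ) * g 0 z) (fun i => by
          by_cases hi : i = 0
          · subst hi; rw [Function.update_self]; exact hg0.mono Set.inter_subset_left
          · rw [Function.update_of_ne hi]; exact (hg i).mono Set.inter_subset_left)
      refine this.congr (Eventually.of_forall fun y => ?_)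
      simp only
      rw [← Finset.mul_prod_erase _ _ (Finset.mem_univ 0),
        ← Finset.mul_prod_erase _ (fun i => g i (y i)) (Finset.mem_univ 0), Function.update_self,
        Finset.prod_congr rfl fun i hi => by rw [Function.update_of_ne (Finset.ne_of_mem_erase hi)]]
      ring
    filter_upwards [ih hf, ih hfu] with x h1 h2 hxb
    rw [iteratedCommutator, slotCommutator, h1 hxb, h2 hxb, ← integral_const_mul,
      ← integral_sub ((hint f hf x hxb).const_mul _) (hint f' hfu x hxb)]
    refine integral_congr_ae (Eventually.of_forall fun y => ?_)
    simp only [hprod]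
    push_cast
    ring

end

/-! ### Medians and reflected balls -/

/-- A median of a measurable function with respect to a finite measure. -/
theorem exists_median {α : Type*} [MeasurableSpace α] (μ : Measure α) [IsFiniteMeasure μ]
    {b : α → ℝ} (hb : Measurable b) :
    ∃ c : ℝ, μ Set.univ ≤ 2 * μ {x | b x ≤ c} ∧ μ Set.univ ≤ 2 * μ {x | c ≤ b x} := by
  rcases eq_or_ne (μ Set.univ) 0 with h0 | h0
  · exact ⟨0, by simp [h0], by simp [h0]⟩
  have hfin : μ Set.univ ≠ ∞ := measure_ne_top _ _
  have hmeas : ∀ t, MeasurableSet {x | b x ≤ t} := fun t => measurableSet_le hb measurable_const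
  have hmono : Monotone fun t : ℝ => {x | b x ≤ t} := fun s t hst x hx => le_trans hx hst
  set S : Set ℝ := {t | μ Set.univ ≤ 2 * μ {x | b x ≤ t}} with hS
  have hup : ∀ s ∈ S, ∀ t, s ≤ t → t ∈ S := fun s hs t hst =>
    le_trans (show μ Set.univ ≤ 2 * μ {x | b x ≤ s} from hs) (by gcongr)
  have hhalf : μ Set.univ / 2 < μ Set.univ := ENNReal.half_lt_self h0 hfin
  have hne : S.Nonempty := by
    have h1 : Tendsto (fun N : ℕ => μ {x | b x ≤ (N : ℝ)}) atTop
        (𝓝 (μ (⋃ N : ℕ, {x | b x ≤ (N : ℝ)}))) :=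
      tendsto_measure_iUnion_atTop fun i j hij => hmono (by exact_mod_cast hij)
    have h2 : (⋃ N : ℕ, {x | b x ≤ (N : ℝ)}) = Set.univ :=
      Set.eq_univ_of_forall fun x => Set.mem_iUnion.2 (exists_nat_ge (b x))
    rw [h2] at h1
    obtain ⟨N, hN⟩ := (h1.eventually (lt_mem_nhds hhalf)).exists
    refine ⟨N, ?_⟩
    have := (ENNReal.div_lt_iff (Or.inl two_ne_zero) (Or.inl ENNReal.ofNat_ne_top)).1 hN
    rw [mul_comm] at this
    exact this.le
  have hbdd : BddBelow S := by
    have h1 : Tendsto (fun N : ℕ => μ {x | b x ≤ -(N : ℝ)}) atTop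
        (𝓝 (μ (⋂ N : ℕ, {x | b x ≤ -(N : ℝ)}))) :=
      tendsto_measure_iInter_atTop (fun N => (hmeas _).nullMeasurableSet)
        (fun i j hij => hmono (by simpa using (Nat.cast_le (α := ℝ)).2 hij))
        ⟨0, measure_ne_top _ _⟩
    have h2 : (⋂ N : ℕ, {x | b x ≤ -(N : ℝ)}) = ∅ := by
      rw [Set.eq_empty_iff_forall_notMem]
      intro x hx
      obtain ⟨N, hN⟩ := exists_nat_gt (-(b x))
      have : b x ≤ -(N : ℝ) := Set.mem_iInter.1 hx N
      linarith
    rw [h2, measure_empty] at h1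
    have hpos : 0 < μ Set.univ / 2 := ENNReal.half_pos h0
    obtain ⟨N, hN⟩ := (h1.eventually (gt_mem_nhds hpos)).exists
    refine ⟨-(N : ℝ), fun t ht => ?_⟩
    by_contra hlt
    have h3 : -(N : ℝ) ∈ S := hup t ht _ (not_le.1 hlt).le
    have h4 : μ Set.univ ≤ 2 * μ {x | b x ≤ -(N : ℝ)} := h3
    have h5 : 2 * μ {x | b x ≤ -(N : ℝ)} < μ Set.univ := by
      have := (ENNReal.lt_div_iff_mul_lt (Or.inl two_ne_zero) (Or.inl ENNReal.ofNat_ne_top)).1 hN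
      rwa [mul_comm] at this
    exact absurd h4 (not_le.2 h5)
  have hu : Tendsto (fun N : ℕ => 1 / ((N : ℝ) + 1)) atTop (𝓝 0) :=
    tendsto_one_div_add_atTop_nhds_zero_nat
  have hanti : ∀ i j : ℕ, i ≤ j → 1 / ((j : ℝ) + 1) ≤ 1 / ((i : ℝ) + 1) := fun i j hij => by
    have : (i : ℝ) ≤ j := by exact_mod_cast hij
    gcongr
  -- Right continuity of the distribution function gives the first inequality. Below the infimum
  -- every sublevel set has less than half of the mass, so `{b < sInf S}` has at most half of it,
  -- which gives the second.
  refine ⟨sInf S, ?_, ?_⟩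
  · have h1 : Tendsto (fun N : ℕ => μ {x | b x ≤ sInf S + 1 / ((N : ℝ) + 1)}) atTop
        (𝓝 (μ (⋂ N : ℕ, {x | b x ≤ sInf S + 1 / ((N : ℝ) + 1)}))) :=
      tendsto_measure_iInter_atTop (fun N => (hmeas _).nullMeasurableSet)
        (fun i j hij => hmono (by linarith [hanti i j hij])) ⟨0, measure_ne_top _ _⟩
    have h2 : (⋂ N : ℕ, {x | b x ≤ sInf S + 1 / ((N : ℝ) + 1)}) = {x | b x ≤ sInf S} := by
      ext x
      rw [Set.mem_iInter]
      constructor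
      · intro h
        have := ge_of_tendsto (hu.const_add (sInf S)) (Eventually.of_forall h)
        simpa using this
      · intro h N
        have h3 : b x ≤ sInf S := h
        have : (0 : ℝ) ≤ 1 / ((N : ℝ) + 1) := by positivity
        exact h3.trans (by linarith)
    rw [h2] at h1
    have h3 := ENNReal.Tendsto.const_mul (a := 2) h1 (Or.inr (by simp))
    refine ge_of_tendsto h3 (Eventually.of_forall fun N => ?_)
    obtain ⟨s, hs, hlt⟩ := exists_lt_of_csInf_lt hne
      (show sInf S < sInf S + 1 / ((N : ℝ) + 1) by
        have : (0 : ℝ) < 1 / ((N : ℝ) + 1) := by positivity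
        linarith)
    exact hup s hs _ hlt.le
  · have h1 : Tendsto (fun N : ℕ => μ {x | b x ≤ sInf S - 1 / ((N : ℝ) + 1)}) atTop
        (𝓝 (μ (⋃ N : ℕ, {x | b x ≤ sInf S - 1 / ((N : ℝ) + 1)}))) :=
      tendsto_measure_iUnion_atTop fun i j hij => hmono (by linarith [hanti i j hij])
    have h2 : (⋃ N : ℕ, {x | b x ≤ sInf S - 1 / ((N : ℝ) + 1)}) = {x | b x < sInf S} := by
      ext x
      rw [Set.mem_iUnion]
      constructor
      · rintro ⟨N, h⟩
        have h3 : b x ≤ sInf S - 1 / ((N : ℝ) + 1) := h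
        have : (0 : ℝ) < 1 / ((N : ℝ) + 1) := by positivity
        exact lt_of_le_of_lt h3 (by linarith)
      · intro h
        have h3 : b x < sInf S := h
        obtain ⟨N, hN⟩ := exists_nat_one_div_lt (sub_pos.2 h3)
        exact ⟨N, show b x ≤ sInf S - 1 / ((N : ℝ) + 1) by linarith⟩
    rw [h2] at h1
    have h3 := ENNReal.Tendsto.const_mul (a := 2) h1 (Or.inr (by simp))
    have h4 : 2 * μ {x | b x < sInf S} ≤ μ Set.univ := by
      refine le_of_tendsto h3 (Eventually.of_forall fun N => ?_)
      have : sInf S - 1 / ((N : ℝ) + 1) ∉ S := by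
        have : (0 : ℝ) < 1 / ((N : ℝ) + 1) := by positivity
        exact notMem_of_lt_csInf (by linarith) hbdd
      exact (not_le.1 this).le
    have h5 : μ {x | b x < sInf S} + μ {x | sInf S ≤ b x} = μ Set.univ := by
      have : {x | sInf S ≤ b x} = {x | b x < sInf S}ᶜ := by ext x; simp
      rw [this]
      exact measure_add_measure_compl (measurableSet_lt hb measurable_const)
    have h6 : μ Set.univ + μ Set.univ ≤ μ Set.univ + 2 * μ {x | sInf S ≤ b x} := by
      calc μ Set.univ + μ Set.univ
          = 2 * μ {x | b x < sInf S} + 2 * μ {x | sInf S ≤ b x} := by rw [← mul_add, h5, two_mul]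
        _ ≤ _ := by gcongr
    exact (ENNReal.add_le_add_iff_left hfin).1 h6

section

variable {n m : ℕ} {K : RSpace n → (Fin m → RSpace n) → ℂ} {C : ℝ} {ω : ℝ → ℝ}

/-- Every ball has a reflected ball on which the kernel is close to a large constant. -/
theorem IsMultilinearCZKernel.exists_reflected (hK : IsMultilinearCZKernel K C ω)
    (hKn : IsNondegenerateKernel K) (hn : 0 < n) (hm : 2 ≤ m) :
    ∃ Λ c₁ : ℝ, 1 ≤ Λ ∧ 0 < c₁ ∧ ∀ (y₀ : RSpace n) (l : ℝ), 0 < l →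
      ∃ (x₀ : RSpace n) (K₀ : ℂ), 4 * l ≤ dist x₀ y₀ ∧ dist x₀ y₀ ≤ Λ * l ∧
        c₁ ≤ ‖K₀‖ * volume.real (Metric.closedBall y₀ l) ^ m ∧
        ∀ x ∈ Metric.closedBall x₀ l, ∀ y : Fin m → RSpace n,
          (∀ i, y i ∈ Metric.closedBall y₀ l) → ‖K x y - K₀‖ ≤ 1 / 2 * ‖K₀‖ := by
  obtain ⟨c₀, hc₀, hnd⟩ := hKn
  have hm0 : 0 < m := by omega
  have hm' : (2 : ℝ) ≤ m := by exact_mod_cast hm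
  have hmn : m * n ≠ 0 := by positivity
  have hCnn : 0 ≤ C := by
    obtain ⟨x, hx, -⟩ := hnd 0 1 one_pos
    refine hK.const_nonneg (x := x) (y := fun _ => 0) ?_
    rw [Metric.mem_ball, not_lt, dist_zero_right] at hx
    simp only [sub_zero, Finset.sum_const, Finset.card_univ, Fintype.card_fin, nsmul_eq_mul]
    nlinarith
  -- `τ` makes the variation of the kernel at most half of the lower bound `1 / (c₀ * ρ ^ (m * n))`:
  -- `m + 1` counts the variables to be moved, and `2 ^ (m * n)` comes from measuring at distance `ρ
  -- / 2`.
  obtain ⟨τ, ⟨hτω, hτm⟩, hτ⟩ : ∃ τ : ℝ,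
      ((m + 1) * (C * 2 ^ (m * n) * ω τ) ≤ 1 / (2 * c₀) ∧ τ * m ≤ 1 / 2) ∧ 0 < τ := by
    have h2 : Tendsto (fun t => (m + 1) * (C * 2 ^ (m * n) * ω t)) (𝓝[>] 0) (𝓝 0) := by
      have := (hK.modulus_tendsto.const_mul (C * 2 ^ (m * n))).const_mul ((m : ℝ) + 1)
      simpa using this
    have e1 := h2.eventually (ge_mem_nhds (show (0 : ℝ) < 1 / (2 * c₀) by positivity))
    have e2 : ∀ᶠ t : ℝ in 𝓝[>] 0, t * m ≤ 1 / 2 := by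
      have : Tendsto (fun t : ℝ => t * m) (𝓝[>] 0) (𝓝 0) := by
        have : Tendsto (fun t : ℝ => t * m) (𝓝 0) (𝓝 (0 * m)) := (continuous_mul_const _).tendsto _
        rw [zero_mul] at this
        exact this.mono_left nhdsWithin_le_nhds
      exact this.eventually (ge_mem_nhds (by norm_num))
    exact ((e1.and e2).and self_mem_nhdsWithin).exists
  set B := max 1 (C * c₀) with hB
  have hB1 : 1 ≤ B := le_max_left _ _
  have hτ4 : τ ≤ 1 / 4 := by nlinarith
  -- With `ρ = P * l` the radius is `l = τ * (ρ / 2)`, exactly the displacement allowed at distance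
  -- `ρ / 2`.
  set P := 2 / τ with hP
  have hP8 : 8 ≤ P := by rw [hP, le_div_iff₀ hτ]; linarith
  have hPτ : τ * P = 2 := by rw [hP]; field_simp
  set v₁ := volume.real (Metric.closedBall (0 : RSpace n) 1) with hv₁
  have hv₁pos : 0 < v₁ := by
    refine ENNReal.toReal_pos (Metric.measure_closedBall_pos _ _ one_pos).ne' measure_closedBall_lt_top.ne
  refine ⟨B * P, v₁ ^ m / (c₀ * P ^ (m * n)), by nlinarith, by positivity, fun y₀ l hl => ?_⟩
  set ρ := P * l with hρ
  have hρpos : 0 < ρ := by positivity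
  obtain ⟨x₀, hx₀, hKx₀⟩ := hnd y₀ ρ hρpos
  rw [Metric.mem_ball, not_lt] at hx₀
  set K₀ := K x₀ fun _ => y₀ with hK₀
  have hsum : ∑ _i : Fin m, ‖x₀ - y₀‖ = m * dist x₀ y₀ := by
    rw [dist_eq_norm]; simp
  have hvol : volume.real (Metric.closedBall y₀ l) = l ^ n * v₁ := by
    have := volume_closedBall_mul (n := n) y₀ (l := 1) zero_le_one hl.le
    rw [mul_one] at this
    rw [Measure.real, this, ENNReal.toReal_mul, ENNReal.toReal_ofReal (by positivity),
      Measure.addHaar_closedBall_center volume y₀]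
    rfl
  refine ⟨x₀, K₀, by nlinarith, ?_, ?_, ?_⟩
  -- Non-degeneracy bounds the distance only from below. If `x₀` were farther than `B * ρ`, the size
  -- condition would contradict the lower bound for `K₀`, because `B ^ (m * n) ≥ B ≥ C * c₀`.
  · by_contra! hcon
    have h1 := hK.size x₀ (fun _ => y₀) (not_diag_of_sum_pos (by rw [hsum]; nlinarith))
    rw [hsum] at h1
    have h2 := hKx₀.trans h1
    have h3 : B * ρ < m * dist x₀ y₀ := by rw [hρ]; nlinarith
    have h4 : (B * ρ) ^ (m * n) < (m * dist x₀ y₀) ^ (m * n) :=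
      pow_lt_pow_left₀ h3 (by positivity) hmn
    have h5 : B ≤ B ^ (m * n) := le_self_pow₀ hB1 hmn
    rw [mul_pow] at h4
    have h6 : C * c₀ * ρ ^ (m * n) < (m * dist x₀ y₀) ^ (m * n) := by
      refine lt_of_le_of_lt ?_ h4
      gcongr
      exact (le_max_right _ _).trans h5
    rw [div_le_div_iff₀ (by positivity) (lt_of_le_of_lt (by positivity) h6)] at h2
    linarith
  · rw [hvol, mul_pow, ← pow_mul, mul_comm n m]
    calc v₁ ^ m / (c₀ * P ^ (m * n)) = 1 / (c₀ * ρ ^ (m * n)) * (l ^ (m * n) * v₁ ^ m) := by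
          rw [hρ, mul_pow]; field_simp
      _ ≤ _ := by gcongr
  · intro x hx y hy
    rw [Metric.mem_closedBall] at hx
    have hD : 0 < ρ / 2 := by positivity
    have hτl : τ * (ρ / 2) = l := by rw [hρ]; linear_combination l / 2 * hPτ
    have hlρ : 8 * l ≤ ρ := by rw [hρ]; nlinarith
    have h1 : ‖K x (fun _ => y₀) - K₀‖ ≤ C / (ρ / 2) ^ (m * n) * ω τ := by
      refine hK.norm_sub_le_left hD ?_ hτm ?_
      · rw [hsum]; nlinarith
      · rw [hτl, ← dist_eq_norm]; exact hx
    have h2 : ‖K x y - K x fun _ => y₀‖ ≤ m * (C / (ρ / 2) ^ (m * n) * ω τ) := by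
      refine hK.norm_sub_le_right hD ?_ hτm fun i => ?_
      · have h3 : ρ - l ≤ ‖x - y₀‖ := by
          rw [← dist_eq_norm]
          have := dist_triangle x₀ x y₀
          rw [dist_comm x₀ x] at this
          linarith
        simp only [Finset.sum_const, Finset.card_univ, Fintype.card_fin, nsmul_eq_mul]
        nlinarith
      · rw [hτl, ← dist_eq_norm]; exact hy i
    have h3 : ‖K x y - K₀‖ ≤ ‖K x y - K x fun _ => y₀‖ + ‖K x (fun _ => y₀) - K₀‖ :=
      norm_sub_le_norm_sub_add_norm_sub _ _ _
    calc ‖K x y - K₀‖ ≤ (m + 1) * (C / (ρ / 2) ^ (m * n) * ω τ) := by linarith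
      _ = (m + 1) * (C * 2 ^ (m * n) * ω τ) / ρ ^ (m * n) := by rw [div_pow]; field_simp
      _ ≤ 1 / (2 * c₀) / ρ ^ (m * n) := by gcongr
      _ = 1 / 2 * (1 / (c₀ * ρ ^ (m * n))) := by field_simp
      _ ≤ _ := by gcongr

end

/-! ### Testing the commutator on indicator functions -/

section

variable {n m : ℕ} {K : RSpace n → (Fin m → RSpace n) → ℂ} {C : ℝ} {ω : ℝ → ℝ}

theorem BddOn.indicator_const {A U : Set (RSpace n)} (hU : MeasurableSet U) (h : U ⊆ A) (a : ℂ) :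
    BddOn A (U.indicator fun _ => a) := by
  refine ⟨measurable_const.indicator hU, ⟨‖a‖, fun x => norm_indicator_le_norm_self _ x⟩,
    fun x hx => Set.indicator_of_notMem (fun hxU => hx (h hxU)) _⟩

/-- Expand `w = z + (w - z)`. Rotating the kernel by the phase of `K₀` thus puts its values in a
half-plane, where integration produces no cancellation. -/
theorem half_sq_le_re_conj_mul {w z : ℂ} (h : ‖w - z‖ ≤ 1 / 2 * ‖z‖) :
    1 / 2 * ‖z‖ ^ 2 ≤ ((starRingEnd ℂ) z * w).re := by
  have e : (starRingEnd ℂ) z * w = (starRingEnd ℂ) z * z + (starRingEnd ℂ) z * (w - z) := by ring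
  have h1 : ((starRingEnd ℂ) z * z).re = ‖z‖ ^ 2 := by
    rw [Complex.conj_mul']; norm_cast
  have h2 : -(‖z‖ * ‖w - z‖) ≤ ((starRingEnd ℂ) z * (w - z)).re := by
    have := Complex.abs_re_le_norm ((starRingEnd ℂ) z * (w - z))
    rw [norm_mul, Complex.norm_conj] at this
    exact (abs_le.1 this).1
  rw [e, Complex.add_re, h1]
  nlinarith [norm_nonneg z]

/-- Testing a commutator on indicator functions bounds the oscillation of `b` from below. -/
theorem le_re_integral_iteratedCommutator [NeZero m] {s : Fin m → ℝ≥0∞} {s₀ : ℝ≥0∞}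
    {T : LpMultilinear n m s s₀} (hT : IsInitiallyBounded T) (hK : IsMultilinearCZKernel K C ω)
    (hTK : IsRepresentedBy T.onFunctions K) {b : RSpace n → ℝ} (hb : Measurable b) {M : ℝ} {k : ℕ}
    {x₀ y₀ : RSpace n} {l : ℝ} (hl : 0 < l) (hxy : 4 * l ≤ dist x₀ y₀) {K₀ : ℂ} (hK₀ : K₀ ≠ 0)
    (hKK₀ : ∀ x ∈ Metric.closedBall x₀ l, ∀ y : Fin m → RSpace n,
      (∀ i, y i ∈ Metric.closedBall y₀ l) → ‖K x y - K₀‖ ≤ 1 / 2 * ‖K₀‖)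
    {U G F : Set (RSpace n)} (hU : MeasurableSet U) (hG : MeasurableSet G) (hF : MeasurableSet F)
    (hUs : U ⊆ Metric.closedBall y₀ l ∩ {z | |b z| ≤ M})
    (hGs : G ⊆ Metric.closedBall y₀ l ∩ {z | |b z| ≤ M}) (hFs : F ⊆ Metric.closedBall x₀ l)
    {c σ : ℝ} (hσ : ∀ x ∈ F, ∀ z ∈ U, |b z - c| ≤ σ * (b z - b x))
    (hint : Integrable (fun x => F.indicator (fun _ => (starRingEnd ℂ) K₀ / ‖K₀‖ * ((-σ) ^ k : ℝ)) x *
      iteratedCommutator b 0 k T.onFunctions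
        (fun i => (if i = 0 then U else G).indicator fun _ => 1) x) volume) :
    1 / 2 * ‖K₀‖ * volume.real F * volume.real G ^ (m - 1) * ∫ z in U, |b z - c| ^ k ≤
      (∫ x, F.indicator (fun _ => (starRingEnd ℂ) K₀ / ‖K₀‖ * ((-σ) ^ k : ℝ)) x *
        iteratedCommutator b 0 k T.onFunctions
          (fun i => (if i = 0 then U else G).indicator fun _ => 1) x).re := by
  have hm : 0 < m := Nat.pos_of_ne_zero (NeZero.ne m)
  have hK₀n : 0 < ‖K₀‖ := norm_pos_iff.2 hK₀
  set f : Fin m → RSpace n → ℂ := fun i => (if i = 0 then U else G).indicator fun _ => 1 with hf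
  have hfb : ∀ i, BddOn (Metric.closedBall y₀ l ∩ {z | |b z| ≤ M}) (f i) := by
    intro i
    by_cases hi : i = 0
    · simp only [hf, hi, if_true]; exact BddOn.indicator_const hU hUs 1
    · simp only [hf, hi, if_false]; exact BddOn.indicator_const hG hGs 1
  -- the real kernel of the lower bound
  set g : Fin m → RSpace n → ℝ := fun i z =>
    if i = 0 then U.indicator (fun z => |b z - c| ^ k) z else G.indicator (fun _ => 1) z with hg
  have hgint : ∫ y : Fin m → RSpace n, ∏ i, g i (y i) =
      volume.real G ^ (m - 1) * ∫ z in U, |b z - c| ^ k := by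
    rw [integral_fintype_prod_volume_eq_prod, ← Finset.mul_prod_erase _ _ (Finset.mem_univ 0),
      mul_comm]
    congr 1
    · rw [Finset.prod_congr rfl (g := fun _ => volume.real G) fun i hi => ?_]
      · rw [Finset.prod_const, Finset.card_erase_of_mem (Finset.mem_univ _), Finset.card_univ,
          Fintype.card_fin]
      · simp only [hg, if_neg (Finset.ne_of_mem_erase hi)]
        rw [integral_indicator hG]; simp
    · simp only [hg, if_true]
      rw [integral_indicator hU]
  have hpt : ∀ᵐ x ∂(volume : Measure (RSpace n)), F.indicator (fun _ => 1 / 2 * ‖K₀‖ *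
      (volume.real G ^ (m - 1) * ∫ z in U, |b z - c| ^ k)) x ≤
      (F.indicator (fun _ => (starRingEnd ℂ) K₀ / ‖K₀‖ * ((-σ) ^ k : ℝ)) x *
        iteratedCommutator b 0 k T.onFunctions f x).re := by
    -- The representation off the ball of radius `2 * l` is enough: points of `F` lie within `l` of
    -- `x₀`, which is at distance at least `4 * l` from `y₀`.
    filter_upwards [hTK.iteratedCommutator_ae_eq hT hK (show l < 2 * l by linarith) hb k hfb]
      with x hx
    by_cases hxF : x ∈ F
    swap
    · rw [Set.indicator_of_notMem hxF, Set.indicator_of_notMem hxF]; simp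
    rw [Set.indicator_of_mem hxF, Set.indicator_of_mem hxF]
    have hxball := hFs hxF
    have hxoff : x ∉ Metric.closedBall y₀ (2 * l) := by
      rw [Metric.mem_closedBall] at hxball ⊢
      have := dist_triangle x₀ x y₀
      rw [dist_comm x₀ x] at this
      linarith
    have hxoff' : x ∉ Metric.closedBall y₀ l := fun h =>
      hxoff (Metric.closedBall_subset_closedBall (by linarith) h)
    rw [hx hxoff, ← integral_const_mul ((starRingEnd ℂ) K₀ / ‖K₀‖ * ((-σ) ^ k : ℝ))]
    have hI : Integrable (fun y : Fin m → RSpace n => (starRingEnd ℂ) K₀ / ‖K₀‖ * ((-σ) ^ k : ℝ) *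
        ((((b x - b (y 0)) ^ k : ℝ) : ℂ) * (K x y * ∏ i, f i (y i)))) volume := by
      refine Integrable.const_mul ?_ _
      have hf0 : BddOn (Metric.closedBall y₀ l) fun z => (((b x - b z) ^ k : ℝ) : ℂ) * f 0 z := by
        refine ((hfb 0).mul_left (by fun_prop) ⟨(|b x| + M) ^ k, fun z hz => ?_⟩).mono
          Set.inter_subset_left
        rw [Complex.norm_real, norm_pow, Real.norm_eq_abs]
        refine pow_le_pow_left₀ (abs_nonneg _) ((abs_sub _ _).trans ?_) k
        have : |b z| ≤ M := hz.2
        linarith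
      have := integrable_kernel_mul_prod hK hm hxoff'
        (f := Function.update f 0 fun z => (((b x - b z) ^ k : ℝ) : ℂ) * f 0 z) (fun i => by
          by_cases hi : i = 0
          · subst hi; rw [Function.update_self]; exact hf0
          · rw [Function.update_of_ne hi]; exact (hfb i).mono Set.inter_subset_left)
      refine this.congr (Eventually.of_forall fun y => ?_)
      simp only
      rw [← Finset.mul_prod_erase _ _ (Finset.mem_univ 0),
        ← Finset.mul_prod_erase _ (fun i => f i (y i)) (Finset.mem_univ 0), Function.update_self,
        Finset.prod_congr rfl fun i hi => by rw [Function.update_of_ne (Finset.ne_of_mem_erase hi)]]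
      ring
    have hre : (∫ y : Fin m → RSpace n, (starRingEnd ℂ) K₀ / ‖K₀‖ * ((-σ) ^ k : ℝ) *
        ((((b x - b (y 0)) ^ k : ℝ) : ℂ) * (K x y * ∏ i, f i (y i)))).re =
        ∫ y : Fin m → RSpace n, ((starRingEnd ℂ) K₀ / ‖K₀‖ * ((-σ) ^ k : ℝ) *
        ((((b x - b (y 0)) ^ k : ℝ) : ℂ) * (K x y * ∏ i, f i (y i)))).re := by
      exact (integral_re hI).symm
    rw [hre, ← hgint, ← integral_const_mul (1 / 2 * ‖K₀‖)]
    refine integral_mono_of_nonneg (Eventually.of_forall fun y => ?_) hI.re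
      (Eventually.of_forall fun y => ?_)
    · refine mul_nonneg (by positivity) (Finset.prod_nonneg fun i _ => ?_)
      simp only [hg]
      split_ifs
      · exact Set.indicator_nonneg (fun _ _ => by positivity) _
      · exact Set.indicator_nonneg (fun _ _ => zero_le_one) _
    · simp only
      by_cases hy : y 0 ∈ U ∧ ∀ i, i ≠ 0 → y i ∈ G
      · obtain ⟨hy0, hyi⟩ := hy
        have hfy : ∏ i, f i (y i) = 1 := Finset.prod_eq_one fun i _ => by
          by_cases hi : i = 0
          · subst hi; simp [hf, hy0]
          · simp [hf, hi, hyi i hi]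
        have hgy : ∏ i, g i (y i) = |b (y 0) - c| ^ k := by
          rw [← Finset.mul_prod_erase _ _ (Finset.mem_univ 0), Finset.prod_eq_one fun i hi => ?_]
          · simp [hg, hy0]
          · have hi := Finset.ne_of_mem_erase hi
            simp [hg, hi, hyi i hi]
        rw [hfy, hgy, mul_one]
        have hyball : ∀ i, y i ∈ Metric.closedBall y₀ l := fun i => by
          by_cases hi : i = 0
          · subst hi; exact (hUs hy0).1
          · exact (hGs (hyi i hi)).1
        have h1 := half_sq_le_re_conj_mul (hKK₀ x hxball y hyball)
        have h2 : |b (y 0) - c| ^ k ≤ (σ * (b (y 0) - b x)) ^ k :=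
          pow_le_pow_left₀ (abs_nonneg _) (hσ x hxF _ hy0) k
        -- The factor `(-σ) ^ k` makes the difference power nonnegative whatever the parity of `k`,
        -- and at least `|b (y 0) - c| ^ k`.
        have e : ((starRingEnd ℂ) K₀ / ‖K₀‖ * ((-σ) ^ k : ℝ) *
            ((((b x - b (y 0)) ^ k : ℝ) : ℂ) * K x y)) =
            (((σ * (b (y 0) - b x)) ^ k / ‖K₀‖ : ℝ) : ℂ) * ((starRingEnd ℂ) K₀ * K x y) := by
          have : (-σ) ^ k * (b x - b (y 0)) ^ k = (σ * (b (y 0) - b x)) ^ k := by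
            rw [← mul_pow]; congr 1; ring
          rw [← this]
          push_cast
          ring
        rw [e, Complex.re_ofReal_mul]
        calc 1 / 2 * ‖K₀‖ * |b (y 0) - c| ^ k
            = |b (y 0) - c| ^ k / ‖K₀‖ * (1 / 2 * ‖K₀‖ ^ 2) := by field_simp
          _ ≤ (σ * (b (y 0) - b x)) ^ k / ‖K₀‖ * (1 / 2 * ‖K₀‖ ^ 2) := by gcongr
          _ ≤ _ := by
            refine mul_le_mul_of_nonneg_left h1 (div_nonneg ?_ hK₀n.le)
            exact (pow_nonneg (abs_nonneg _) k).trans h2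
      · have hgy : ∏ i, g i (y i) = 0 := by
          rw [not_and_or] at hy
          rcases hy with h | h
          · exact Finset.prod_eq_zero (Finset.mem_univ 0) (by simp [hg, h])
          · push Not at h
            obtain ⟨i, hi, hiG⟩ := h
            exact Finset.prod_eq_zero (Finset.mem_univ i) (by simp [hg, hi, hiG])
        have hfy : ∏ i, f i (y i) = 0 := by
          rw [not_and_or] at hy
          rcases hy with h | h
          · exact Finset.prod_eq_zero (Finset.mem_univ 0) (by simp [hf, h])
          · push Not at h
            obtain ⟨i, hi, hiG⟩ := h
            exact Finset.prod_eq_zero (Finset.mem_univ i) (by simp [hf, hi, hiG])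
        rw [hfy, hgy]; simp
  have hFfin : volume F ≠ ∞ := ne_top_of_le_ne_top measure_closedBall_lt_top.ne (measure_mono hFs)
  have hre : (∫ x, F.indicator (fun _ => (starRingEnd ℂ) K₀ / ‖K₀‖ * ((-σ) ^ k : ℝ)) x *
      iteratedCommutator b 0 k T.onFunctions f x).re =
      ∫ x, (F.indicator (fun _ => (starRingEnd ℂ) K₀ / ‖K₀‖ * ((-σ) ^ k : ℝ)) x *
        iteratedCommutator b 0 k T.onFunctions f x).re := (integral_re hint).symm
  rw [hre]
  refine le_trans (le_of_eq ?_) (integral_mono_ae ?_ hint.re hpt)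
  · rw [integral_indicator hF, setIntegral_const, smul_eq_mul]; ring
  · exact (integrable_indicator_iff hF).2 (integrableOn_const hFfin)

end

/-! ### Multilinearity and random signs -/

/-- Orthogonality of independent signs: for `p ≠ q`, flipping the sign at `p` permutes the sign
patterns and negates the sum. -/
theorem sum_sign_mul_sign {ι : Type*} [Fintype ι] [DecidableEq ι] (p q : ι) :
    ∑ e : ι → ℤˣ, (((e p : ℤ) : ℂ) * ((e q : ℤ) : ℂ)) =
      if p = q then (Fintype.card (ι → ℤˣ) : ℂ) else 0 := by
  split_ifs with h
  · subst h
    have : ∀ e : ι → ℤˣ, (((e p : ℤ) : ℂ) * ((e p : ℤ) : ℂ)) = 1 := fun e => by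
      have : (e p : ℤ) * (e p : ℤ) = 1 := Int.units_coe_mul_self (e p)
      exact_mod_cast this
    simp [this]
  · have hE : ∑ e : ι → ℤˣ, (((e p : ℤ) : ℂ) * ((e q : ℤ) : ℂ)) =
        ∑ e : ι → ℤˣ, -(((e p : ℤ) : ℂ) * ((e q : ℤ) : ℂ)) := by
      refine Fintype.sum_equiv (Equiv.mulRight (Pi.mulSingle p (-1 : ℤˣ))) _ _ fun e => ?_
      simp [Pi.mulSingle_eq_of_ne (Ne.symm h)]
    rw [Finset.sum_neg_distrib] at hE
    exact self_eq_neg.1 hE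

/-- Averaging over independent random signs selects the diagonal of a sum of multilinear forms. -/
theorem sum_signs_multilinear {ι V : Type*} [Fintype ι] [DecidableEq ι] [AddCommGroup V] [Module ℂ V]
    {m : ℕ} (Φ : ι → MultilinearMap ℂ (fun _ : Fin m => V) ℂ) (f : Fin m → ι → V) :
    ∑ ε : Fin m → ι → ℤˣ, ∑ Q, (∏ i, ((ε i Q : ℤ) : ℂ)) *
        Φ Q (fun i => ∑ P, ((ε i P : ℤ) : ℂ) • f i P) =
      (Fintype.card (Fin m → ι → ℤˣ) : ℂ) * ∑ Q, Φ Q fun i => f i Q := by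
  classical
  rw [Finset.sum_comm, Finset.mul_sum]
  refine Finset.sum_congr rfl fun Q _ => ?_
  simp_rw [MultilinearMap.map_sum, MultilinearMap.map_smul_univ, Finset.mul_sum]
  rw [Finset.sum_comm]
  -- After expansion, `π` records which index each slot picked. The mean factors over the slots, and
  -- slot `i` survives only if `π i = Q`.
  have h1 : ∀ π : Fin m → ι, ∑ ε : Fin m → ι → ℤˣ, (∏ i, ((ε i Q : ℤ) : ℂ)) *
      ((∏ i, ((ε i (π i) : ℤ) : ℂ)) • Φ Q fun i => f i (π i)) =
      (∏ i, if π i = Q then (Fintype.card (ι → ℤˣ) : ℂ) else 0) * Φ Q fun i => f i (π i) := by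
    intro π
    simp_rw [smul_eq_mul, ← mul_assoc, ← Finset.prod_mul_distrib]
    rw [← Finset.sum_mul]
    congr 1
    simp_rw [← sum_sign_mul_sign]
    rw [Finset.prod_univ_sum, Fintype.piFinset_univ]
    exact Finset.sum_congr rfl fun ε _ => Finset.prod_congr rfl fun i _ => mul_comm _ _
  rw [Finset.sum_congr rfl fun π _ => h1 π, Finset.sum_eq_single (fun _ => Q)]
  · simp
  · intro π _ hπ
    obtain ⟨i, hi⟩ : ∃ i, π i ≠ Q := by
      by_contra! h
      exact hπ (funext h)
    rw [Finset.prod_eq_zero (Finset.mem_univ i) (if_neg hi), zero_mul]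
  · simp

/-- The diagonal sum is a mean over the signs, so a bound uniform in the signs is inherited by it.
-/
theorem norm_sum_diag_le {ι V : Type*} [Fintype ι] [DecidableEq ι] [AddCommGroup V] [Module ℂ V]
    {m : ℕ} (Φ : ι → MultilinearMap ℂ (fun _ : Fin m => V) ℂ) (f : Fin m → ι → V) {B : ℝ}
    (hB : ∀ ε : Fin m → ι → ℤˣ, ‖∑ Q, (∏ i, ((ε i Q : ℤ) : ℂ)) *
        Φ Q (fun i => ∑ P, ((ε i P : ℤ) : ℂ) • f i P)‖ ≤ B) :
    ‖∑ Q, Φ Q fun i => f i Q‖ ≤ B := by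
  have h1 := sum_signs_multilinear Φ f
  have h2 : (Fintype.card (Fin m → ι → ℤˣ) : ℝ) * ‖∑ Q, Φ Q fun i => f i Q‖ ≤
      (Fintype.card (Fin m → ι → ℤˣ) : ℝ) * B := by
    have h3 := congrArg norm h1
    rw [norm_mul, Complex.norm_natCast] at h3
    rw [← h3]
    refine (norm_sum_le _ _).trans ((Finset.sum_le_sum fun ε _ => hB ε).trans (le_of_eq ?_))
    simp
  have hc : (0 : ℝ) < Fintype.card (Fin m → ι → ℤˣ) := by exact_mod_cast Fintype.card_pos
  exact le_of_mul_le_mul_left h2 hc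

/-- The space of bounded measurable functions that vanish off `A`. -/
def bddSubmodule {n : ℕ} (A : Set (RSpace n)) : Submodule ℂ (RSpace n → ℂ) where
  carrier := {f | BddOn A f}
  zero_mem' := ⟨measurable_const, ⟨0, by simp⟩, by simp⟩
  add_mem' := by
    rintro f g hf hg
    obtain ⟨M, hM⟩ := hf.2
    obtain ⟨M', hM'⟩ := hg.2
    exact ⟨hf.1.add hg.1, ⟨M + M', fun x => (norm_add_le _ _).trans (add_le_add (hM x) (hM' x))⟩,
      fun x hx => by simp [hf.3 x hx, hg.3 x hx]⟩
  smul_mem' := by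
    rintro a f hf
    obtain ⟨M, hM⟩ := hf.2
    refine ⟨hf.1.const_smul a, ⟨‖a‖ * M, fun x => ?_⟩, fun x hx => by simp [hf.3 x hx]⟩
    rw [Pi.smul_apply, norm_smul]
    exact mul_le_mul_of_nonneg_left (hM x) (norm_nonneg _)

/-- `S` is, up to null sets, multilinear on bounded functions that vanish off `A`. -/
structure IsAEMultilinearOn {n m : ℕ} (A : Set (RSpace n)) (S : TupleOp n m) : Prop where
  add : ∀ f : Fin m → RSpace n → ℂ, (∀ i, BddOn A (f i)) → ∀ (i : Fin m) (u v : RSpace n → ℂ),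
    BddOn A u → BddOn A v → S (Function.update f i (u + v)) =ᵐ[volume]
      S (Function.update f i u) + S (Function.update f i v)
  smul : ∀ f : Fin m → RSpace n → ℂ, (∀ i, BddOn A (f i)) → ∀ (i : Fin m) (a : ℂ)
    (u : RSpace n → ℂ), BddOn A u → S (Function.update f i (a • u)) =ᵐ[volume]
      a • S (Function.update f i u)

section

variable {n m : ℕ} {A : Set (RSpace n)}

theorem LpMultilinear.isAEMultilinearOn {s : Fin m → ℝ≥0∞} {s₀ : ℝ≥0∞}
    (T : LpMultilinear n m s s₀) (hA : Bornology.IsBounded A) :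
    IsAEMultilinearOn A T.onFunctions := by
  have hadd : ∀ (w : ℝ≥0∞) (u v : RSpace n → ℂ), BddOn A u → BddOn A v →
      lpClass w (u + v) = lpClass w u + lpClass w v := by
    intro w u v hu hv
    have h1 := hu.memLp hA w
    have h2 := hv.memLp hA w
    rw [lpClass, lpClass, lpClass, dif_pos h1, dif_pos h2, dif_pos (h1.add h2)]
    exact MemLp.toLp_add h1 h2
  have hsmul : ∀ (w : ℝ≥0∞) (a : ℂ) (u : RSpace n → ℂ), BddOn A u →
      lpClass w (a • u) = a • lpClass w u := by
    intro w a u hu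
    have h1 := hu.memLp hA w
    rw [lpClass, lpClass, dif_pos h1, dif_pos (h1.const_smul a)]
    exact MemLp.toLp_const_smul a h1
  constructor
  · intro f _ i u v hu hv
    rw [T.onFunctions_update, T.onFunctions_update, T.onFunctions_update, hadd _ u v hu hv,
      T.map_update_add]
    exact Lp.coeFn_add _ _
  · intro f _ i a u hu
    rw [T.onFunctions_update, T.onFunctions_update, hsmul _ a u hu, T.map_update_smul]
    exact Lp.coeFn_smul _ _

theorem IsAEMultilinearOn.slotCommutator {S : TupleOp n m} (hS : IsAEMultilinearOn A S)
    {b : RSpace n → ℝ} (hb : Measurable b) {M : ℝ} (hbA : ∀ x ∈ A, |b x| ≤ M) (j : Fin m) :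
    IsAEMultilinearOn A (slotCommutator b j S) := by
  have hmul : ∀ u, BddOn A u → BddOn A fun z => (b z : ℂ) * u z := fun u hu =>
    hu.mul_left (by fun_prop) ⟨M, fun z hz => by simpa using hbA z hz⟩
  have hupd : ∀ (f : Fin m → RSpace n → ℂ), (∀ i, BddOn A (f i)) →
      ∀ i, BddOn A (Function.update f j (fun z => (b z : ℂ) * f j z) i) := by
    intro f hf i
    by_cases hi : i = j
    · subst hi; rw [Function.update_self]; exact hmul _ (hf i)
    · rw [Function.update_of_ne hi]; exact hf i
  constructor
  · intro f hf i u v hu hv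
    have h0 := hS.add f hf i u v hu hv
    by_cases hij : i = j
    · subst hij
      have h1 := hS.add f hf i _ _ (hmul u hu) (hmul v hv)
      filter_upwards [h0, h1] with x hx0 hx1
      have e : (fun z => (b z : ℂ) * (u + v) z) =
          (fun z => (b z : ℂ) * u z) + fun z => (b z : ℂ) * v z := by
        funext z; simp [mul_add]
      simp only [_root_.slotCommutator, Pi.add_apply, Function.update_idem, Function.update_self] at *
      rw [hx0, show (fun z => (b z : ℂ) * (u z + v z)) =
        (fun z => (b z : ℂ) * u z) + fun z => (b z : ℂ) * v z from e, hx1]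
      ring
    · have h1 := hS.add _ (hupd f hf) i u v hu hv
      filter_upwards [h0, h1] with x hx0 hx1
      simp only [_root_.slotCommutator, Pi.add_apply] at *
      simp only [Function.update_of_ne (Ne.symm hij), Function.update_comm hij] at *
      rw [hx0, hx1]
      ring
  · intro f hf i a u hu
    have h0 := hS.smul f hf i a u hu
    by_cases hij : i = j
    · subst hij
      have h1 := hS.smul f hf i a _ (hmul u hu)
      filter_upwards [h0, h1] with x hx0 hx1
      have e : (fun z => (b z : ℂ) * (a • u) z) = a • (fun z => (b z : ℂ) * u z) := by
        funext z; simp; ring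
      simp only [_root_.slotCommutator, Pi.smul_apply, Function.update_idem,
        Function.update_self] at *
      rw [hx0, show (fun z => (b z : ℂ) * (a • u z)) = a • (fun z => (b z : ℂ) * u z) from e, hx1]
      simp only [smul_eq_mul]
      ring
    · have h1 := hS.smul _ (hupd f hf) i a u hu
      filter_upwards [h0, h1] with x hx0 hx1
      simp only [_root_.slotCommutator, Pi.smul_apply] at *
      simp only [Function.update_of_ne (Ne.symm hij), Function.update_comm hij] at *
      rw [hx0, hx1]
      simp only [smul_eq_mul]
      ring

theorem IsAEMultilinearOn.iteratedCommutator {S : TupleOp n m} (hS : IsAEMultilinearOn A S)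
    {b : RSpace n → ℝ} (hb : Measurable b) {M : ℝ} (hbA : ∀ x ∈ A, |b x| ≤ M) (j : Fin m) (k : ℕ) :
    IsAEMultilinearOn A (iteratedCommutator b j k S) := by
  induction k with
  | zero => exact hS
  | succ k ih => exact ih.slotCommutator hb hbA j

/-- Pairing an operator with a function gives a multilinear form. -/
theorem IsAEMultilinearOn.exists_form {S : TupleOp n m} (hS : IsAEMultilinearOn A S)
    {h : RSpace n → ℂ} (hint : ∀ f : Fin m → RSpace n → ℂ, (∀ i, BddOn A (f i)) →
      Integrable (fun x => h x * S f x) volume) :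
    ∃ Φ : MultilinearMap ℂ (fun _ : Fin m => bddSubmodule A) ℂ,
      ∀ f, Φ f = ∫ x, h x * S (fun i => (f i : RSpace n → ℂ)) x := by
  have hcoe : ∀ (f : Fin m → bddSubmodule A) (i : Fin m) (u : bddSubmodule A),
      (fun l => ((Function.update f i u l : bddSubmodule A) : RSpace n → ℂ)) =
        Function.update (fun l => (f l : RSpace n → ℂ)) i (u : RSpace n → ℂ) := by
    intro f i u
    funext l
    exact Function.apply_update (fun _ (v : bddSubmodule A) => (v : RSpace n → ℂ)) f i u l
  have hupd : ∀ (f : Fin m → bddSubmodule A) (i : Fin m) (u : bddSubmodule A),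
      Integrable (fun x => h x * S (Function.update (fun l => (f l : RSpace n → ℂ)) i
        (u : RSpace n → ℂ)) x) volume := by
    intro f i u
    rw [← hcoe]
    exact hint _ fun l => (Function.update f i u l).2
  refine ⟨{ toFun := fun f => ∫ x, h x * S (fun i => (f i : RSpace n → ℂ)) x
            map_update_add' := ?_
            map_update_smul' := ?_ }, fun f => rfl⟩
  · intro inst f i u v
    obtain rfl : inst = instDecidableEqFin m := Subsingleton.elim _ _
    rw [hcoe, hcoe, hcoe, ← integral_add (hupd f i u) (hupd f i v)]
    refine integral_congr_ae ?_
    filter_upwards [hS.add _ (fun l => (f l).2) i u v u.2 v.2] with x hx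
    rw [Submodule.coe_add, hx, Pi.add_apply, mul_add]
  · intro inst f i a u
    obtain rfl : inst = instDecidableEqFin m := Subsingleton.elim _ _
    rw [hcoe, hcoe, smul_eq_mul, ← integral_const_mul]
    refine integral_congr_ae ?_
    filter_upwards [hS.smul _ (fun l => (f l).2) i a u u.2] with x hx
    rw [Submodule.coe_smul, hx, Pi.smul_apply, smul_eq_mul]
    ring

end

/-! ### The testing inequality for sparse families of balls -/

/-- `L^u` bounds for sums of functions that live on balls with disjoint major subsets. -/
theorem eLpNorm_sum_le_of_balls {n : ℕ} {u : ℝ} (hu : 1 < u) {C₀ : ℝ} (hC₀ : 0 < C₀) :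
    ∃ C : ℝ, 0 < C ∧ ∀ {ι : Type} [Fintype ι] (y : ι → RSpace n) (l : ι → ℝ)
      (E : ι → Set (RSpace n)), (∀ Q, 0 < l Q) → (∀ Q, MeasurableSet (E Q)) →
      (∀ Q, E Q ⊆ Metric.closedBall (y Q) (l Q)) → Pairwise (Function.onFun Disjoint E) →
      (∀ Q, volume (Metric.closedBall (y Q) (l Q)) ≤ ENNReal.ofReal C₀ * volume (E Q)) →
      ∀ (a : ι → ℝ) (t : ℝ), (∀ Q, 0 ≤ a Q) → ∀ w : ι → RSpace n → ℂ,
      (∀ Q x, ‖w Q x‖ ≤ (Metric.closedBall (y Q) (l Q)).indicator (fun _ => a Q ^ (t / u)) x) →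
      eLpNorm (fun x => ∑ Q, w Q x) (ENNReal.ofReal u) volume ≤
        ENNReal.ofReal (C * (∑ Q, a Q ^ t * volume.real (E Q)) ^ (1 / u)) := by
  obtain ⟨C, hC, H⟩ := lintegral_sum_balls_rpow_le (n := n) hu hC₀
  have hu0 : 0 < u := by linarith
  refine ⟨C ^ (1 / u), by positivity, ?_⟩
  intro ι _ y l E hl hEm hEs hdis hvol a t ha w hw
  have h1 := H Finset.univ y l E (fun Q => (a Q ^ (t / u)).toNNReal) (fun Q _ => hl Q)
    (fun Q _ => hEm Q) (fun Q _ => hEs Q) (fun P _ Q _ h => hdis h) (fun Q _ => hvol Q)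
  have hap : ∀ Q, 0 ≤ a Q ^ (t / u) := fun Q => Real.rpow_nonneg (ha Q) _
  have h2 : ∑ Q, (((a Q ^ (t / u)).toNNReal : ℝ≥0) : ℝ≥0∞) ^ u * volume (E Q) =
      ENNReal.ofReal (∑ Q, a Q ^ t * volume.real (E Q)) := by
    rw [ENNReal.ofReal_sum_of_nonneg fun Q _ => mul_nonneg (Real.rpow_nonneg (ha Q) _) (by positivity)]
    refine Finset.sum_congr rfl fun Q _ => ?_
    have hEfin : volume (E Q) ≠ ∞ :=
      ne_top_of_le_ne_top measure_closedBall_lt_top.ne (measure_mono (hEs Q))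
    rw [ENNReal.ofReal_mul (Real.rpow_nonneg (ha Q) _), Measure.real, ENNReal.ofReal_toReal hEfin]
    congr 1
    change ENNReal.ofReal (a Q ^ (t / u)) ^ u = _
    rw [ENNReal.ofReal_rpow_of_nonneg (hap Q) hu0.le, ← Real.rpow_mul (ha Q),
      div_mul_cancel₀ _ hu0.ne']
  rw [h2, ← ENNReal.ofReal_mul hC.le] at h1
  have hY : 0 ≤ ∑ Q, a Q ^ t * volume.real (E Q) :=
    Finset.sum_nonneg fun Q _ => mul_nonneg (Real.rpow_nonneg (ha Q) _) (by positivity)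
  rw [eLpNorm_eq_lintegral_rpow_enorm_toReal (by simpa using hu0) ENNReal.ofReal_ne_top,
    ENNReal.toReal_ofReal hu0.le, ← Real.mul_rpow hC.le hY,
    ← ENNReal.ofReal_rpow_of_nonneg (by positivity) (by positivity)]
  refine ENNReal.rpow_le_rpow (le_trans (lintegral_mono fun x => ?_) h1) (by positivity)
  refine ENNReal.rpow_le_rpow ?_ hu0.le
  refine (enorm_sum_le _ _).trans (Finset.sum_le_sum fun Q _ => ?_)
  by_cases hx : x ∈ Metric.closedBall (y Q) (l Q)
  · have h3 := hw Q x
    rw [Set.indicator_of_mem hx] at h3 ⊢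
    rw [← ofReal_norm]
    exact ENNReal.ofReal_le_ofReal h3
  · have h3 := hw Q x
    rw [Set.indicator_of_notMem hx] at h3 ⊢
    rw [norm_le_zero_iff.1 h3]; simp

theorem enorm_integral_mul_le {α : Type*} [MeasurableSpace α] {μ : Measure α} {f g : α → ℂ}
    (hf : AEStronglyMeasurable f μ) (hg : AEStronglyMeasurable g μ) {u v : ℝ}
    (huv : u.HolderConjugate v) :
    ∫⁻ x, ‖f x * g x‖ₑ ∂μ ≤
      eLpNorm f (ENNReal.ofReal u) μ * eLpNorm g (ENNReal.ofReal v) μ := by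
  have h := ENNReal.lintegral_mul_le_Lp_mul_Lq μ huv hf.enorm hg.enorm
  rw [eLpNorm_eq_lintegral_rpow_enorm_toReal (by simpa using huv.pos) ENNReal.ofReal_ne_top,
    eLpNorm_eq_lintegral_rpow_enorm_toReal (by simpa using huv.symm.pos) ENNReal.ofReal_ne_top,
    ENNReal.toReal_ofReal huv.nonneg, ENNReal.toReal_ofReal huv.symm.nonneg]
  simpa [enorm_mul] using h

theorem aestronglyMeasurable_iteratedCommutator {n m : ℕ} {s : Fin m → ℝ≥0∞} {s₀ : ℝ≥0∞}
    (T : LpMultilinear n m s s₀) {b : RSpace n → ℝ} (hb : Measurable b) (i : Fin m) (k : ℕ)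
    (f : Fin m → RSpace n → ℂ) :
    AEStronglyMeasurable (iteratedCommutator b i k T.onFunctions f) volume := by
  induction k generalizing f with
  | zero => exact Lp.aestronglyMeasurable _
  | succ k ih =>
    exact ((by fun_prop : Measurable fun x => (b x : ℂ)).aestronglyMeasurable.mul (ih f)).sub (ih _)

section

variable {n m : ℕ}

/-- When `b` is bounded on `A`, all `b ^ j * f i` are bounded with bounded support and so lie in
every Lebesgue space. This is why testing takes place on sets where `|b| ≤ M`. -/
theorem mem_commutatorDomain_of_bdd {s p : Fin m → ℝ≥0∞} {b : RSpace n → ℝ} (hb : Measurable b)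
    {A : Set (RSpace n)} (hA : Bornology.IsBounded A) {M : ℝ} (hbA : ∀ x ∈ A, |b x| ≤ M) (i : Fin m)
    (k : ℕ) {f : Fin m → RSpace n → ℂ} (hf : ∀ l, BddOn A (f l)) :
    f ∈ commutatorDomain s p b i k := by
  refine ⟨fun l => (hf l).memLp hA _, fun l => (hf l).memLp hA _, fun j _ => ?_⟩
  refine BddOn.memLp (A := A) ((hf i).mul_left (by fun_prop) ⟨M ^ j, fun x hx => ?_⟩) hA _
  rw [norm_pow]
  exact pow_le_pow_left₀ (norm_nonneg _) (by simpa using hbA x hx) j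

/-- The testing inequality for a finite family of balls, with weights and sets on which the
commutator is controlled. -/
theorem exists_weighted_testing [NeZero m] {k : ℕ}
    {p q t : ℝ} {ps : Fin m → ℝ} (hq : 1 < q) (hps : ∀ i, 1 < ps i)
    (hp : 1 / p = ∑ i, 1 / ps i) (ht0 : 0 < t) (ht : 1 / t = 1 / p + (1 - 1 / q))
    {s : Fin m → ℝ≥0∞} {s₀ : ℝ≥0∞} {T : LpMultilinear n m s s₀} (hT : IsInitiallyBounded T)
    {K : RSpace n → (Fin m → RSpace n) → ℂ} {C : ℝ} {ω : ℝ → ℝ}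
    (hK : IsMultilinearCZKernel K C ω) (hTK : IsRepresentedBy T.onFunctions K)
    {b : RSpace n → ℝ} (hb : Measurable b)
    (hbdd : IsBoundedOnDomain (commutatorDomain s (fun i => ENNReal.ofReal (ps i)) b 0 k)
      (iteratedCommutator b 0 k T.onFunctions)
      (fun i => ENNReal.ofReal (ps i)) (ENNReal.ofReal q))
    {Λ c₁ C₀ : ℝ} (hΛ : 1 ≤ Λ) (hc₁ : 0 < c₁) (hC₀ : 0 < C₀) :
    ∃ C₂ : ℝ, 0 < C₂ ∧ ∀ {ι : Type} [Fintype ι] (y : ι → RSpace n) (l : ι → ℝ)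
      (E : ι → Set (RSpace n)), (∀ Q, 0 < l Q) → (∀ Q, MeasurableSet (E Q)) →
      (∀ Q, E Q ⊆ Metric.closedBall (y Q) (l Q)) → Pairwise (Function.onFun Disjoint E) →
      (∀ Q, volume (Metric.closedBall (y Q) (l Q)) ≤ ENNReal.ofReal C₀ * volume (E Q)) →
      ∀ (x₀ : ι → RSpace n) (K₀ : ι → ℂ), (∀ Q, 4 * l Q ≤ dist (x₀ Q) (y Q)) →
      (∀ Q, dist (x₀ Q) (y Q) ≤ Λ * l Q) →
      (∀ Q, c₁ ≤ ‖K₀ Q‖ * volume.real (Metric.closedBall (y Q) (l Q)) ^ m) →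
      (∀ Q, ∀ x ∈ Metric.closedBall (x₀ Q) (l Q), ∀ z : Fin m → RSpace n,
        (∀ i, z i ∈ Metric.closedBall (y Q) (l Q)) → ‖K x z - K₀ Q‖ ≤ 1 / 2 * ‖K₀ Q‖) →
      ∀ (M : ℝ) (U G F : ι → Set (RSpace n)), (∀ Q, MeasurableSet (U Q)) →
      (∀ Q, MeasurableSet (G Q)) → (∀ Q, MeasurableSet (F Q)) →
      (∀ Q, U Q ⊆ Metric.closedBall (y Q) (l Q) ∩ {z | |b z| ≤ M}) →
      (∀ Q, G Q ⊆ Metric.closedBall (y Q) (l Q) ∩ {z | |b z| ≤ M}) →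
      (∀ Q, F Q ⊆ Metric.closedBall (x₀ Q) (l Q)) →
      (∀ Q, volume.real (Metric.closedBall (y Q) (l Q)) ≤ 4 * volume.real (G Q)) →
      (∀ Q, volume.real (Metric.closedBall (y Q) (l Q)) ≤ 4 * volume.real (F Q)) →
      ∀ (c : ι → ℝ) (σ : ℝ), |σ| = 1 →
      (∀ Q, ∀ x ∈ F Q, ∀ z ∈ U Q, |b z - c Q| ≤ σ * (b z - b x)) →
      ∀ a : ι → ℝ, (∀ Q, 0 ≤ a Q) →
      ∑ Q, a Q * ∫ z in U Q, |b z - c Q| ^ k ≤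
        C₂ * (∑ Q, a Q ^ t * volume.real (E Q)) ^ (1 / t) := by
  classical
  obtain ⟨A₀, hA₀⟩ := hbdd
  have hm : 0 < m := Nat.pos_of_ne_zero (NeZero.ne m)
  set q' := q / (q - 1) with hq'
  have hqq : q.HolderConjugate q' := Real.HolderConjugate.conjExponent hq
  have hq'1 : 1 < q' := hqq.symm.lt
  have hq'inv : 1 / q' = 1 - 1 / q := by
    have := hqq.inv_add_inv_eq_one
    simp only [one_div]; linarith
  -- Enlarging by `Λ + 1` makes one ball contain both the original ball and its reflection; the
  -- major subset stays the same and the volume ratio grows by `(Λ + 1) ^ n`.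
  have hC₀' : 0 < C₀ * (Λ + 1) ^ n := by positivity
  choose Cp hCp Hp using fun i => eLpNorm_sum_le_of_balls (n := n) (hps i) hC₀'
  obtain ⟨Cq, hCq, Hq⟩ := eLpNorm_sum_le_of_balls (n := n) hq'1 hC₀'
  have hprodC : 0 < ∏ i, Cp i := Finset.prod_pos fun i _ => hCp i
  set D : ℝ := Cq * ((A₀ + 1) * ∏ i, Cp i) with hD
  have hDpos : 0 < D := by positivity
  -- The `2` comes from the kernel being within half of `K₀`, and `4 ^ m` from `F` and the `m - 1`
  -- copies of `G`, each of at least a quarter of the volume of the ball.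
  refine ⟨2 * 4 ^ m / c₁ * D, by positivity, ?_⟩
  intro ι _ y l E hl hEm hEs hdis hvol x₀ K₀ hfar hnear hKvol hKK₀ M U G F hUm hGm hFm hUs hGs hFs
    hGv hFv c σ hσ1 hσ a ha
  -- the enlarged balls
  set B : ι → Set (RSpace n) := fun Q => Metric.closedBall (y Q) (l Q) with hB
  set l' : ι → ℝ := fun Q => (Λ + 1) * l Q with hl'
  have hl'pos : ∀ Q, 0 < l' Q := fun Q => mul_pos (by linarith) (hl Q)
  set B' : ι → Set (RSpace n) := fun Q => Metric.closedBall (y Q) (l' Q) with hB'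
  have hBB' : ∀ Q, B Q ⊆ B' Q := fun Q =>
    Metric.closedBall_subset_closedBall (by simp only [hl']; nlinarith [hl Q])
  have hFB' : ∀ Q, F Q ⊆ B' Q := fun Q x hx => by
    have h1 := Metric.mem_closedBall.1 (hFs Q hx)
    have h2 := dist_triangle x (x₀ Q) (y Q)
    refine Metric.mem_closedBall.2 ?_
    have := hnear Q
    simp only [hl']
    linarith
  have hvol' : ∀ Q, volume (B' Q) ≤ ENNReal.ofReal (C₀ * (Λ + 1) ^ n) * volume (E Q) := by
    intro Q
    simp only [hB', hl']
    rw [volume_closedBall_mul _ (hl Q).le (by linarith), mul_comm C₀,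
      ENNReal.ofReal_mul (by positivity), mul_assoc]
    gcongr
    exact hvol Q
  have hEs' : ∀ Q, E Q ⊆ B' Q := fun Q => (hEs Q).trans (hBB' Q)
  -- the common support
  set A : Set (RSpace n) := (⋃ Q, B' Q) ∩ {z | |b z| ≤ M} with hA
  have hAb : Bornology.IsBounded A :=
    (Bornology.isBounded_iUnion.2 fun Q => Metric.isBounded_closedBall).subset
      Set.inter_subset_left
  have hbA : ∀ x ∈ A, |b x| ≤ M := fun x hx => hx.2
  have hsubA : ∀ Q (W : Set (RSpace n)), W ⊆ B Q ∩ {z | |b z| ≤ M} → W ⊆ A := fun Q W hW x hx =>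
    ⟨Set.mem_iUnion.2 ⟨Q, hBB' Q (hW hx).1⟩, (hW hx).2⟩
  set S := iteratedCommutator b 0 k T.onFunctions with hS
  have hSml : IsAEMultilinearOn A S :=
    (T.isAEMultilinearOn hAb).iteratedCommutator hb hbA 0 k
  have hSbound : ∀ f : Fin m → RSpace n → ℂ, (∀ i, BddOn A (f i)) →
      eLpNorm (S f) (ENNReal.ofReal q) volume ≤
        A₀ * ∏ i, eLpNorm (f i) (ENNReal.ofReal (ps i)) volume := fun f hf =>
    hA₀ f (mem_commutatorDomain_of_bdd hb hAb hbA 0 k hf)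
  have hSfin : ∀ f : Fin m → RSpace n → ℂ, (∀ i, BddOn A (f i)) →
      eLpNorm (S f) (ENNReal.ofReal q) volume ≠ ∞ := fun f hf =>
    ne_top_of_le_ne_top (ENNReal.mul_ne_top ENNReal.coe_ne_top (ENNReal.prod_ne_top fun i _ =>
      ((hf i).memLp hAb _).eLpNorm_ne_top)) (hSbound f hf)
  have hSm : ∀ f, AEStronglyMeasurable (S f) volume :=
    aestronglyMeasurable_iteratedCommutator T hb 0 k
  -- the dual functions
  set h₀ : ι → RSpace n → ℂ := fun Q =>
    (F Q).indicator fun _ => (starRingEnd ℂ) (K₀ Q) / ‖K₀ Q‖ * ((-σ) ^ k : ℝ) with hh₀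
  have hh₀b : ∀ Q, BddOn (B' Q) (h₀ Q) := fun Q => BddOn.indicator_const (hFm Q) (hFB' Q) _
  have hpair : ∀ (h : RSpace n → ℂ) (W : Set (RSpace n)), Bornology.IsBounded W → BddOn W h →
      ∀ f : Fin m → RSpace n → ℂ, (∀ i, BddOn A (f i)) →
      Integrable (fun x => h x * S f x) volume := by
    intro h W hW hh f hf
    refine ⟨hh.1.aestronglyMeasurable.mul (hSm f), ?_⟩
    refine lt_of_le_of_lt (enorm_integral_mul_le hh.1.aestronglyMeasurable (hSm f) hqq.symm) ?_
    exact ENNReal.mul_lt_top (hh.memLp hW _).eLpNorm_lt_top (hSfin f hf).lt_top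
  choose Φ hΦ using fun Q => hSml.exists_form (h := h₀ Q)
    (hpair (h₀ Q) (B' Q) Metric.isBounded_closedBall (hh₀b Q))
  -- the test functions
  have hw : ∀ (i : Fin m) Q, BddOn A ((if i = 0 then U Q else G Q).indicator fun _ => (1 : ℂ)) := by
    intro i Q
    split_ifs
    · exact BddOn.indicator_const (hUm Q) (hsubA Q _ (hUs Q)) 1
    · exact BddOn.indicator_const (hGm Q) (hsubA Q _ (hGs Q)) 1
  set w : Fin m → ι → bddSubmodule A := fun i Q => ⟨_, hw i Q⟩ with hw_def
  -- The weight is split into `a ^ (t / ps i)` in slot `i` and `a ^ (t / q')` on the dual side.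
  -- These exponents add up to one by the choice of `t`, and each norm then involves the same sum `∑
  -- a ^ t * |E|`.
  set f : Fin m → ι → bddSubmodule A := fun i Q => ((a Q ^ (t / ps i) : ℝ) : ℂ) • w i Q with hf
  set Ψ : ι → MultilinearMap ℂ (fun _ : Fin m => bddSubmodule A) ℂ := fun Q =>
    ((a Q ^ (t / q') : ℝ) : ℂ) • Φ Q with hΨ
  have hps0 : ∀ i, 0 < ps i := fun i => by linarith [hps i]
  have hq'0 : 0 < q' := by linarith
  have hcoef : ∀ Q, a Q ^ (t / q') * ∏ i, a Q ^ (t / ps i) = a Q := by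
    intro Q
    rw [← Real.rpow_sum_of_nonneg (ha Q) fun i _ => (div_pos ht0 (hps0 i)).le,
      ← Real.rpow_add_of_nonneg (ha Q) (by positivity)
        (Finset.sum_nonneg fun i _ => (div_pos ht0 (hps0 i)).le)]
    have : t / q' + ∑ i, t / ps i = 1 := by
      have e : ∑ i, t / ps i = t * (1 / p) := by
        rw [hp, Finset.mul_sum]; exact Finset.sum_congr rfl fun i _ => by ring
      rw [e, show t / q' = t * (1 / q') by ring, hq'inv, ← mul_add, add_comm, ← ht]
      field_simp
    rw [this, Real.rpow_one]
  have hdiag : ∀ Q, Ψ Q (fun i => f i Q) = (a Q : ℂ) * Φ Q fun i => w i Q := by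
    intro Q
    simp only [hΨ, hf, _root_.smul_apply, MultilinearMap.map_smul_univ, smul_eq_mul]
    rw [← mul_assoc]
    congr 1
    exact_mod_cast hcoef Q
  set Y := ∑ Q, a Q ^ t * volume.real (E Q) with hY
  have hYnn : 0 ≤ Y := Finset.sum_nonneg fun Q _ => mul_nonneg (Real.rpow_nonneg (ha Q) _)
    (by positivity)
  have hsign : ∀ e : ℤˣ, ‖((e : ℤ) : ℂ)‖ = 1 := fun e => by
    rcases Int.units_eq_one_or e with rfl | rfl <;> simp
  have hK₀pos : ∀ Q, 0 < ‖K₀ Q‖ := fun Q => by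
    by_contra hcon
    have h0 : ‖K₀ Q‖ = 0 := le_antisymm (not_lt.1 hcon) (norm_nonneg _)
    have := hKvol Q
    rw [h0, zero_mul] at this
    linarith
  -- the upper bound, uniform in the signs
  have hupper : ∀ ε : Fin m → ι → ℤˣ, ‖∑ Q, (∏ i, ((ε i Q : ℤ) : ℂ)) *
      Ψ Q (fun i => ∑ P, ((ε i P : ℤ) : ℂ) • f i P)‖ ≤ D * Y ^ (1 / t) := by
    intro ε
    set g : Fin m → bddSubmodule A := fun i => ∑ P, ((ε i P : ℤ) : ℂ) • f i P with hg
    -- The dual functions are added with the product of the signs of all slots, so the whole signed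
    -- sum is one pairing with one value of the commutator.
    set H : RSpace n → ℂ := fun x =>
      ∑ Q, ((∏ i, ((ε i Q : ℤ) : ℂ)) * ((a Q ^ (t / q') : ℝ) : ℂ)) * h₀ Q x with hH
    have hgb : ∀ i, BddOn A (g i : RSpace n → ℂ) := fun i => (g i).2
    have hsum : ∑ Q, (∏ i, ((ε i Q : ℤ) : ℂ)) * Ψ Q g =
        ∫ x, H x * S (fun i => (g i : RSpace n → ℂ)) x := by
      have h1 : ∀ x, H x * S (fun i => (g i : RSpace n → ℂ)) x =
          ∑ Q, ((∏ i, ((ε i Q : ℤ) : ℂ)) * ((a Q ^ (t / q') : ℝ) : ℂ)) *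
            (h₀ Q x * S (fun i => (g i : RSpace n → ℂ)) x) := fun x => by
        rw [hH]; simp only; rw [Finset.sum_mul]
        exact Finset.sum_congr rfl fun Q _ => by ring
      rw [integral_congr_ae (Eventually.of_forall h1), integral_finsetSum _ fun Q _ =>
        (hpair (h₀ Q) (B' Q) Metric.isBounded_closedBall (hh₀b Q) _ hgb).const_mul _]
      refine Finset.sum_congr rfl fun Q _ => ?_
      rw [integral_const_mul, ← hΦ Q]
      simp only [hΨ, _root_.smul_apply, smul_eq_mul]
      ring
    have hHm : Measurable H :=
      Finset.measurable_fun_sum _ fun Q _ => (hh₀b Q).1.const_mul _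
    have hHn : eLpNorm H (ENNReal.ofReal q') volume ≤ ENNReal.ofReal (Cq * Y ^ (1 / q')) := by
      refine Hq y l' E hl'pos hEm hEs' hdis hvol' a t ha _ fun Q x => ?_
      have hapos : 0 ≤ a Q ^ (t / q') := Real.rpow_nonneg (ha Q) _
      rw [norm_mul, norm_mul, norm_prod, Finset.prod_congr rfl fun i _ => hsign (ε i Q),
        Finset.prod_const_one, one_mul, Complex.norm_real, Real.norm_eq_abs, abs_of_nonneg hapos]
      by_cases hx : x ∈ F Q
      · rw [Set.indicator_of_mem (hFB' Q hx)]
        have : ‖h₀ Q x‖ = 1 := by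
          simp only [hh₀]
          rw [Set.indicator_of_mem hx, norm_mul, norm_div, Complex.norm_conj, Complex.norm_real,
            Complex.norm_real, norm_norm, div_self (hK₀pos Q).ne', norm_pow, norm_neg,
            Real.norm_eq_abs, hσ1, one_pow, one_mul]
        rw [this, mul_one]
      · have : h₀ Q x = 0 := Set.indicator_of_notMem hx _
        rw [this, norm_zero, mul_zero]
        exact Set.indicator_nonneg (fun _ _ => hapos) _
    have hgn : ∀ i, eLpNorm (g i : RSpace n → ℂ) (ENNReal.ofReal (ps i)) volume ≤
        ENNReal.ofReal (Cp i * Y ^ (1 / ps i)) := by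
      intro i
      have e : (g i : RSpace n → ℂ) = fun x => ∑ Q, (((ε i Q : ℤ) : ℂ) • (f i Q : RSpace n → ℂ)) x := by
        funext x
        simp [hg, Finset.sum_apply]
      rw [e]
      refine Hp i y l' E hl'pos hEm hEs' hdis hvol' a t ha _ fun Q x => ?_
      have hapos : 0 ≤ a Q ^ (t / ps i) := Real.rpow_nonneg (ha Q) _
      have e2 : ‖(((ε i Q : ℤ) : ℂ) • (f i Q : RSpace n → ℂ)) x‖ =
          a Q ^ (t / ps i) * ‖(if i = 0 then U Q else G Q).indicator (fun _ => (1 : ℂ)) x‖ := by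
        rw [Pi.smul_apply, norm_smul, hsign, one_mul]
        simp only [hf, hw_def, Submodule.coe_smul, Pi.smul_apply, norm_smul, Complex.norm_real,
          Real.norm_eq_abs, abs_of_nonneg hapos]
      rw [e2]
      have hsub : (if i = 0 then U Q else G Q) ⊆ B' Q := by
        split_ifs
        · exact fun z hz => hBB' Q (hUs Q hz).1
        · exact fun z hz => hBB' Q (hGs Q hz).1
      by_cases hx : x ∈ (if i = 0 then U Q else G Q)
      · rw [Set.indicator_of_mem hx, Set.indicator_of_mem (hsub hx)]; simp
      · rw [Set.indicator_of_notMem hx, norm_zero, mul_zero]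
        exact Set.indicator_nonneg (fun _ _ => hapos) _
    have hfinal : ‖∑ Q, (∏ i, ((ε i Q : ℤ) : ℂ)) * Ψ Q g‖ₑ ≤
        ENNReal.ofReal (D * Y ^ (1 / t)) := by
      rw [hsum]
      calc _ ≤ ∫⁻ x, ‖H x * S (fun i => (g i : RSpace n → ℂ)) x‖ₑ := enorm_integral_le_lintegral_enorm _
        _ ≤ eLpNorm H (ENNReal.ofReal q') volume *
            eLpNorm (S fun i => (g i : RSpace n → ℂ)) (ENNReal.ofReal q) volume :=
          enorm_integral_mul_le hHm.aestronglyMeasurable (hSm _) hqq.symm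
        _ ≤ ENNReal.ofReal (Cq * Y ^ (1 / q')) *
            (A₀ * ∏ i, ENNReal.ofReal (Cp i * Y ^ (1 / ps i))) := by
          refine mul_le_mul' hHn ((hSbound _ hgb).trans ?_)
          gcongr with i
          exact hgn i
        _ ≤ ENNReal.ofReal (Cq * Y ^ (1 / q')) * (ENNReal.ofReal (A₀ + 1) *
            ENNReal.ofReal (∏ i, (Cp i * Y ^ (1 / ps i)))) := by
          rw [ENNReal.ofReal_prod_of_nonneg fun i _ => by
            have := hCp i
            positivity]
          gcongr
          rw [← ENNReal.ofReal_coe_nnreal]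
          exact ENNReal.ofReal_le_ofReal (by linarith)
        _ = ENNReal.ofReal (D * Y ^ (1 / t)) := by
          have hnn : 0 ≤ ∏ i, (Cp i * Y ^ (1 / ps i)) := Finset.prod_nonneg fun i _ => by
            have := hCp i
            positivity
          rw [← ENNReal.ofReal_mul (by positivity), ← ENNReal.ofReal_mul (by positivity)]
          congr 1
          have e1 : Y ^ (1 / t) = Y ^ (1 / q') * ∏ i, Y ^ (1 / ps i) := by
            rw [← Real.rpow_sum_of_nonneg hYnn fun i _ => (one_div_pos.2 (hps0 i)).le, ← hp,
              ← Real.rpow_add_of_nonneg hYnn (by positivity)]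
            · rw [ht, hq'inv, add_comm]
            · rw [hp]; exact Finset.sum_nonneg fun i _ => (one_div_pos.2 (hps0 i)).le
          rw [e1, Finset.prod_mul_distrib, hD]
          ring
    have hnn : 0 ≤ D * Y ^ (1 / t) := by positivity
    rw [← ofReal_norm] at hfinal
    exact (ENNReal.ofReal_le_ofReal_iff hnn).1 hfinal
  have hmain := norm_sum_diag_le Ψ f hupper
  -- the lower bound
  have hlower : ∀ Q, c₁ / (2 * 4 ^ m) * ∫ z in U Q, |b z - c Q| ^ k ≤
      (Φ Q fun i => w i Q).re := by
    intro Q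
    have hwi : (fun i => ((w i Q : bddSubmodule A) : RSpace n → ℂ)) =
      fun i => (if i = 0 then U Q else G Q).indicator fun _ => (1 : ℂ) := rfl
    have h1 := le_re_integral_iteratedCommutator hT hK hTK hb (k := k) (hl Q) (hfar Q)
      (norm_pos_iff.1 (hK₀pos Q)) (hKK₀ Q) (hUm Q) (hGm Q) (hFm Q) (hUs Q) (hGs Q) (hFs Q) (hσ Q)
      (hpair (h₀ Q) (B' Q) Metric.isBounded_closedBall (hh₀b Q) _ fun i => hw i Q)
    rw [hΦ Q, hwi]
    refine le_trans ?_ h1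
    refine mul_le_mul_of_nonneg_right ?_ (integral_nonneg fun _ => by positivity)
    set V := volume.real (Metric.closedBall (y Q) (l Q)) with hV
    have hVnn : 0 ≤ V := by positivity
    have hFQ : V / 4 ≤ volume.real (F Q) := by have := hFv Q; linarith
    have hGQ : V / 4 ≤ volume.real (G Q) := by have := hGv Q; linarith
    have e : V ^ m = V * V ^ (m - 1) := by
      rw [← pow_succ']; congr 1; omega
    have e4 : (4 : ℝ) ^ m = 4 * 4 ^ (m - 1) := by
      rw [← pow_succ']; congr 1; omega
    calc c₁ / (2 * 4 ^ m) ≤ ‖K₀ Q‖ * V ^ m / (2 * 4 ^ m) := by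
          gcongr; exact hKvol Q
      _ = 1 / 2 * ‖K₀ Q‖ * (V / 4) * (V / 4) ^ (m - 1) := by
          rw [e, e4, div_pow]; field_simp
      _ ≤ _ := by gcongr
  have hre : ∑ Q, a Q * (c₁ / (2 * 4 ^ m) * ∫ z in U Q, |b z - c Q| ^ k) ≤
      (∑ Q, Ψ Q fun i => f i Q).re := by
    rw [Complex.re_sum]
    refine Finset.sum_le_sum fun Q _ => ?_
    rw [hdiag Q, Complex.re_ofReal_mul]
    exact mul_le_mul_of_nonneg_left (hlower Q) (ha Q)
  have h2 : c₁ / (2 * 4 ^ m) * ∑ Q, a Q * ∫ z in U Q, |b z - c Q| ^ k ≤ D * Y ^ (1 / t) := by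
    rw [Finset.mul_sum]
    refine le_trans (le_of_eq ?_) (hre.trans ((Complex.re_le_norm _).trans hmain))
    exact Finset.sum_congr rfl fun Q _ => by ring
  have h3 : (0 : ℝ) < 2 * 4 ^ m / c₁ := by positivity
  calc _ = 2 * 4 ^ m / c₁ * (c₁ / (2 * 4 ^ m) * ∑ Q, a Q * ∫ z in U Q, |b z - c Q| ^ k) := by
        field_simp
    _ ≤ 2 * 4 ^ m / c₁ * (D * Y ^ (1 / t)) := by gcongr
    _ = _ := by ring

end

section

variable {n m : ℕ}

/-- Continuity from below, `b` being finite everywhere. Truncating at a large height costs a factor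
`2`, which turns the halves given by a median into quarters. -/
theorem eventually_volume_truncation {b : RSpace n → ℝ} (S : Set (RSpace n))
    (hSfin : volume S ≠ ∞) :
    ∀ᶠ N : ℕ in atTop, volume.real S ≤ 2 * volume.real (S ∩ {z | |b z| ≤ N}) := by
  have hmono : Monotone fun N : ℕ => S ∩ {z | |b z| ≤ (N : ℝ)} := fun i j hij z hz =>
    ⟨hz.1, le_trans (show |b z| ≤ (i : ℝ) from hz.2) (by exact_mod_cast hij)⟩
  have hU : ⋃ N : ℕ, S ∩ {z | |b z| ≤ (N : ℝ)} = S := by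
    rw [← Set.inter_iUnion, Set.inter_eq_left]
    intro z _
    exact Set.mem_iUnion.2 (exists_nat_ge |b z|)
  have h1 := tendsto_measure_iUnion_atTop (μ := volume) hmono
  rw [hU] at h1
  have h2 := (ENNReal.tendsto_toReal hSfin).comp h1
  rcases (measureReal_nonneg (μ := volume) (s := S)).eq_or_lt with h0 | h0
  · refine Eventually.of_forall fun N => ?_
    rw [← h0]; positivity
  · have h3 : volume.real S / 2 < (volume S).toReal := half_lt_self h0
    filter_upwards [h2.eventually (lt_mem_nhds h3)] with N hN
    have : volume.real S / 2 < volume.real (S ∩ {z | |b z| ≤ (N : ℝ)}) := hN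
    linarith

/-- The testing inequality for a finite family of balls, with arbitrary weights. -/
theorem exists_testing_bound [NeZero m] (hn : 0 < n) (hm : 2 ≤ m) {k : ℕ}
    {p q r : ℝ} {ps : Fin m → ℝ} (hq : 1 < q) (hps : ∀ i, 1 < ps i)
    (hp : 1 / p = ∑ i, 1 / ps i) (hr1 : 1 < r) (hr : 1 / r = 1 / q - 1 / p)
    {s : Fin m → ℝ≥0∞} {s₀ : ℝ≥0∞} {T : LpMultilinear n m s s₀} (hT : IsNondegenerateCZO T)
    {b : RSpace n → ℝ} (hb : Measurable b)
    (hloc : ∀ t y l, IntegrableOn (fun z => |b z - t| ^ k) (Metric.closedBall y l))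
    (hbdd : IsBoundedOnDomain (commutatorDomain s (fun i => ENNReal.ofReal (ps i)) b 0 k)
      (iteratedCommutator b 0 k T.onFunctions)
      (fun i => ENNReal.ofReal (ps i)) (ENNReal.ofReal q)) {C₀ : ℝ} (hC₀ : 0 < C₀) :
    ∃ (W : ℝ) (c : RSpace n → ℝ → ℝ), ∀ {ι : Type} [Fintype ι] (y : ι → RSpace n) (l : ι → ℝ)
      (E : ι → Set (RSpace n)), (∀ Q, 0 < l Q) → (∀ Q, MeasurableSet (E Q)) →
      (∀ Q, E Q ⊆ Metric.closedBall (y Q) (l Q)) → Pairwise (Function.onFun Disjoint E) →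
      (∀ Q, volume (Metric.closedBall (y Q) (l Q)) ≤ ENNReal.ofReal C₀ * volume (E Q)) →
      ∑ Q, (⨍ z in Metric.closedBall (y Q) (l Q), |b z - c (y Q) (l Q)| ^ k) ^ r *
        volume.real (E Q) ≤ W := by
  obtain ⟨hTb, K, C, ω, hK, hTK, hKn⟩ := hT
  obtain ⟨Λ, c₁, hΛ, hc₁, hrefl⟩ := hK.exists_reflected hKn hn hm
  choose! x₀ K₀ hfar hnear hKvol hKK₀ using hrefl
  have hr0 : 0 < r := by linarith
  have hr10 : 0 < r - 1 := by linarith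
  -- `t` is the conjugate exponent of `r`; the relation between `p`, `q` and `r` says that `1/t =
  -- 1/p + 1/q'`.
  set t := r / (r - 1) with ht_def
  have ht0 : 0 < t := by positivity
  have ht1 : 1 / t = 1 - 1 / r := by rw [ht_def]; field_simp
  have ht : 1 / t = 1 / p + (1 - 1 / q) := by rw [ht1, hr]; ring
  obtain ⟨D, hD, H⟩ := exists_weighted_testing hq hps hp ht0 ht hTb hK hTK hb hbdd hΛ hc₁ hC₀
  -- The median is taken over the reflected ball, where the output is tested, although it serves as
  -- the constant for the oscillation on the original ball.
  have hmed : ∀ (y : RSpace n) (l : ℝ), ∃ c : ℝ,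
      volume (Metric.closedBall (x₀ y l) l) ≤
        2 * volume (Metric.closedBall (x₀ y l) l ∩ {z | b z ≤ c}) ∧
      volume (Metric.closedBall (x₀ y l) l) ≤
        2 * volume (Metric.closedBall (x₀ y l) l ∩ {z | c ≤ b z}) := by
    intro y l
    have : IsFiniteMeasure (volume.restrict (Metric.closedBall (x₀ y l) l)) :=
      ⟨by rw [Measure.restrict_apply_univ]; exact measure_closedBall_lt_top⟩
    obtain ⟨c, h1, h2⟩ := exists_median (volume.restrict (Metric.closedBall (x₀ y l) l)) hb
    rw [Measure.restrict_apply_univ, Measure.restrict_apply (measurableSet_le hb measurable_const),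
      Set.inter_comm] at h1
    rw [Measure.restrict_apply_univ, Measure.restrict_apply (measurableSet_le measurable_const hb),
      Set.inter_comm] at h2
    exact ⟨c, h1, h2⟩
  choose c hc1 hc2 using hmed
  refine ⟨(2 * D) ^ r, c, ?_⟩
  intro ι _ y l E hl hEm hEs hdis hvol
  set B : ι → Set (RSpace n) := fun Q => Metric.closedBall (y Q) (l Q) with hB
  set Br : ι → Set (RSpace n) := fun Q => Metric.closedBall (x₀ (y Q) (l Q)) (l Q) with hBr
  set γ : ι → ℝ := fun Q => c (y Q) (l Q) with hγ
  have hBm : ∀ Q, MeasurableSet (B Q) := fun Q => Metric.isClosed_closedBall.measurableSet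
  have hBrm : ∀ Q, MeasurableSet (Br Q) := fun Q => Metric.isClosed_closedBall.measurableSet
  have hBfin : ∀ Q, volume (B Q) ≠ ∞ := fun Q => measure_closedBall_lt_top.ne
  have hBrfin : ∀ Q, volume (Br Q) ≠ ∞ := fun Q => measure_closedBall_lt_top.ne
  have hBBr : ∀ Q, volume.real (B Q) = volume.real (Br Q) := fun Q => by
    rw [Measure.real, Measure.real, hB, hBr]
    simp only
    rw [Measure.addHaar_closedBall_center volume (y Q),
      Measure.addHaar_closedBall_center volume (x₀ (y Q) (l Q))]
  set Flo : ι → Set (RSpace n) := fun Q => Br Q ∩ {z | b z ≤ γ Q} with hFlo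
  set Fhi : ι → Set (RSpace n) := fun Q => Br Q ∩ {z | γ Q ≤ b z} with hFhi
  have hlom : ∀ a : ℝ, MeasurableSet {z | b z ≤ a} := fun a => measurableSet_le hb measurable_const
  have him : ∀ a : ℝ, MeasurableSet {z | a ≤ b z} := fun a => measurableSet_le measurable_const hb
  have hltm : ∀ a : ℝ, MeasurableSet {z | b z < a} := fun a => measurableSet_lt hb measurable_const
  have habm : ∀ a : ℝ, MeasurableSet {z | |b z| ≤ a} := fun a =>
    measurableSet_le hb.abs measurable_const
  have hFreal : ∀ Q (S : Set (RSpace n)), S ⊆ Br Q → volume (Br Q) ≤ 2 * volume S →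
      volume.real (B Q) ≤ 2 * volume.real S := by
    intro Q S hS h
    rw [hBBr]
    have hSfin := ne_top_of_le_ne_top (hBrfin Q) (measure_mono hS)
    have := ENNReal.toReal_mono (ENNReal.mul_ne_top (by simp) hSfin) h
    simpa [Measure.real] using this
  have hFlo2 : ∀ Q, volume.real (B Q) ≤ 2 * volume.real (Flo Q) := fun Q =>
    hFreal Q _ Set.inter_subset_left (hc1 (y Q) (l Q))
  have hFhi2 : ∀ Q, volume.real (B Q) ≤ 2 * volume.real (Fhi Q) := fun Q =>
    hFreal Q _ Set.inter_subset_left (hc2 (y Q) (l Q))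
  -- the weighted estimate
  have hweighted : ∀ a : ι → ℝ, (∀ Q, 0 ≤ a Q) →
      ∑ Q, a Q * ∫ z in B Q, |b z - γ Q| ^ k ≤
        2 * D * (∑ Q, a Q ^ t * volume.real (E Q)) ^ (1 / t) := by
    intro a ha
    have hev : ∀ᶠ N : ℕ in atTop, ∑ Q, a Q * ∫ z in B Q ∩ {z | |b z| ≤ N}, |b z - γ Q| ^ k ≤
        2 * D * (∑ Q, a Q ^ t * volume.real (E Q)) ^ (1 / t) := by
      have e1 := eventually_all.2 fun Q => eventually_volume_truncation (b := b) (B Q) (hBfin Q)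
      have e2 := eventually_all.2 fun Q => eventually_volume_truncation (b := b) (Flo Q)
        (ne_top_of_le_ne_top (hBrfin Q) (measure_mono Set.inter_subset_left))
      have e3 := eventually_all.2 fun Q => eventually_volume_truncation (b := b) (Fhi Q)
        (ne_top_of_le_ne_top (hBrfin Q) (measure_mono Set.inter_subset_left))
      filter_upwards [e1, e2, e3] with N h1 h2 h3
      have hG4 : ∀ Q, volume.real (B Q) ≤ 4 * volume.real (B Q ∩ {z | |b z| ≤ (N : ℝ)}) := fun Q => by
        have := h1 Q
        have h0 : 0 ≤ volume.real (B Q ∩ {z | |b z| ≤ (N : ℝ)}) := by positivity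
        linarith
      -- Where `b ≥ γ`, the lower half of the reflected ball is used with `σ = 1`; in `hdown`, the
      -- part where `b < γ` meets the upper half with `σ = -1`. In both cases the median separates
      -- `b z` from `b x`.
      have hup := H y l E hl hEm hEs hdis hvol (fun Q => x₀ (y Q) (l Q)) (fun Q => K₀ (y Q) (l Q))
        (fun Q => hfar _ _ (hl Q)) (fun Q => hnear _ _ (hl Q)) (fun Q => hKvol _ _ (hl Q))
        (fun Q => hKK₀ _ _ (hl Q)) N (fun Q => B Q ∩ {z | |b z| ≤ N} ∩ {z | γ Q ≤ b z})
        (fun Q => B Q ∩ {z | |b z| ≤ N}) (fun Q => Flo Q ∩ {z | |b z| ≤ N})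
        (fun Q => ((hBm Q).inter (habm _)).inter (him _)) (fun Q => (hBm Q).inter (habm _))
        (fun Q => ((hBrm Q).inter (hlom _)).inter (habm _)) (fun Q => Set.inter_subset_left)
        (fun Q => le_rfl) (fun Q => Set.inter_subset_left.trans Set.inter_subset_left) hG4
        (fun Q => by have := h2 Q; have := hFlo2 Q; linarith) γ 1 (by simp)
        (fun Q x hx z hz => by
          have h4 : b x ≤ γ Q := hx.1.2
          have h5 : γ Q ≤ b z := hz.2
          rw [abs_of_nonneg (by linarith)]; linarith) a ha
      have hdown := H y l E hl hEm hEs hdis hvol (fun Q => x₀ (y Q) (l Q)) (fun Q => K₀ (y Q) (l Q))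
        (fun Q => hfar _ _ (hl Q)) (fun Q => hnear _ _ (hl Q)) (fun Q => hKvol _ _ (hl Q))
        (fun Q => hKK₀ _ _ (hl Q)) N (fun Q => B Q ∩ {z | |b z| ≤ N} ∩ {z | b z < γ Q})
        (fun Q => B Q ∩ {z | |b z| ≤ N}) (fun Q => Fhi Q ∩ {z | |b z| ≤ N})
        (fun Q => ((hBm Q).inter (habm _)).inter (hltm _)) (fun Q => (hBm Q).inter (habm _))
        (fun Q => ((hBrm Q).inter (him _)).inter (habm _)) (fun Q => Set.inter_subset_left)
        (fun Q => le_rfl) (fun Q => Set.inter_subset_left.trans Set.inter_subset_left) hG4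
        (fun Q => by have := h3 Q; have := hFhi2 Q; linarith) γ (-1) (by simp)
        (fun Q x hx z hz => by
          have h4 : γ Q ≤ b x := hx.1.2
          have h5 : b z < γ Q := hz.2
          rw [abs_of_neg (by linarith)]; linarith) a ha
      have hsplit : ∀ Q, ∫ z in B Q ∩ {z | |b z| ≤ N}, |b z - γ Q| ^ k =
          (∫ z in B Q ∩ {z | |b z| ≤ N} ∩ {z | γ Q ≤ b z}, |b z - γ Q| ^ k) +
          ∫ z in B Q ∩ {z | |b z| ≤ N} ∩ {z | b z < γ Q}, |b z - γ Q| ^ k := by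
        intro Q
        have hc : {z | b z < γ Q} = {z | γ Q ≤ b z}ᶜ := by ext z; simp
        rw [hc, ← Set.sdiff_eq, integral_inter_add_sdiff (him _)]
        exact (hloc _ _ _).mono_set Set.inter_subset_left
      calc _ = (∑ Q, a Q * ∫ z in B Q ∩ {z | |b z| ≤ N} ∩ {z | γ Q ≤ b z}, |b z - γ Q| ^ k) +
            ∑ Q, a Q * ∫ z in B Q ∩ {z | |b z| ≤ N} ∩ {z | b z < γ Q}, |b z - γ Q| ^ k := by
            rw [← Finset.sum_add_distrib]
            exact Finset.sum_congr rfl fun Q _ => by rw [hsplit Q, mul_add]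
        _ ≤ _ := by linarith
    -- The truncation height goes to infinity; the bound does not depend on it, and `|b - γ Q| ^ k`
    -- is integrable on each ball.
    refine le_of_tendsto (tendsto_finsetSum _ fun Q _ => Tendsto.const_mul _ ?_) hev
    have hmono : Monotone fun N : ℕ => B Q ∩ {z | |b z| ≤ (N : ℝ)} := fun i j hij z hz =>
      ⟨hz.1, le_trans (show |b z| ≤ (i : ℝ) from hz.2) (by exact_mod_cast hij)⟩
    have hU : ⋃ N : ℕ, B Q ∩ {z | |b z| ≤ (N : ℝ)} = B Q := by
      rw [← Set.inter_iUnion, Set.inter_eq_left]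
      intro z _
      exact Set.mem_iUnion.2 (exists_nat_ge |b z|)
    have := tendsto_setIntegral_of_monotone (μ := volume) (f := fun z => |b z - γ Q| ^ k)
      (fun N : ℕ => (hBm Q).inter (habm (N : ℝ))) hmono (by rw [hU]; exact hloc _ _ _)
    rwa [hU] at this
  -- the choice of the weights
  set o : ι → ℝ := fun Q => ⨍ z in B Q, |b z - γ Q| ^ k with ho
  have honn : ∀ Q, 0 ≤ o Q := fun Q => by
    simp only [ho]
    rw [setAverage_eq]
    exact smul_nonneg (by positivity) (integral_nonneg fun _ => by positivity)
  set X := ∑ Q, o Q ^ r * volume.real (E Q) with hX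
  have hXnn : 0 ≤ X := Finset.sum_nonneg fun Q _ =>
    mul_nonneg (Real.rpow_nonneg (honn Q) _) (by positivity)
  have hXle : X ≤ 2 * D * X ^ (1 / t) := by
    -- Because `(r - 1) * t = r`, this choice reproduces `X` on the right-hand side.
    have h1 := hweighted (fun Q => o Q ^ (r - 1)) fun Q => Real.rpow_nonneg (honn Q) _
    have h2 : ∀ Q, (o Q ^ (r - 1)) ^ t = o Q ^ r := fun Q => by
      rw [← Real.rpow_mul (honn Q)]; congr 1; rw [ht_def]; field_simp
    simp only [h2] at h1
    refine le_trans (Finset.sum_le_sum fun Q _ => ?_) h1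
    have hBpos : 0 < volume.real (B Q) :=
      ENNReal.toReal_pos (Metric.measure_closedBall_pos _ _ (hl Q)).ne' (hBfin Q)
    have h3 : ∫ z in B Q, |b z - γ Q| ^ k = o Q * volume.real (B Q) := by
      simp only [ho]
      rw [setAverage_eq, smul_eq_mul]
      field_simp
    have h4 : o Q ^ r = o Q ^ (r - 1) * o Q := by
      rcases (honn Q).eq_or_lt with h0 | h0
      · rw [← h0, Real.zero_rpow hr0.ne', mul_zero]
      · rw [Real.rpow_sub_one h0.ne']; field_simp
    rw [h3, h4, mul_assoc]
    refine mul_le_mul_of_nonneg_left ?_ (Real.rpow_nonneg (honn Q) _)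
    exact mul_le_mul_of_nonneg_left (measureReal_mono (hEs Q) (hBfin Q)) (honn Q)
  change X ≤ (2 * D) ^ r
  -- `X` is a finite sum of real numbers, so `X ^ (1 / t)` can be cancelled unless it vanishes.
  rcases hXnn.eq_or_lt with h0 | h0
  · rw [← h0]; positivity
  · have h1 : X ^ (1 / r) ≤ 2 * D := by
      have h2 : X ^ (1 / r) * X ^ (1 / t) ≤ 2 * D * X ^ (1 / t) := by
        rw [← Real.rpow_add h0, show 1 / r + 1 / t = 1 by rw [ht1]; ring, Real.rpow_one]; exact hXle
      exact le_of_mul_le_mul_right h2 (by positivity)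
    calc X = (X ^ (1 / r)) ^ r := by
          rw [← Real.rpow_mul hXnn, one_div_mul_cancel hr0.ne', Real.rpow_one]
      _ ≤ _ := by gcongr

end

/-! ### Bounds for dyadic averages and passage to the limit -/

section

variable {n m : ℕ}

/-- The ratio of the volume of the ball of radius `gridRadius n L j` to that of the cube. -/
def gridRatio (n : ℕ) : ℝ := √n ^ n * volume.real (Metric.closedBall (0 : RSpace n) 1)

theorem gridRatio_pos (hn : 0 < n) : 0 < gridRatio n := by
  have h0 : (0 : ℝ) < n := by exact_mod_cast hn
  have h1 : 0 < volume.real (Metric.closedBall (0 : RSpace n) 1) :=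
    ENNReal.toReal_pos (Metric.measure_closedBall_pos _ _ one_pos).ne' measure_closedBall_lt_top.ne
  unfold gridRatio
  positivity

theorem volume_closedBall_eq_gridRatio_mul {L : ℝ} (hL : 0 < L) (j : ℕ) (κ : Fin n → ℤ)
    (y : RSpace n) : volume (Metric.closedBall y (gridRadius n L j)) =
      ENNReal.ofReal (gridRatio n) * volume (gridCube L j κ) := by
  rw [volume_closedBall_gridRadius hL j κ y, gridRatio, ENNReal.ofReal_mul (by positivity),
    Measure.real, ENNReal.ofReal_toReal measure_closedBall_lt_top.ne]

theorem setAverage_gridCube_le (hn : 0 < n) {L : ℝ} (hL : 0 < L) (j : ℕ) (κ : Fin n → ℤ)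
    {g : RSpace n → ℝ} (hg : ∀ x, 0 ≤ g x)
    (hgi : IntegrableOn g (Metric.closedBall (gridCorner L j κ) (gridRadius n L j))) :
    ⨍ z in gridCube L j κ, g z ≤
      gridRatio n * ⨍ z in Metric.closedBall (gridCorner L j κ) (gridRadius n L j), g z := by
  have hκ := gridRatio_pos hn
  have hV : volume.real (Metric.closedBall (gridCorner L j κ) (gridRadius n L j)) =
      gridRatio n * volume.real (gridCube L j κ) := by
    rw [Measure.real, volume_closedBall_eq_gridRatio_mul hL j κ, ENNReal.toReal_mul,
      ENNReal.toReal_ofReal hκ.le, Measure.real]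
  have hc : 0 < volume.real (gridCube L j κ) :=
    ENNReal.toReal_pos (volume_gridCube_pos hL j κ).ne' (volume_gridCube_lt_top hL j κ).ne
  rw [setAverage_eq, setAverage_eq, hV, smul_eq_mul, smul_eq_mul, mul_inv, ← mul_assoc,
    ← mul_assoc, mul_inv_cancel₀ hκ.ne', one_mul]
  refine mul_le_mul_of_nonneg_left ?_ (by positivity)
  exact setIntegral_mono_set hgi (Eventually.of_forall hg)
    (gridCube_subset_closedBall hL j κ).eventuallyLE

/-- A testing bound over sparse families of balls bounds the dyadic averages in `L^{kr}`. -/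
theorem exists_lintegral_average_le (hn : 0 < n) {k : ℕ} (hk : 1 ≤ k) {r : ℝ} (hr1 : 1 < r)
    {b : RSpace n → ℝ} (hb : Measurable b)
    (hloc : ∀ t y l, IntegrableOn (fun z => |b z - t| ^ k) (Metric.closedBall y l))
    {W : ℝ} {c : RSpace n → ℝ → ℝ}
    (H : ∀ {ι : Type} [Fintype ι] (y : ι → RSpace n) (l : ι → ℝ)
      (E : ι → Set (RSpace n)), (∀ Q, 0 < l Q) → (∀ Q, MeasurableSet (E Q)) →
      (∀ Q, E Q ⊆ Metric.closedBall (y Q) (l Q)) → Pairwise (Function.onFun Disjoint E) →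
      (∀ Q, volume (Metric.closedBall (y Q) (l Q)) ≤
        ENNReal.ofReal (2 * gridRatio n) * volume (E Q)) →
      ∑ Q, (⨍ z in Metric.closedBall (y Q) (l Q), |b z - c (y Q) (l Q)| ^ k) ^ r *
        volume.real (E Q) ≤ W) :
    ∃ V : ℝ≥0∞, V ≠ ∞ ∧ ∀ L : ℝ, 0 < L → ∃ t : ℝ, ∀ N : ℕ,
      ∫⁻ x in gridCube L 0 0,
        ‖(⨍ y in gridCube L N (gridMap L N x), b y) - t‖ₑ ^ (k * r) ≤ V := by
  have hκ := gridRatio_pos hn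
  have hk0 : (1 : ℝ) ≤ k := by exact_mod_cast hk
  have hu : 1 < (k : ℝ) * r := by nlinarith
  have hu0 : 0 ≤ (k : ℝ) * r := by linarith
  obtain ⟨C, hC, hballs⟩ := lintegral_sum_balls_rpow_le (n := n) hu (C₀ := 2 * gridRatio n)
    (by positivity)
  set A : ℝ := 1 + (2 * 2 ^ n) ^ (1 / k : ℝ) with hA
  -- The bound involves neither `L` nor `N`; both limits later rely on this.
  refine ⟨ENNReal.ofReal A ^ (k * r) * (ENNReal.ofReal C * ENNReal.ofReal (gridRatio n ^ r * W)),
    ENNReal.mul_ne_top (ENNReal.rpow_ne_top_of_nonneg hu0 ENNReal.ofReal_ne_top)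
      (ENNReal.mul_ne_top ENNReal.ofReal_ne_top ENNReal.ofReal_ne_top), ?_⟩
  intro L hL
  -- Sparse domination allows any constants on the cubes; those taken here are the ones `H` attaches
  -- to the balls that contain the cubes.
  set cI : ℕ × (Fin n → ℤ) → ℝ := fun I => c (gridCorner L I.1 I.2) (gridRadius n L I.1) with hcI
  set B : ℕ × (Fin n → ℤ) → Set (RSpace n) := fun I =>
    Metric.closedBall (gridCorner L I.1 I.2) (gridRadius n L I.1) with hB
  refine ⟨cI (0, 0), fun N => ?_⟩
  have hcube : ∀ t j κ, IntegrableOn (fun y => |b y - t| ^ k) (gridCube L j κ) := fun t j κ =>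
    (hloc _ _ _).mono_set (gridCube_subset_closedBall hL j κ)
  obtain ⟨S, E, hEm, hEs, hdis, hEv, hdom⟩ := exists_sparse_domination hL hk hb hcube cI N
  set o : ℕ × (Fin n → ℤ) → ℝ := fun I => ⨍ z in B I, |b z - cI I| ^ k with ho
  have honn : ∀ I, 0 ≤ o I := fun I => by
    simp only [ho]
    rw [setAverage_eq]
    exact smul_nonneg (by positivity) (integral_nonneg fun _ => by positivity)
  have hEB : ∀ I, E I ⊆ B I := fun I => (hEs I).trans (gridCube_subset_closedBall hL _ _)
  have hBv : ∀ I ∈ S, volume (B I) ≤ ENNReal.ofReal (2 * gridRatio n) * volume (E I) := by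
    intro I hI
    rw [hB, volume_closedBall_eq_gridRatio_mul hL I.1 I.2, mul_comm 2,
      ENNReal.ofReal_mul hκ.le, mul_assoc, ENNReal.ofReal_ofNat]
    gcongr
    exact hEv I hI
  have hEfin : ∀ I, volume (E I) ≠ ∞ := fun I =>
    ne_top_of_le_ne_top measure_closedBall_lt_top.ne (measure_mono (hEB I))
  have h1 : ∑ I ∈ S, o I ^ r * volume.real (E I) ≤ W := by
    have := H (ι := S) (fun I => gridCorner L I.1.1 I.1.2) (fun I => gridRadius n L I.1.1)
      (fun I => E I.1) (fun I => gridRadius_pos hn hL _) (fun I => hEm _) (fun I => hEB _)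
      (fun I J hIJ => hdis fun h => hIJ (Subtype.ext h)) (fun I => hBv _ I.2)
    rwa [Finset.sum_coe_sort S (fun I => o I ^ r * volume.real (E I))] at this
  -- The root `1 / k` matches the sparse domination, and the power `k * r` turns it into `o ^ r`,
  -- the quantity in the testing bound. `gridRatio n` pays for passing from cube averages to ball
  -- averages.
  set α : ℕ × (Fin n → ℤ) → ℝ≥0 := fun I => ((gridRatio n * o I) ^ (1 / k : ℝ)).toNNReal with hα
  have hαu : ∀ I, (α I : ℝ≥0∞) ^ (k * r) = ENNReal.ofReal (gridRatio n ^ r * o I ^ r) := by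
    intro I
    have h0 : 0 ≤ gridRatio n * o I := mul_nonneg hκ.le (honn I)
    change ENNReal.ofReal _ ^ (k * r) = _
    rw [ENNReal.ofReal_rpow_of_nonneg (Real.rpow_nonneg h0 _) hu0, ← Real.rpow_mul h0,
      ← Real.mul_rpow hκ.le (honn I)]
    congr 2
    field_simp
  have h2 := hballs S (fun I => gridCorner L I.1 I.2) (fun I => gridRadius n L I.1) E α
    (fun I _ => gridRadius_pos hn hL _) (fun I _ => hEm I) (fun I _ => hEB I)
    (fun I _ J _ h => hdis h) hBv
  have h3 : ∑ I ∈ S, (α I : ℝ≥0∞) ^ (k * r) * volume (E I) ≤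
      ENNReal.ofReal (gridRatio n ^ r * W) := by
    have e : ∀ I ∈ S, (α I : ℝ≥0∞) ^ (k * r) * volume (E I) =
        ENNReal.ofReal (gridRatio n ^ r * (o I ^ r * volume.real (E I))) := by
      intro I _
      rw [hαu, ← mul_assoc,
        ENNReal.ofReal_mul (p := gridRatio n ^ r * o I ^ r) (by have := honn I; positivity),
        Measure.real, ENNReal.ofReal_toReal (hEfin I)]
    rw [Finset.sum_congr rfl e, ← ENNReal.ofReal_sum_of_nonneg (fun I _ => by
      have := honn I; positivity), ← Finset.mul_sum]
    exact ENNReal.ofReal_le_ofReal (by gcongr)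
  have h4 : ∀ x ∈ gridCube L 0 0,
      ‖(⨍ y in gridCube L N (gridMap L N x), b y) - cI (0, 0)‖ₑ ^ (k * r) ≤
        ENNReal.ofReal A ^ (k * r) *
          (∑ I ∈ S, (B I).indicator (fun _ => (α I : ℝ≥0∞)) x) ^ (k * r) := by
    intro x hx
    rw [← ENNReal.mul_rpow_of_nonneg _ _ hu0]
    refine ENNReal.rpow_le_rpow ?_ hu0
    rw [← ofReal_norm, Real.norm_eq_abs]
    refine (ENNReal.ofReal_le_ofReal (hdom x hx)).trans ?_
    rw [ENNReal.ofReal_mul (by positivity)]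
    gcongr
    have hnn : ∀ I, 0 ≤ (⨍ y in gridCube L I.1 I.2, |b y - cI I| ^ k) := fun I => by
      rw [setAverage_eq]
      exact smul_nonneg (by positivity) (integral_nonneg fun _ => by positivity)
    rw [ENNReal.ofReal_sum_of_nonneg fun I _ =>
      Set.indicator_nonneg (fun _ _ => Real.rpow_nonneg (hnn I) _) _]
    refine Finset.sum_le_sum fun I _ => ?_
    by_cases hxI : x ∈ gridCube L I.1 I.2
    · rw [Set.indicator_of_mem hxI,
        Set.indicator_of_mem (gridCube_subset_closedBall hL I.1 I.2 hxI : x ∈ B I)]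
      change _ ≤ ENNReal.ofReal _
      refine ENNReal.ofReal_le_ofReal (Real.rpow_le_rpow (hnn I) ?_ (by positivity))
      exact setAverage_gridCube_le hn hL _ _ (fun _ => by positivity) (hloc _ _ _)
    · rw [Set.indicator_of_notMem hxI, ENNReal.ofReal_zero]
      exact zero_le
  calc _ ≤ ∫⁻ x in gridCube L 0 0, ENNReal.ofReal A ^ (k * r) *
          (∑ I ∈ S, (B I).indicator (fun _ => (α I : ℝ≥0∞)) x) ^ (k * r) :=
        setLIntegral_mono' (measurableSet_gridCube _ _ _) h4
    _ ≤ ∫⁻ x, ENNReal.ofReal A ^ (k * r) *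
          (∑ I ∈ S, (B I).indicator (fun _ => (α I : ℝ≥0∞)) x) ^ (k * r) :=
        setLIntegral_le_lintegral _ _
    _ = ENNReal.ofReal A ^ (k * r) *
          ∫⁻ x, (∑ I ∈ S, (B I).indicator (fun _ => (α I : ℝ≥0∞)) x) ^ (k * r) :=
        lintegral_const_mul' _ _ (ENNReal.rpow_ne_top_of_nonneg hu0 ENNReal.ofReal_ne_top)
    _ ≤ _ := by
        gcongr
        exact h2.trans (by gcongr)

/-- Lebesgue differentiation along the balls around the cube corners, which contain `x` without
being centred there. The cubes fill a fixed proportion of these balls, so averages of `|b - b x|`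
over the cubes tend to zero as well. -/
theorem ae_tendsto_gridCube_average (hn : 0 < n) {L : ℝ} (hL : 0 < L) {b : RSpace n → ℝ}
    (hb : LocallyIntegrable b volume) :
    ∀ᵐ x ∂(volume : Measure (RSpace n)),
      Tendsto (fun N => ⨍ y in gridCube L N (gridMap L N x), b y) atTop (𝓝 (b x)) := by
  have hδ0 : Tendsto (fun j : ℕ => gridRadius n L j) atTop (𝓝 0) := by
    have h : Tendsto (fun j : ℕ => (√n * L) * (2⁻¹ : ℝ) ^ j) atTop (𝓝 ((√n * L) * 0)) :=
      (tendsto_pow_atTop_nhds_zero_of_lt_one (by norm_num) (by norm_num)).const_mul _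
    rw [mul_zero] at h
    refine h.congr fun j => ?_
    rw [gridRadius, inv_pow]; ring
  have hδ : Tendsto (fun j : ℕ => gridRadius n L j) atTop (𝓝[>] 0) :=
    tendsto_nhdsWithin_iff.2 ⟨hδ0, Eventually.of_forall fun j => gridRadius_pos hn hL j⟩
  have hint : ∀ y l, IntegrableOn b (Metric.closedBall y l) := fun y l =>
    hb.integrableOn_isCompact (isCompact_closedBall y l)
  filter_upwards [IsUnifLocDoublingMeasure.ae_tendsto_average_norm_sub volume hb 1] with x hx
  have h1 := hx (fun j => gridCorner L j (gridMap L j x)) (fun j => gridRadius n L j) hδ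
    (Eventually.of_forall fun j => by
      rw [one_mul]; exact gridCube_subset_closedBall hL j _ rfl)
  have h2 := h1.const_mul (gridRatio n)
  rw [mul_zero] at h2
  rw [tendsto_iff_norm_sub_tendsto_zero]
  refine squeeze_zero (fun _ => norm_nonneg _) (fun j => ?_) h2
  have hQfin := (volume_gridCube_lt_top hL j (gridMap L j x)).ne
  have hQpos := (volume_gridCube_pos hL j (gridMap L j x)).ne'
  have hQr : 0 < volume.real (gridCube L j (gridMap L j x)) := ENNReal.toReal_pos hQpos hQfin
  have hi : IntegrableOn (fun y => b y - b x)
      (Metric.closedBall (gridCorner L j (gridMap L j x)) (gridRadius n L j)) :=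
    (hint _ _).sub (integrableOn_const measure_closedBall_lt_top.ne)
  have e : (⨍ y in gridCube L j (gridMap L j x), b y) - b x =
      ⨍ y in gridCube L j (gridMap L j x), (b y - b x) := by
    rw [setAverage_eq, setAverage_eq, integral_sub
      ((hint _ _).mono_set (gridCube_subset_closedBall hL j _)) (integrableOn_const hQfin),
      setIntegral_const, smul_sub, smul_smul,
      inv_mul_cancel₀ hQr.ne', one_smul]
  rw [e]
  refine le_trans ?_ (setAverage_gridCube_le hn hL j _ (fun _ => norm_nonneg _) hi.norm)
  rw [setAverage_eq, setAverage_eq, norm_smul, Real.norm_of_nonneg (by positivity), smul_eq_mul]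
  exact mul_le_mul_of_nonneg_left (norm_integral_le_integral_norm _) (by positivity)

/-- Fatou's lemma in `N`, using the a.e. convergence of the dyadic averages. -/
theorem setLIntegral_sub_rpow_le_of_average (hn : 0 < n) {L : ℝ} (hL : 0 < L)
    {b : RSpace n → ℝ} (hb : LocallyIntegrable b volume) {u t : ℝ} {V : ℝ≥0∞}
    (h : ∀ N : ℕ, ∫⁻ x in gridCube L 0 0,
      ‖(⨍ y in gridCube L N (gridMap L N x), b y) - t‖ₑ ^ u ≤ V) :
    ∫⁻ x in gridCube L 0 0, ‖b x - t‖ₑ ^ u ≤ V := by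
  have hmeas : ∀ N : ℕ, Measurable fun x : RSpace n =>
      ‖(⨍ y in gridCube L N (gridMap L N x), b y) - t‖ₑ ^ u := fun N =>
    (measurable_of_countable fun κ : Fin n → ℤ =>
      ‖(⨍ y in gridCube L N κ, b y) - t‖ₑ ^ u).comp (measurable_gridMap L N)
  calc _ = ∫⁻ x in gridCube L 0 0, liminf (fun N : ℕ =>
        ‖(⨍ y in gridCube L N (gridMap L N x), b y) - t‖ₑ ^ u) atTop := by
        refine lintegral_congr_ae (ae_restrict_of_ae ?_)
        filter_upwards [ae_tendsto_gridCube_average hn hL hb] with x hx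
        refine (Tendsto.liminf_eq ?_).symm
        exact ((ENNReal.continuous_rpow_const.tendsto _).comp
          ((continuous_enorm.tendsto _).comp (hx.sub_const t)))
    _ ≤ liminf (fun N : ℕ => ∫⁻ x in gridCube L 0 0,
        ‖(⨍ y in gridCube L N (gridMap L N x), b y) - t‖ₑ ^ u) atTop := lintegral_liminf_le hmeas
    _ ≤ V := by
        refine liminf_le_of_le (by isBoundedDefault) fun a ha => ?_
        obtain ⟨N, hN⟩ := ha.exists
        exact hN.trans (h N)

theorem ball_subset_gridCube {R L : ℝ} (hL : 0 < L) (hRL : 2 * R ≤ L) :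
    Metric.ball (0 : RSpace n) R ⊆ gridCube L 0 0 := by
  intro x hx
  rw [mem_gridCube_iff hL]
  intro i
  have h1 : |x i| < R := by
    have := PiLp.norm_apply_le x i
    rw [Real.norm_eq_abs] at this
    rw [mem_ball_zero_iff] at hx
    linarith
  rw [abs_lt] at h1
  simp only [gridCorner, Pi.zero_apply, Int.cast_zero, pow_zero]
  constructor <;> linarith

/-- Constants approximating `b` on balls, with a uniform bound, converge along a subsequence. -/
theorem exists_lintegral_sub_rpow_le {b : RSpace n → ℝ} (hb : Measurable b) {u : ℝ} (hu : 1 ≤ u)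
    {V : ℝ≥0∞} (hV : V ≠ ∞)
    (h : ∀ R : ℝ, ∃ t : ℝ, ∫⁻ x in Metric.ball 0 R, ‖b x - t‖ₑ ^ u ≤ V) :
    ∃ t : ℝ, ∫⁻ x, ‖b x - t‖ₑ ^ u ≤ V := by
  have hu0 : 0 < u := by linarith
  choose t ht using h
  have hm : ∀ c : ℝ, Measurable fun x => ‖b x - c‖ₑ ^ u := fun c => by fun_prop
  set v := volume (Metric.ball (0 : RSpace n) 1) with hv
  have hvpos : v ≠ 0 := (Metric.measure_ball_pos _ _ one_pos).ne'
  set M : ℝ≥0∞ := (2 ^ (u - 1) * (V + V) / v) ^ (1 / u) with hM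
  have hMtop : M ≠ ∞ := ENNReal.rpow_ne_top_of_nonneg (by positivity)
    (ENNReal.div_ne_top (ENNReal.mul_ne_top
      (ENNReal.rpow_ne_top_of_nonneg (by linarith) (by simp)) (by simp [hV])) hvpos)
  -- The constants are compared on the unit ball, which lies in the ball of radius `N + 1`; both
  -- approximate `b` there in `L^u` with bound `V`, and `M` comes from the resulting triangle
  -- inequality.
  have hbd : ∀ N : ℕ, t (N + 1) ∈ Metric.closedBall (t 1) M.toReal := by
    intro N
    have h1 : ∫⁻ x in Metric.ball 0 1, ‖b x - t (N + 1)‖ₑ ^ u ≤ V :=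
      (lintegral_mono_set (Metric.ball_subset_ball (by
        have : (0 : ℝ) ≤ N := by positivity
        linarith))).trans (ht (N + 1))
    have h2 : ‖t (N + 1) - t 1‖ₑ ^ u * v ≤ 2 ^ (u - 1) * (V + V) := by
      calc _ = ∫⁻ x in Metric.ball (0 : RSpace n) 1, ‖t (N + 1) - t 1‖ₑ ^ u := by
            rw [setLIntegral_const]
        _ ≤ ∫⁻ x in Metric.ball (0 : RSpace n) 1,
            2 ^ (u - 1) * (‖b x - t 1‖ₑ ^ u + ‖b x - t (N + 1)‖ₑ ^ u) := by
            refine lintegral_mono fun x => ?_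
            refine le_trans ?_ (ENNReal.rpow_add_le_mul_rpow_add_rpow _ _ hu)
            refine ENNReal.rpow_le_rpow ?_ hu0.le
            have e : t (N + 1) - t 1 = (b x - t 1) - (b x - t (N + 1)) := by ring
            rw [e]
            exact enorm_sub_le
        _ = 2 ^ (u - 1) * ((∫⁻ x in Metric.ball (0 : RSpace n) 1, ‖b x - t 1‖ₑ ^ u) +
            ∫⁻ x in Metric.ball (0 : RSpace n) 1, ‖b x - t (N + 1)‖ₑ ^ u) := by
            rw [← lintegral_add_left (hm _)]
            exact lintegral_const_mul _ ((hm _).add (hm _))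
        _ ≤ _ := by gcongr; exact ht 1
    have h3 : ‖t (N + 1) - t 1‖ₑ ≤ M := by
      rw [hM, one_div, ENNReal.le_rpow_inv_iff hu0, ENNReal.le_div_iff_mul_le (Or.inl hvpos)
        (Or.inl measure_ball_lt_top.ne)]
      exact h2
    rw [Metric.mem_closedBall, Real.dist_eq, ← Real.norm_eq_abs, ← toReal_enorm]
    exact ENNReal.toReal_mono hMtop h3
  -- Bolzano–Weierstrass provides the limiting constant; Fatou along this subsequence, with
  -- indicators of growing balls, carries the bound to the whole space.
  obtain ⟨a, -, φ, hφ, hlim⟩ := tendsto_subseq_of_bounded Metric.isBounded_closedBall hbd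
  refine ⟨a, ?_⟩
  calc _ = ∫⁻ x, liminf (fun N : ℕ => (Metric.ball (0 : RSpace n) ((φ N : ℝ) + 1)).indicator
        (fun x => ‖b x - t (φ N + 1)‖ₑ ^ u) x) atTop := by
        refine lintegral_congr fun x => ?_
        refine (Tendsto.liminf_eq ?_).symm
        have h1 : Tendsto (fun N : ℕ => ‖b x - t (φ N + 1)‖ₑ ^ u) atTop (𝓝 (‖b x - a‖ₑ ^ u)) :=
          (ENNReal.continuous_rpow_const.tendsto _).comp
            ((continuous_enorm.tendsto _).comp (hlim.const_sub (b x)))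
        refine h1.congr' ?_
        filter_upwards [hφ.tendsto_atTop.eventually_ge_atTop ⌈‖x‖⌉₊] with N hN
        rw [Set.indicator_of_mem]
        rw [mem_ball_zero_iff]
        have : ‖x‖ ≤ φ N := (Nat.le_ceil _).trans (by exact_mod_cast hN)
        linarith
    _ ≤ liminf (fun N : ℕ => ∫⁻ x, (Metric.ball (0 : RSpace n) ((φ N : ℝ) + 1)).indicator
        (fun x => ‖b x - t (φ N + 1)‖ₑ ^ u) x) atTop :=
        lintegral_liminf_le fun N => (hm _).indicator measurableSet_ball
    _ ≤ V := by
        refine liminf_le_of_le (by isBoundedDefault) fun c hc => ?_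
        obtain ⟨N, hN⟩ := hc.exists
        rw [lintegral_indicator measurableSet_ball] at hN
        exact hN.trans (ht _)

/-! ### Almost everywhere equality and the conclusion -/

theorem lpClass_congr_ae {u : ℝ≥0∞} {f g : RSpace n → ℂ} (h : f =ᵐ[volume] g) :
    lpClass u f = lpClass u g := by
  by_cases hf : MemLp f u volume
  · have hg : MemLp g u volume := (memLp_congr_ae h).1 hf
    rw [lpClass, lpClass, dif_pos hf, dif_pos hg]
    exact MemLp.toLp_congr hf hg h
  · have hg : ¬ MemLp g u volume := fun hg => hf ((memLp_congr_ae h).2 hg)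
    rw [lpClass, lpClass, dif_neg hf, dif_neg hg]

/-- The operator only sees classes, and the outer multiplications by `b` change on null sets only.
This permits replacing `b` by a Borel representative. -/
theorem iteratedCommutator_congr_ae {s : Fin m → ℝ≥0∞} {s₀ : ℝ≥0∞} (T : LpMultilinear n m s s₀)
    {b b' : RSpace n → ℝ} (hbb : b =ᵐ[volume] b') (i : Fin m) (k : ℕ) :
    ∀ {f f' : Fin m → RSpace n → ℂ}, (∀ l, f l =ᵐ[volume] f' l) →
      iteratedCommutator b i k T.onFunctions f =ᵐ[volume]
        iteratedCommutator b' i k T.onFunctions f' := by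
  induction k with
  | zero =>
    intro f f' h
    have : (fun l => lpClass (s l) (f l)) = fun l => lpClass (s l) (f' l) :=
      funext fun l => lpClass_congr_ae (h l)
    simp only [iteratedCommutator, LpMultilinear.onFunctions, this]
    rfl
  | succ k ih =>
    intro f f' h
    have h2 : ∀ l, Function.update f i (fun z => (b z : ℂ) * f i z) l =ᵐ[volume]
        Function.update f' i (fun z => (b' z : ℂ) * f' i z) l := by
      intro l
      by_cases hl : l = i
      · subst hl
        simp only [Function.update_self]
        filter_upwards [hbb, h l] with z h1 h2
        rw [h1, h2]
      · simp only [Function.update_of_ne hl]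
        exact h l
    filter_upwards [hbb, ih h, ih h2] with x e1 e2 e3
    simp only [iteratedCommutator, slotCommutator, e1, e2, e3]

theorem IsBoundedOnDomain.congr_ae {s p : Fin m → ℝ≥0∞} {s₀ q : ℝ≥0∞}
    {T : LpMultilinear n m s s₀} {b b' : RSpace n → ℝ} (hbb : b =ᵐ[volume] b') {i : Fin m} {k : ℕ}
    (h : IsBoundedOnDomain (commutatorDomain s p b i k) (iteratedCommutator b i k T.onFunctions)
      p q) :
    IsBoundedOnDomain (commutatorDomain s p b' i k) (iteratedCommutator b' i k T.onFunctions)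
      p q := by
  obtain ⟨C, hC⟩ := h
  refine ⟨C, fun f hf => ?_⟩
  rw [← eLpNorm_congr_ae (iteratedCommutator_congr_ae T hbb i k fun l => EventuallyEq.rfl)]
  refine hC f ⟨hf.1, hf.2.1, fun j hj => (memLp_congr_ae ?_).2 (hf.2.2 j hj)⟩
  filter_upwards [hbb] with z hz
  rw [hz]

theorem MemLpLoc.aestronglyMeasurable {u : ℝ≥0∞} {b : RSpace n → ℝ} (hb : MemLpLoc u b) :
    AEStronglyMeasurable b volume := by
  have h := (aestronglyMeasurable_iUnion_iff (μ := volume) (f := b)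
    (s := fun N : ℕ => Metric.ball (0 : RSpace n) N)).2 fun N => (hb 0 N).1
  rwa [Metric.iUnion_ball_nat, Measure.restrict_univ] at h

theorem MemLpLoc.congr_ae {u : ℝ≥0∞} {b b' : RSpace n → ℝ} (hb : MemLpLoc u b)
    (hbb : b =ᵐ[volume] b') : MemLpLoc u b' := fun z R =>
  (memLp_congr_ae (ae_restrict_of_ae hbb)).1 (hb z R)

theorem MemLpModConst.congr_ae {u : ℝ≥0∞} {b b' : RSpace n → ℝ} (hb : MemLpModConst u b)
    (hbb : b =ᵐ[volume] b') : MemLpModConst u b' := by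
  refine ⟨hb.1.congr_ae hbb, ?_⟩
  convert hb.2 using 3 with c
  refine eLpNorm_congr_ae ?_
  filter_upwards [hbb] with z hz
  rw [hz]

theorem MemLpLoc.integrableOn_abs_sub_pow {k : ℕ} (hk : 1 ≤ k) {b : RSpace n → ℝ}
    (hb : MemLpLoc (k : ℝ≥0∞) b) (t : ℝ) (y : RSpace n) (l : ℝ) :
    IntegrableOn (fun z => |b z - t| ^ k) (Metric.closedBall y l) := by
  have : IsFiniteMeasure (volume.restrict (Metric.ball y (l + 1))) := ⟨by
    rw [Measure.restrict_apply_univ]; exact measure_ball_lt_top⟩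
  have h := ((hb y (l + 1)).sub (memLp_const t)).integrable_norm_pow (by omega)
  exact IntegrableOn.mono_set (s := Metric.closedBall y l) (t := Metric.ball y (l + 1)) h
    (Metric.closedBall_subset_ball (by linarith))

theorem MemLpLoc.locallyIntegrable {k : ℕ} (hk : 1 ≤ k) {b : RSpace n → ℝ}
    (hb : MemLpLoc (k : ℝ≥0∞) b) : LocallyIntegrable b volume := by
  intro x
  refine ⟨Metric.ball x 1, Metric.ball_mem_nhds x one_pos, ?_⟩
  have : IsFiniteMeasure (volume.restrict (Metric.ball x 1)) := ⟨by
    rw [Measure.restrict_apply_univ]; exact measure_ball_lt_top⟩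
  exact (hb x 1).integrable (by exact_mod_cast hk)

theorem memLpModConst_of_memLp_sub {u : ℝ≥0∞} {b : RSpace n → ℝ} {t : ℝ}
    (h : MemLp (fun x => b x - t) u volume) : MemLpModConst u b := by
  refine ⟨fun z R => ?_, (iInf_le _ t).trans_lt h.2⟩
  have : IsFiniteMeasure (volume.restrict (Metric.ball z R)) := ⟨by
    rw [Measure.restrict_apply_univ]; exact measure_ball_lt_top⟩
  have h1 := (h.restrict (Metric.ball z R)).add (memLp_const t)
  convert h1 using 1
  ext x
  simp

theorem memLpModConst_of_measurable [NeZero m] (hn : 0 < n) (hm : 2 ≤ m) {k : ℕ} (hk : 1 ≤ k)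
    {p q r : ℝ} {ps : Fin m → ℝ} (hq : 1 < q) (hps : ∀ i, 1 < ps i)
    (hp : 1 / p = ∑ i, 1 / ps i) (hr1 : 1 < r) (hr : 1 / r = 1 / q - 1 / p)
    {s : Fin m → ℝ≥0∞} {s₀ : ℝ≥0∞} {T : LpMultilinear n m s s₀} (hT : IsNondegenerateCZO T)
    {b : RSpace n → ℝ} (hbm : Measurable b) (hb : MemLpLoc (k : ℝ≥0∞) b)
    (hbdd : IsBoundedOnDomain (commutatorDomain s (fun i => ENNReal.ofReal (ps i)) b 0 k)
      (iteratedCommutator b 0 k T.onFunctions)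
      (fun i => ENNReal.ofReal (ps i)) (ENNReal.ofReal q)) :
    MemLpModConst (ENNReal.ofReal (k * r)) b := by
  have hκ := gridRatio_pos hn
  have hk0 : (1 : ℝ) ≤ k := by exact_mod_cast hk
  have hu : 1 < (k : ℝ) * r := by nlinarith
  have hloc := fun t y l => hb.integrableOn_abs_sub_pow hk t y l
  obtain ⟨W, c, H⟩ := exists_testing_bound hn hm hq hps hp hr1 hr hT hbm hloc hbdd
    (C₀ := 2 * gridRatio n) (by positivity)
  obtain ⟨V, hV, hav⟩ := exists_lintegral_average_le hn hk hr1 hbm hloc H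
  obtain ⟨t, ht⟩ := exists_lintegral_sub_rpow_le hbm hu.le hV fun R => by
    have hL : 0 < 2 * |R| + 1 := by positivity
    obtain ⟨t, ht⟩ := hav (2 * |R| + 1) hL
    refine ⟨t, (lintegral_mono_set (ball_subset_gridCube hL ?_)).trans
      (setLIntegral_sub_rpow_le_of_average hn hL (hb.locallyIntegrable hk) ht)⟩
    linarith [le_abs_self R]
  refine memLpModConst_of_memLp_sub (t := t)
    ⟨(hbm.sub_const t).aestronglyMeasurable, ?_⟩
  rw [eLpNorm_lt_top_iff_lintegral_rpow_enorm_lt_top 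
    (ENNReal.ofReal_pos.2 (by linarith)).ne' ENNReal.ofReal_ne_top, ENNReal.toReal_ofReal (by linarith)]
  exact ht.trans_lt hV.lt_top

/-- In dimension zero the space is one point, and no point lies outside a ball of radius one. -/
theorem IsNondegenerateKernel.dim_pos {K : RSpace n → (Fin m → RSpace n) → ℂ}
    (hK : IsNondegenerateKernel K) : 0 < n := by
  rcases Nat.eq_zero_or_pos n with rfl | h
  · obtain ⟨c, -, h⟩ := hK
    obtain ⟨x, hx, -⟩ := h 0 1 one_pos
    exact absurd (by rw [Subsingleton.elim x 0]; exact Metric.mem_ball_self one_pos) hx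
  · exact h

end

end

theorem theorem3p6 (n m k : ℕ) [NeZero m] (hm : 2 ≤ m) (hk : 1 ≤ k)
    (p q r : ℝ) (ps : Fin m → ℝ) (hq : 1 < q) (hqp : q < p) (hps : ∀ i, 1 < ps i)
    (hp : 1 / p = ∑ i, 1 / ps i) (hr : 1 / r = 1 / q - 1 / p)
    (s : Fin m → ℝ≥0∞) (s₀ : ℝ≥0∞) (T : LpMultilinear n m s s₀) (hT : IsNondegenerateCZO T)
    (b : RSpace n → ℝ) (hb : MemLpLoc (k : ℝ≥0∞) b)
    (hbdd : IsBoundedOnDomain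
      (commutatorDomain s (fun i => ENNReal.ofReal (ps i)) b 0 k)
      (iteratedCommutator b 0 k T.onFunctions)
      (fun i => ENNReal.ofReal (ps i)) (ENNReal.ofReal q)) :
    MemLpModConst (ENNReal.ofReal (k * r)) b := by
  have hn : 0 < n := by
    obtain ⟨-, K, C, ω, -, -, hK⟩ := hT
    exact hK.dim_pos
  -- `q < p` makes `1 / r` positive, and `1 / r < 1 / q < 1` then gives `r > 1`, as the conjugate
  -- exponent requires.
  have hr1 : 1 < r := by
    have h1 : 1 / p < 1 / q := one_div_lt_one_div_of_lt (by linarith) hqp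
    have h2 : 0 < 1 / r := by rw [hr]; linarith
    have h3 : 1 / r < 1 := by
      have h4 : 1 / q < 1 := by rw [div_lt_one (by linarith)]; exact hq
      have h5 : 0 < 1 / p := one_div_pos.2 (by linarith)
      rw [hr]; linarith
    have h6 : 0 < r := one_div_pos.1 h2
    rwa [div_lt_one h6] at h3
  have hae := hb.aestronglyMeasurable.ae_eq_mk
  have hmk := hb.aestronglyMeasurable.stronglyMeasurable_mk.measurable
  exact (memLpModConst_of_measurable hn hm hk hq hps hp hr1 hr hT hmk (hb.congr_ae hae)
    (hbdd.congr_ae hae)).congr_ae hae.symm
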